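/- **Soft edge, real sample covariance matrices.** Let $Q$ be a probability distribution on $\mathbb{R}$ with expectation $0$, variance $1$ and finite fourth moment $b$, and let $\alpha \ge 0$ be a fixed integer. For each integer $N \ge \alpha$ put $n = N$, $m = N-\alpha$, let $X$ be an $n\times m$ random matrix whose entries are i.i.d. real random variables with distribution $Q$, and for $\mu,\nu\in\mathbb{C}$ put $$ f(n,m;\mu,\nu) := \mathbb{E}\big(\det(X^TX-\mu)\,\det(X^TX-\nu)\big), $$ the product of determinants being integrable (a $0\times 0$ determinant is $1$). For $\mu,\nu\in\mathbb{R}$ set $$ Z_N(\mu,\nu) := \big(16N^2 + 4(\mu+\nu)N^{4/3} + \mu\nu N^{2/3}\big)^{\alpha/2}\exp\big(-4N-\tfrac12(\mu+\nu)N^{1/3}\big). $$ Let $\mathrm{Ai}$ be the Airy function and let $$ \widetilde{\mathbb{A}}(x,y) := \frac{2\,\mathrm{Ai}(x)\mathrm{Ai}'(y)-2\,\mathrm{Ai}'(x)\mathrm{Ai}(y)}{(x-y)^3} + \frac{(x+y)\,\mathrm{Ai}(x)\mathrm{Ai}(y)-2\,\mathrm{Ai}'(x)\mathrm{Ai}'(y)}{(x-y)^2}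 \qquad (x\neq y), $$ with $\widetilde{\mathbb{A}}(x,x) := \lim_{y\to x,\, y\neq x}\widetilde{\mathbb{A}}(x,y)$; the function $\widetilde{\mathbb{A}}$ so defined is continuous on $\mathbb{R}^2$. Then for all $\mu,\nu\in\mathbb{R}$, $$ \lim_{N\to\infty}\left(4\,Z_N(2^{4/3}\mu,2^{4/3}\nu)\cdot\frac{f(n,m;\,4N+2^{4/3}\mu N^{1/3},\,4N+2^{4/3}\nu N^{1/3})}{n!\,m!}\right) = \exp(b-3)\,\widetilde{\mathbb{A}}(\mu,\nu). $$ -/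

import Mathlib

open MeasureTheory ProbabilityTheory Filter Topology

noncomputable section

/-- The integrand `exp (z ^ 3 / 3 - x z)` at the point `z = 1 + i t` of the line `Re z = 1`. -/
def airyIntegrand (x t : ℝ) : ℂ :=
  Complex.exp ((1 + t * Complex.I) ^ 3 / 3 - x * (1 + t * Complex.I))

/-- The Airy function on the real line, through its (absolutely convergent) contour integral
`Ai x = (1 / (2 π i)) ∫ exp (z ^ 3 / 3 - x z) dz` over the line `z = 1 + i t`, `t ∈ ℝ`.
The integral is real since the integrand at `-t` is conjugate to that at `t`; the real part
only serves to get a real-valued function. -/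
def airyAi (x : ℝ) : ℝ := ((1 / (2 * Real.pi) : ℂ) * ∫ t : ℝ, airyIntegrand x t).re

theorem norm_airyIntegrand (x t : ℝ) :
    ‖airyIntegrand x t‖ = Real.exp (1 / 3 - x) * Real.exp (-1 * t ^ 2) := by
  rw [airyIntegrand, Complex.norm_exp, ← Real.exp_add]
  congr 1
  have h : ((1 + t * Complex.I) ^ 3 / 3 - x * (1 + t * Complex.I) : ℂ)
      = ((1 / 3 - x - t ^ 2 : ℝ) : ℂ) + ((t - t ^ 3 / 3 - x * t : ℝ) : ℂ) * Complex.I := by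
    push_cast
    ring_nf
    rw [show Complex.I ^ 3 = -Complex.I by rw [pow_succ, Complex.I_sq]; ring, Complex.I_sq]
    ring
  rw [h]
  simp only [Complex.add_re, Complex.ofReal_re, Complex.re_ofReal_mul, Complex.I_re, mul_zero]
  ring

theorem continuous_airyIntegrand (x : ℝ) : Continuous (airyIntegrand x) := by
  unfold airyIntegrand
  fun_prop

theorem integrable_airyIntegrand (x : ℝ) : Integrable (airyIntegrand x) := by
  have h := (integrable_exp_neg_mul_sq (b := 1) one_pos).const_mul (Real.exp (1 / 3 - x))
  exact h.mono' (continuous_airyIntegrand x).aestronglyMeasurable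
    (ae_of_all _ fun t => (norm_airyIntegrand x t).le)

/-- The Airy function is differentiable, so that `deriv airyAi` is its derivative `Ai'`. -/
theorem differentiable_airyAi : Differentiable ℝ airyAi := by
  intro x
  have hb : Integrable (fun t : ℝ => Real.exp (1 / 3 - x + 1) * Real.exp (-1 * t ^ 2)
      + Real.exp (1 / 3 - x + 1) * ‖t * Real.exp (-1 * t ^ 2)‖) :=
    ((integrable_exp_neg_mul_sq (b := 1) one_pos).const_mul _).add
      ((integrable_mul_exp_neg_mul_sq (b := 1) one_pos).norm.const_mul _)
  have key := hasDerivAt_integral_of_dominated_loc_of_deriv_le (𝕜 := ℝ) (μ := volume)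
    (F := airyIntegrand) (F' := fun y t => airyIntegrand y t * (-(1 + t * Complex.I)))
    (x₀ := x) (Metric.ball_mem_nhds x one_pos)
    (Eventually.of_forall fun y => (continuous_airyIntegrand y).aestronglyMeasurable)
    (integrable_airyIntegrand x)
    (Continuous.aestronglyMeasurable
      ((continuous_airyIntegrand x).mul (by fun_prop)))
    (ae_of_all _ fun t y hy => ?_) hb (ae_of_all _ fun t y _ => ?_)
  · have h := (key.2.const_mul (1 / (2 * Real.pi) : ℂ)).differentiableAt
    exact (Complex.reCLM.differentiableAt).comp x h
  · have hy' : x - 1 < y := by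
      have := (abs_lt.1 (by simpa [Real.dist_eq] using hy : |y - x| < 1)).1
      linarith
    rw [norm_mul, norm_airyIntegrand, norm_neg, norm_mul, Real.norm_eq_abs,
      Real.norm_of_nonneg (Real.exp_pos _).le]
    have h1 : ‖(1 + t * Complex.I : ℂ)‖ ≤ 1 + |t| := by
      refine (norm_add_le _ _).trans ?_
      simp
    have h2 : Real.exp (1 / 3 - y) ≤ Real.exp (1 / 3 - x + 1) :=
      Real.exp_le_exp.2 (by linarith)
    calc Real.exp (1 / 3 - y) * Real.exp (-1 * t ^ 2) * ‖(1 + t * Complex.I : ℂ)‖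
        ≤ Real.exp (1 / 3 - x + 1) * Real.exp (-1 * t ^ 2) * (1 + |t|) := by gcongr
      _ = _ := by ring
  · have h1 : HasDerivAt (fun y : ℝ => ((1 + t * Complex.I) ^ 3 / 3 - y * (1 + t * Complex.I) : ℂ))
        (-(1 + t * Complex.I)) y := by
      have := ((Complex.ofRealCLM.hasDerivAt (x := y)).mul_const
        (1 + t * Complex.I : ℂ)).const_sub ((1 + t * Complex.I) ^ 3 / 3 : ℂ)
      simpa using this
    exact h1.cexp

/-- The formula of the "differentiated" Airy kernel, meaningful for `x ≠ y`. -/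
def diffAiryFormula (x y : ℝ) : ℝ :=
  (2 * airyAi x * deriv airyAi y - 2 * deriv airyAi x * airyAi y) / (x - y) ^ 3
    + ((x + y) * airyAi x * airyAi y - 2 * deriv airyAi x * deriv airyAi y) / (x - y) ^ 2

open Classical in
/-- The "differentiated" Airy kernel on `ℝ × ℝ`: the formula off the diagonal,
and its limit on the diagonal. -/
def diffAiryKernel (x y : ℝ) : ℝ :=
  if x = y then limUnder (𝓝[≠] x) (fun t => diffAiryFormula x t) else diffAiryFormula x y

/-- The product `det (Aᵀ A - z) det (Aᵀ A - w)` for a real matrix `A` and complex `z`, `w`. -/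
def detProduct {n m : ℕ} (A : Matrix (Fin n) (Fin m) ℝ) (z w : ℂ) : ℂ :=
  ((A.transpose * A).map (fun r : ℝ => (r : ℂ)) - z • (1 : Matrix (Fin m) (Fin m) ℂ)).det
    * ((A.transpose * A).map (fun r : ℝ => (r : ℂ)) - w • (1 : Matrix (Fin m) (Fin m) ℂ)).det

/-- The second-order correlation function `E (det (Xᵀ X - z) det (Xᵀ X - w))` of the
characteristic polynomial of the unrescaled real sample covariance matrix `Xᵀ X`. -/
def charPolyCorrelation {Ω : Type*} [MeasurableSpace Ω] {n m : ℕ} (P : Measure Ω)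
    (X : Ω → Matrix (Fin n) (Fin m) ℝ) (z w : ℂ) : ℂ :=
  ∫ ω, detProduct (X ω) z w ∂P

/-- The entries of the random matrix `X` are independent random variables,
each with distribution `Q`. -/
structure HasIIDEntries {Ω : Type*} [MeasurableSpace Ω] {n m : ℕ} (P : Measure Ω)
    (Q : Measure ℝ) (X : Ω → Matrix (Fin n) (Fin m) ℝ) : Prop where
  hasLaw : ∀ i j, HasLaw (fun ω => X ω i j) Q P
  indep : iIndepFun (fun (p : Fin n × Fin m) ω => X ω p.1 p.2) P

/-- The normalization `Z_N(μ, ν)` at the soft edge. -/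
def softEdgeNormalization (α N : ℕ) (μ ν : ℝ) : ℝ :=
  (16 * (N : ℝ) ^ 2 + 4 * (μ + ν) * (N : ℝ) ^ (4 / 3 : ℝ)
      + μ * ν * (N : ℝ) ^ (2 / 3 : ℝ)) ^ ((α : ℝ) / 2)
    * Real.exp (-4 * N - (μ + ν) / 2 * (N : ℝ) ^ (1 / 3 : ℝ))

/-- The point `4 N + 2 ^ (4/3) μ N ^ (1/3)` at the soft edge of the spectrum. -/
def softEdgePoint (N : ℕ) (μ : ℝ) : ℝ :=
  4 * N + (2 : ℝ) ^ (4 / 3 : ℝ) * μ * (N : ℝ) ^ (1 / 3 : ℝ)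

end

/-! Write f(n,m;z,w) for the averaged product of characteristic polynomials p(z)p(w) of the Gram
matrix of n rows of length m. Adding a row x perturbs the Gram matrix G by the rank-one matrix x xᵀ,
so p(z) changes by the quadratic form of adj(z - G) at x. The average over x involves only moments
up to order four. It closes up because tr adj(z - G) = p'(z), because (w - z) tr(adj(z - G) adj(w -
G)) = p'(z)p(w) - p(z)p'(w), and because diagonal cofactors are characteristic polynomials of Gram
matrices with one column fewer. The outcome, `gramCorr_succ`, is f(n+1,m) = D f(n,m) + (b-3) m
f(n,m-1) with D = (1-∂z)(1-∂w) - 2/(z-w) (∂z-∂w).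

This recursion is solved exactly. To a polynomial p attach the kernel K[p] = (z-w)⁻¹ (∂z-∂w)
((p'(z)p(w) - p(z)p'(w))/(z-w)). Then D K[p] = K[p - p'] (`stepRel_polyKernel`), and the initial
value zᵐwᵐ is a multiple of K[X^(m+2)] (`polyKernel_X_pow`). Pascal's rule expresses f(n,m) as a sum
over k of kernels of the Laguerre-type polynomials (1 - d/dX)^(n-k) X^(m-k+2). After division by n!
m! the k-th term carries the weight (b-3)^k/k! (`gramCorr_div_factorial`).

These polynomials are contour integrals of (1-z)^n z^(-K-1) e^(xz). At x = 4N the phase has a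
degenerate saddle at z = 1/2. On the scale l = (16N)^(1/3), with z = 1/2 + ω/l and x = 4N + ls, the
integrand tends to exp(sω - ω³/3), an Airy integrand, and a Gaussian dominates it uniformly in N and
k (`norm_edgeIntegrand_le`). Each kernel thus tends to the Airy kernel whatever k is, and dominated
convergence of the sum over k produces the factor e^(b-3) (`tendsto_edgeCorr_of_ne`).

The kernel formulas are singular at z = w, whereas the correlation function is entire in z. Cauchy's
formula on a large circle in z, which stays away from w, carries the limit to the diagonal. It also
shows that the Airy kernel extends continuously there (`tendsto_edgeCorr_airyCauchyKernel`,
`ofReal_diffAiryKernel`). -/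

open Polynomial in
/-- Continuous functions on `ℂ` that agree off the zeros of a nonzero polynomial agree. -/
theorem eq_of_continuous_of_eval_ne_zero {p : ℂ[X]} (hp : p ≠ 0) {f g : ℂ → ℂ}
    (hf : Continuous f) (hg : Continuous g) (h : ∀ t, p.eval t ≠ 0 → f t = g t) (t : ℂ) :
    f t = g t := by
  have hd : Dense {t : ℂ | p.eval t ≠ 0} := by
    have hfin : {t : ℂ | p.eval t = 0}.Finite := by
      have := p.roots.toFinset.finite_toSet
      refine this.subset fun t ht => ?_
      simpa [hp] using ht
    exact hfin.countable.dense_compl ℂ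
  exact congrFun (Continuous.ext_on hd hf hg fun t ht => h t ht) t

/-! ### Determinants, adjugates and resolvent-type identities -/

section LinearAlgebra

variable {m : Type*} [Fintype m] [DecidableEq m]

/-- The matrix determinant lemma, without an invertibility assumption. -/
theorem det_add_vecMulVec_complex (A : Matrix m m ℂ) (u v : m → ℂ) :
    (A + Matrix.vecMulVec u v).det = A.det + v ⬝ᵥ (A.adjugate.mulVec u) := by
  have key : ∀ B : Matrix m m ℂ, B.det ≠ 0 →
      (B + Matrix.vecMulVec u v).det = B.det + v ⬝ᵥ (B.adjugate.mulVec u) := by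
    intro B hB
    have hB' : IsUnit B.det := isUnit_iff_ne_zero.2 hB
    rw [Matrix.vecMulVec_eq Unit, Matrix.det_add_replicateCol_mul_replicateRow hB',
      Matrix.det_unique (n := Unit)]
    have : B⁻¹ = B.det⁻¹ • B.adjugate := by
      rw [Matrix.inv_def, Ring.inverse_eq_inv']
    rw [Matrix.add_apply, Matrix.one_apply_eq, mul_add, mul_one, this, Matrix.mul_assoc,
      Matrix.smul_mul, Matrix.mul_smul, Matrix.smul_apply]
    rw [← Matrix.replicateCol_mulVec, Matrix.replicateRow_mul_replicateCol_apply]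
    rw [smul_eq_mul, mul_inv_cancel_left₀ hB]
  have := eq_of_continuous_of_eval_ne_zero (p := (-A).charpoly)
    (f := fun t => (Matrix.scalar m t - -A + Matrix.vecMulVec u v).det)
    (g := fun t => (Matrix.scalar m t - -A).det
      + v ⬝ᵥ ((Matrix.scalar m t - -A).adjugate.mulVec u))
    (Matrix.charpoly_monic _).ne_zero ?_ ?_
    (fun t ht => key _ (by rwa [Matrix.eval_charpoly] at ht)) 0
  · simpa using this
  · have : Continuous fun t : ℂ => Matrix.scalar m t := by
      simp only [Matrix.scalar_apply]; fun_prop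
    fun_prop
  · have : Continuous fun t : ℂ => Matrix.scalar m t := by
      simp only [Matrix.scalar_apply]; fun_prop
    have h2 : Continuous fun t : ℂ => (Matrix.scalar m t - -A).adjugate := by fun_prop
    exact Continuous.add (by fun_prop) (continuous_const.dotProduct (h2.matrix_mulVec continuous_const))

/-- Off the spectrum put B = z - A and expand det(B + r) = det B · (1 + r tr B⁻¹ + O(r²)); the
coefficient of r is tr adj B. Continuity covers the eigenvalues. -/
theorem eval_derivative_charpoly (A : Matrix m m ℂ) (z : ℂ) :
    A.charpoly.derivative.eval z = (Matrix.scalar m z - A).adjugate.trace := by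
  refine eq_of_continuous_of_eval_ne_zero (p := A.charpoly)
    (f := fun z => A.charpoly.derivative.eval z)
    (g := fun z => (Matrix.scalar m z - A).adjugate.trace)
    (Matrix.charpoly_monic _).ne_zero (by fun_prop) ?_ (fun t ht => ?_) z
  · have : Continuous fun t : ℂ => Matrix.scalar m t := by
      simp only [Matrix.scalar_apply]; fun_prop
    fun_prop
  · rw [Matrix.eval_charpoly] at ht
    set B := Matrix.scalar m t - A with hB
    have hB' : IsUnit B.det := isUnit_iff_ne_zero.2 ht
    have h1 : ∀ r : ℂ, A.charpoly.eval (t + r) = B.det *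
        (1 + B⁻¹.trace * r
          + (Matrix.det (1 + (Polynomial.X : Polynomial ℂ) • B⁻¹.map Polynomial.C)).divX.divX.eval r
            * r ^ 2) := by
      intro r
      rw [← Matrix.det_one_add_smul, ← Matrix.det_mul, Matrix.mul_add, Matrix.mul_one,
        Matrix.mul_smul, Matrix.mul_nonsing_inv _ hB', Matrix.eval_charpoly, hB, map_add]
      congr 1
      rw [Matrix.smul_one_eq_diagonal, Matrix.scalar_apply r]
      abel
    set q := (Matrix.det (1 + (Polynomial.X : Polynomial ℂ) • B⁻¹.map Polynomial.C)).divX.divX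
    have h2 : HasDerivAt (fun r : ℂ => A.charpoly.eval (t + r))
        (A.charpoly.derivative.eval (t + 0)) 0 :=
      HasDerivAt.comp_const_add t 0 (A.charpoly.hasDerivAt (t + 0))
    have h3 : HasDerivAt (fun r : ℂ => B.det * (1 + B⁻¹.trace * r + q.eval r * r ^ 2))
        (B.det * (B⁻¹.trace * 1 + (q.derivative.eval 0 * (0:ℂ) ^ 2
          + q.eval 0 * (((2 : ℕ) : ℂ) * (0:ℂ) ^ (2 - 1) * 1)))) 0 := by
      refine HasDerivAt.const_mul _ ?_
      have := (((hasDerivAt_id (0:ℂ)).const_mul B⁻¹.trace).const_add 1).add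
        ((q.hasDerivAt 0).mul ((hasDerivAt_id (0:ℂ)).pow 2))
      exact this
    have h4 := h2.unique (h3.congr_of_eventuallyEq (Eventually.of_forall h1))
    rw [add_zero] at h4
    rw [h4, Matrix.inv_def, Ring.inverse_eq_inv', Matrix.trace_smul, smul_eq_mul]
    field_simp
    simp

/-- The resolvent identity with denominators cleared: insert (w - A) - (z - A) between the two
adjugates and let each adjugate cancel its own matrix. This is the source of the 1/(z - w) term in
the recursion. -/
theorem trace_adjugate_mul_adjugate (A : Matrix m m ℂ) (z w : ℂ) :
    (w - z) * ((Matrix.scalar m z - A).adjugate * (Matrix.scalar m w - A).adjugate).trace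
      = A.charpoly.derivative.eval z * A.charpoly.eval w
        - A.charpoly.eval z * A.charpoly.derivative.eval w := by
  have key : (Matrix.scalar m z - A).adjugate
      * ((Matrix.scalar m w - A) - (Matrix.scalar m z - A)) * (Matrix.scalar m w - A).adjugate
      = (Matrix.scalar m w - A).det • (Matrix.scalar m z - A).adjugate
        - (Matrix.scalar m z - A).det • (Matrix.scalar m w - A).adjugate := by
    rw [mul_sub, sub_mul, mul_assoc, Matrix.mul_adjugate, Matrix.adjugate_mul]
    simp
  have h2 : (Matrix.scalar m w - A) - (Matrix.scalar m z - A) = (w - z) • 1 := by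
    rw [Matrix.smul_one_eq_diagonal]
    simp
  rw [h2] at key
  have := congrArg Matrix.trace key
  simp only [Matrix.mul_smul, mul_one, Matrix.smul_mul, Matrix.trace_smul, Matrix.trace_sub,
    smul_eq_mul] at this
  rw [this, eval_derivative_charpoly, eval_derivative_charpoly, Matrix.eval_charpoly,
    Matrix.eval_charpoly]
  ring

end LinearAlgebra

/-! ### Gram matrices and their rank-one updates -/

theorem adjugate_scalar_sub_apply_self {m : ℕ} (A : Matrix (Fin (m + 1)) (Fin (m + 1)) ℂ) (z : ℂ)
    (i : Fin (m + 1)) :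
    (Matrix.scalar (Fin (m + 1)) z - A).adjugate i i
      = (A.submatrix i.succAbove i.succAbove).charpoly.eval z := by
  rw [Matrix.adjugate_fin_succ_eq_det_submatrix, Matrix.eval_charpoly, ← two_mul, pow_mul]
  simp only [even_two, Even.neg_pow, one_pow, one_mul]
  congr 1
  ext j k
  simp [Matrix.diagonal_apply]

/-- The complexified Gram matrix `Yᵀ Y` of a family of row vectors. -/
def gramC {ι m : Type*} [Fintype ι] (Y : ι → m → ℝ) : Matrix m m ℂ :=
  Matrix.of fun a b => ∑ i, (Y i a : ℂ) * (Y i b : ℂ)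

theorem gramC_apply {ι m : Type*} [Fintype ι] (Y : ι → m → ℝ) (a b : m) :
    gramC Y a b = ∑ i, (Y i a : ℂ) * (Y i b : ℂ) := rfl

theorem gramC_submatrix {ι m l : Type*} [Fintype ι] (Y : ι → m → ℝ) (f : l → m) :
    (gramC Y).submatrix f f = gramC fun i a => Y i (f a) := rfl

theorem gramC_transpose {ι m : Type*} [Fintype ι] (Y : ι → m → ℝ) :
    (gramC Y).transpose = gramC Y := by
  ext a b
  simp [gramC_apply, mul_comm]

theorem gramC_cons {n : ℕ} {m : Type*} (x : m → ℝ) (Y : Fin n → m → ℝ) :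
    gramC (Fin.cons x Y : Fin (n + 1) → m → ℝ)
      = gramC Y + Matrix.vecMulVec (fun a => (x a : ℂ)) (fun a => (x a : ℂ)) := by
  ext a b
  simp [gramC_apply, Fin.sum_univ_succ, Matrix.vecMulVec_apply, add_comm]

theorem detProduct_eq_charpoly {n m : ℕ} (A : Matrix (Fin n) (Fin m) ℝ) (z w : ℂ) :
    detProduct A z w = (gramC A).charpoly.eval z * (gramC A).charpoly.eval w := by
  have h : (A.transpose * A).map (fun r : ℝ => (r : ℂ)) = gramC A := by
    ext a b
    simp only [Matrix.map_apply, Matrix.mul_apply, Matrix.transpose_apply, Complex.ofReal_sum,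
      Complex.ofReal_mul]
    exact (gramC_apply A a b).symm
  have h2 : ∀ z : ℂ, (gramC A - z • (1 : Matrix (Fin m) (Fin m) ℂ)).det
      = (-1) ^ m * (gramC A).charpoly.eval z := by
    intro z
    rw [Matrix.eval_charpoly, Matrix.smul_one_eq_diagonal, ← neg_sub, Matrix.det_neg]
    simp
  rw [detProduct, h, h2, h2, mul_mul_mul_comm, ← mul_pow]
  simp

theorem eval_charpoly_gramC_cons {n : ℕ} {m : Type*} [Fintype m] [DecidableEq m]
    (x : m → ℝ) (Y : Fin n → m → ℝ) (z : ℂ) :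
    (gramC (Fin.cons x Y : Fin (n + 1) → m → ℝ)).charpoly.eval z
      = (gramC Y).charpoly.eval z
        - ∑ i, ∑ j, (x i : ℂ) * (x j : ℂ) * (Matrix.scalar m z - gramC Y).adjugate i j := by
  rw [Matrix.eval_charpoly, Matrix.eval_charpoly, gramC_cons]
  have : Matrix.scalar m z - (gramC Y + Matrix.vecMulVec (fun a => (x a : ℂ)) (fun a => (x a : ℂ)))
      = (Matrix.scalar m z - gramC Y)
        + Matrix.vecMulVec (fun a => -(x a : ℂ)) (fun a => (x a : ℂ)) := by
    ext a b
    simp [Matrix.vecMulVec_apply]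
    ring
  rw [this, det_add_vecMulVec_complex]
  generalize Matrix.scalar m z - gramC Y = B
  rw [sub_eq_add_neg]
  congr 1
  simp only [dotProduct, Matrix.mulVec, Finset.mul_sum]
  rw [← Finset.sum_neg_distrib]
  refine Finset.sum_congr rfl fun i _ => ?_
  rw [← Finset.sum_neg_distrib]
  refine Finset.sum_congr rfl fun j _ => ?_
  ring

/-! ### Growth in each row -/

section Growth

variable {m : Type*} [Fintype m]

/-- A rank-one term enters a determinant at most linearly in each of its two vectors, however large
the matrix. A degree count in the entries would give a power growing with the dimension, for which
four moments would not suffice. -/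
theorem exists_norm_det_add_sum_vecMulVec_le [DecidableEq m] (n : ℕ) (B : Matrix m m ℂ) :
    ∃ C : ℝ, 0 ≤ C ∧ ∀ U V : Fin n → m → ℂ,
      ‖(B + ∑ i, Matrix.vecMulVec (U i) (V i)).det‖ ≤ C * ∏ i, ((1 + ‖U i‖) * (1 + ‖V i‖)) := by
  induction n generalizing B with
  | zero => exact ⟨‖B.det‖, norm_nonneg _, fun U V => by simp⟩
  | succ n ih =>
    choose C hC0 hC using ih
    refine ⟨C B + ∑ i, ∑ j, C (B.updateRow j (Pi.single i 1)),
      add_nonneg (hC0 _) (Finset.sum_nonneg fun i _ => Finset.sum_nonneg fun j _ => hC0 _), ?_⟩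
    intro U V
    rw [Fin.sum_univ_succ, add_comm (Matrix.vecMulVec _ _), ← add_assoc, det_add_vecMulVec_complex,
      Fin.prod_univ_succ]
    set M := B + ∑ i : Fin n, Matrix.vecMulVec (U i.succ) (V i.succ) with hM
    set W := ∏ i : Fin n, ((1 + ‖U i.succ‖) * (1 + ‖V i.succ‖)) with hW
    have hW0 : 0 ≤ W := Finset.prod_nonneg fun i _ => by positivity
    have h1 : ‖M.det‖ ≤ C B * W := hC B _ _
    have hadj : ∀ i j, ‖M.adjugate i j‖ ≤ C (B.updateRow j (Pi.single i 1)) * W := by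
      intro i j
      rw [Matrix.adjugate_apply]
      -- Cofactors have the same shape: replacing row j of the sum amounts to replacing it in B and
      -- zeroing the j-th entry of every left vector. This is why the induction must run over all B.
      have hrow : M.updateRow j (Pi.single i 1) = B.updateRow j (Pi.single i 1)
          + ∑ k : Fin n, Matrix.vecMulVec (Function.update (U k.succ) j 0) (V k.succ) := by
        ext a b
        rw [Matrix.add_apply, Matrix.sum_apply]
        by_cases ha : a = j
        · subst ha
          simp [Matrix.vecMulVec_apply]
        · simp [Matrix.updateRow_ne ha, hM, Matrix.sum_apply, Matrix.vecMulVec_apply,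
            Function.update_of_ne ha]
      rw [hrow]
      refine (hC _ _ _).trans ?_
      refine mul_le_mul_of_nonneg_left ?_ (hC0 _)
      refine Finset.prod_le_prod (fun k _ => by positivity) fun k _ => ?_
      gcongr
      refine (pi_norm_le_iff_of_nonneg (norm_nonneg _)).2 fun a => ?_
      by_cases ha : a = j
      · subst ha; simp
      · rw [Function.update_of_ne ha]; exact norm_le_pi_norm _ a
    have h2 : ‖V 0 ⬝ᵥ M.adjugate.mulVec (U 0)‖
        ≤ (∑ i, ∑ j, C (B.updateRow j (Pi.single i 1))) * W * (‖U 0‖ * ‖V 0‖) := by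
      simp only [dotProduct, Matrix.mulVec, Finset.mul_sum, Finset.sum_mul]
      refine (norm_sum_le _ _).trans (Finset.sum_le_sum fun i _ => ?_)
      refine (norm_sum_le _ _).trans (Finset.sum_le_sum fun j _ => ?_)
      rw [norm_mul, norm_mul]
      calc ‖V 0 i‖ * (‖M.adjugate i j‖ * ‖U 0 j‖)
          ≤ ‖V 0‖ * (C (B.updateRow j (Pi.single i 1)) * W * ‖U 0‖) := by
            gcongr
            · exact norm_le_pi_norm _ i
            · exact mul_nonneg (hC0 _) hW0
            · exact hadj i j
            · exact norm_le_pi_norm _ j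
        _ = _ := by ring
    have hS : 0 ≤ ∑ i, ∑ j, C (B.updateRow j (Pi.single i 1)) :=
      Finset.sum_nonneg fun i _ => Finset.sum_nonneg fun j _ => hC0 _
    set S := ∑ i, ∑ j, C (B.updateRow j (Pi.single i 1))
    refine (norm_add_le _ _).trans ((add_le_add h1 h2).trans ?_)
    have hu := norm_nonneg (U 0)
    have hv := norm_nonneg (V 0)
    have h3 : 1 ≤ (1 + ‖U 0‖) * (1 + ‖V 0‖) := by nlinarith [mul_nonneg hu hv]
    have h4 : ‖U 0‖ * ‖V 0‖ ≤ (1 + ‖U 0‖) * (1 + ‖V 0‖) := by nlinarith [mul_nonneg hu hv]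
    have e1 := mul_le_mul_of_nonneg_left h3 (mul_nonneg (hC0 B) hW0)
    have e2 := mul_le_mul_of_nonneg_left h4 (mul_nonneg hS hW0)
    calc C B * W + S * W * (‖U 0‖ * ‖V 0‖)
        ≤ C B * W * ((1 + ‖U 0‖) * (1 + ‖V 0‖)) + S * W * ((1 + ‖U 0‖) * (1 + ‖V 0‖)) := by
          linarith
      _ = _ := by ring

theorem norm_ofReal_comp (x : m → ℝ) : ‖fun a => (x a : ℂ)‖ = ‖x‖ := by
  simp [Pi.norm_def]

/-- A function of the rows of a matrix that is measurable and grows at most quadratically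
in each row. -/
structure QuadraticGrowth {n : ℕ} (h : (Fin n → m → ℝ) → ℂ) : Prop where
  continuous : Continuous h
  bound : ∃ C : ℝ, 0 ≤ C ∧ ∀ Y, ‖h Y‖ ≤ C * ∏ i, (1 + ‖Y i‖) ^ 2

theorem continuous_gramC {n : ℕ} {m : Type*} : Continuous (fun Y : Fin n → m → ℝ => gramC Y) := by
  refine continuous_matrix fun a b => ?_
  simp only [gramC_apply]
  fun_prop

theorem quadraticGrowth_eval_charpoly [DecidableEq m] {n : ℕ} (z : ℂ) :
    QuadraticGrowth (fun Y : Fin n → m → ℝ => (gramC Y).charpoly.eval z) := by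
  simp only [Matrix.eval_charpoly]
  refine ⟨?_, ?_⟩
  · have := continuous_gramC (m := m) (n := n)
    fun_prop
  · obtain ⟨C, hC0, hC⟩ := exists_norm_det_add_sum_vecMulVec_le n (Matrix.scalar m z)
    refine ⟨C, hC0, fun Y => ?_⟩
    have := hC (fun i a => -(Y i a : ℂ)) (fun i a => (Y i a : ℂ))
    have e1 : ∀ i, ‖fun a => -(Y i a : ℂ)‖ = ‖Y i‖ := fun i => by
      rw [← norm_ofReal_comp (Y i), ← norm_neg (fun a => (Y i a : ℂ))]; rfl
    simp only [norm_ofReal_comp, e1, ← pow_two] at this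
    convert this using 3
    ext a b
    rw [Matrix.sub_apply, Matrix.add_apply, Matrix.sum_apply, gramC_apply]
    simp [Matrix.vecMulVec_apply, sub_eq_add_neg]

theorem quadraticGrowth_adjugate [DecidableEq m] {n : ℕ} (z : ℂ) (i j : m) :
    QuadraticGrowth (fun Y : Fin n → m → ℝ => (Matrix.scalar m z - gramC Y).adjugate i j) := by
  refine ⟨?_, ?_⟩
  · have := continuous_gramC (m := m) (n := n)
    have h2 : Continuous fun Y : Fin n → m → ℝ => (Matrix.scalar m z - gramC Y).adjugate := by
      fun_prop
    exact h2.matrix_elem i j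
  · obtain ⟨C, hC0, hC⟩ := exists_norm_det_add_sum_vecMulVec_le n
      ((Matrix.scalar m z).updateRow j (Pi.single i 1))
    refine ⟨C, hC0, fun Y => ?_⟩
    have := hC (fun k => Function.update (fun a => -(Y k a : ℂ)) j 0) (fun i a => (Y i a : ℂ))
    have e1 : ∀ k, ‖Function.update (fun a => -(Y k a : ℂ)) j 0‖ ≤ ‖Y k‖ := fun k => by
      refine (pi_norm_le_iff_of_nonneg (norm_nonneg _)).2 fun a => ?_
      by_cases ha : a = j
      · subst ha; simp
      · rw [Function.update_of_ne ha]; simpa using norm_le_pi_norm (Y k) a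
    rw [Matrix.adjugate_apply]
    have hrow : (Matrix.scalar m z - gramC Y).updateRow j (Pi.single i 1)
        = (Matrix.scalar m z).updateRow j (Pi.single i 1)
          + ∑ k : Fin n, Matrix.vecMulVec (Function.update (fun a => -(Y k a : ℂ)) j 0)
            (fun a => (Y k a : ℂ)) := by
      ext a b
      rw [Matrix.add_apply, Matrix.sum_apply]
      by_cases ha : a = j
      · subst ha
        simp [Matrix.vecMulVec_apply]
      · simp [Matrix.updateRow_ne ha, gramC_apply, Matrix.vecMulVec_apply,
          Function.update_of_ne ha, sub_eq_add_neg]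
    rw [hrow]
    refine this.trans (mul_le_mul_of_nonneg_left ?_ hC0)
    refine Finset.prod_le_prod (fun k _ => by positivity) fun k _ => ?_
    rw [norm_ofReal_comp, pow_two]
    gcongr
    exact e1 k

end Growth

/-! ### Integrability under a finite fourth moment -/

section Integrability

/-- The law of a row with `m` independent entries of law `Q`. -/
noncomputable abbrev rowLaw (Q : Measure ℝ) (m : ℕ) : Measure (Fin m → ℝ) :=
  Measure.pi fun _ => Q

/-- The law of an `n × m` matrix with independent entries of law `Q`. -/
noncomputable abbrev matrixLaw (Q : Measure ℝ) (n m : ℕ) : Measure (Fin n → Fin m → ℝ) :=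
  Measure.pi fun _ => rowLaw Q m

variable {Q : Measure ℝ} [IsProbabilityMeasure Q]

theorem integrable_one_add_norm_pow (hfinite : MemLp (fun x : ℝ => x) 4 Q) (m : ℕ) :
    Integrable (fun x : Fin m → ℝ => (1 + ‖x‖) ^ 4) (rowLaw Q m) := by
  have h1 : ∀ a : Fin m, MemLp (fun x : Fin m → ℝ => x a) 4 (rowLaw Q m) := fun a =>
    hfinite.comp_measurePreserving (measurePreserving_eval (fun _ : Fin m => Q) a)
  have h2 : MemLp (fun x : Fin m → ℝ => 1 + ∑ a, ‖x a‖) 4 (rowLaw Q m) :=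
by
    have hs : MemLp (fun x : Fin m → ℝ => ∑ a, ‖x a‖) 4 (rowLaw Q m) :=
      memLp_finsetSum (f := fun (a : Fin m) (x : Fin m → ℝ) => ‖x a‖) Finset.univ
        fun a _ => (h1 a).norm
    have hc : MemLp (fun _ : Fin m → ℝ => (1 : ℝ)) 4 (rowLaw Q m) := memLp_const 1
    exact hc.add hs
  have h3 := MemLp.integrable_norm_pow (p := 4) (by exact_mod_cast h2) (by norm_num)
  refine h3.mono' (by fun_prop) (ae_of_all _ fun x => ?_)
  rw [Real.norm_of_nonneg (by positivity)]
  gcongr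
  have : 0 ≤ ∑ a, ‖x a‖ := Finset.sum_nonneg fun a _ => norm_nonneg _
  rw [Real.norm_of_nonneg (by positivity)]
  gcongr
  refine (pi_norm_le_iff_of_nonneg this).2 fun a => ?_
  exact Finset.single_le_sum (f := fun a => ‖x a‖) (fun a _ => norm_nonneg _) (Finset.mem_univ a)

/-- The product is dominated by quartic factors, one for each row; the rows are independent, so the
fourth moment is enough. -/
theorem QuadraticGrowth.integrable_mul (hfinite : MemLp (fun x : ℝ => x) 4 Q) {n m : ℕ}
    {g h : (Fin n → Fin m → ℝ) → ℂ} (hg : QuadraticGrowth g) (hh : QuadraticGrowth h) :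
    Integrable (fun Y => g Y * h Y) (matrixLaw Q n m) := by
  obtain ⟨C, hC0, hC⟩ := hg.bound
  obtain ⟨D, hD0, hD⟩ := hh.bound
  have h1 : Integrable (fun Y : Fin n → Fin m → ℝ => ∏ i, (1 + ‖Y i‖) ^ 4) (matrixLaw Q n m) :=
    Integrable.fintype_prod (f := fun (_ : Fin n) (x : Fin m → ℝ) => (1 + ‖x‖) ^ 4)
      fun _ => integrable_one_add_norm_pow hfinite m
  refine (h1.const_mul (C * D)).mono' (hg.continuous.mul hh.continuous).aestronglyMeasurable
    (ae_of_all _ fun Y => ?_)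
  have hp : 0 ≤ ∏ i, (1 + ‖Y i‖) ^ 2 := Finset.prod_nonneg fun i _ => by positivity
  rw [norm_mul]
  refine (mul_le_mul (hC Y) (hD Y) (norm_nonneg _) (mul_nonneg hC0 hp)).trans_eq ?_
  rw [mul_mul_mul_comm, ← Finset.prod_mul_distrib]
  congr 1
  refine Finset.prod_congr rfl fun i _ => ?_
  ring

theorem QuadraticGrowth.sum {n : ℕ} {m : Type*} [Fintype m] {κ : Type*}
    (s : Finset κ) {h : κ → (Fin n → m → ℝ) → ℂ} (hh : ∀ k, QuadraticGrowth (h k)) :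
    QuadraticGrowth (fun Y => ∑ k ∈ s, h k Y) := by
  choose C hC0 hC using fun k => (hh k).bound
  refine ⟨continuous_finsetSum _ fun k _ => (hh k).continuous, ∑ k ∈ s, C k,
    Finset.sum_nonneg fun k _ => hC0 k, fun Y => ?_⟩
  rw [Finset.sum_mul]
  exact (norm_sum_le _ _).trans (Finset.sum_le_sum fun k _ => hC k Y)

theorem quadraticGrowth_derivative_charpoly {n : ℕ} {m : Type*} [Fintype m] [DecidableEq m]
    (z : ℂ) : QuadraticGrowth
      (fun Y : Fin n → m → ℝ => (gramC Y).charpoly.derivative.eval z) := by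
  simp only [eval_derivative_charpoly]
  exact QuadraticGrowth.sum _ fun k => quadraticGrowth_adjugate z k k

end Integrability

/-! ### Mixed moments of one row -/

section Moments

variable {Q : Measure ℝ} [IsProbabilityMeasure Q]

theorem prod_pow_ite_eq {m : ℕ} (x : Fin m → ℝ) (i : Fin m) :
    ∏ p, x p ^ (if p = i then 1 else 0) = x i := by
  simp [pow_ite]

theorem integral_mul_rowLaw (hmean : ∫ x, x ∂Q = 0) (hsq : ∫ x, x ^ 2 ∂Q = 1) {m : ℕ}
    (i j : Fin m) :
    ∫ x : Fin m → ℝ, x i * x j ∂(rowLaw Q m) = if i = j then 1 else 0 := by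
  have hrep : ∀ x : Fin m → ℝ, x i * x j
      = ∏ p, x p ^ ((if p = i then 1 else 0) + (if p = j then 1 else 0)) := by
    intro x
    simp only [pow_add, Finset.prod_mul_distrib, prod_pow_ite_eq]
  simp_rw [hrep]
  rw [integral_fintype_prod_eq_prod
    (f := fun (p : Fin m) (t : ℝ) => t ^ ((if p = i then 1 else 0) + (if p = j then 1 else 0)))]
  split_ifs with h
  · subst h
    refine Finset.prod_eq_one fun p _ => ?_
    by_cases hp : p = i <;> simp [hp, hsq]
  · refine Finset.prod_eq_zero (Finset.mem_univ i) ?_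
    simp [h, hmean]

/-- By independence the moment factors over the multiplicities of the indices. A coordinate of
multiplicity one kills it, and two distinct pairs give 1. If all four indices coincide, the three
pairings already count 3, which leaves the correction b - 3. -/
theorem integral_mul_four_rowLaw {b : ℝ} (hmean : ∫ x, x ∂Q = 0) (hsq : ∫ x, x ^ 2 ∂Q = 1)
    (hfourth : ∫ x, x ^ 4 ∂Q = b) {m : ℕ} (i j k l : Fin m) :
    ∫ x : Fin m → ℝ, x i * x j * (x k * x l) ∂(rowLaw Q m)
      = (if i = j then 1 else 0) * (if k = l then 1 else 0)
        + (if i = k then 1 else 0) * (if j = l then 1 else 0)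
        + (if i = l then 1 else 0) * (if j = k then 1 else 0)
        + (b - 3) * ((if i = j then 1 else 0) * ((if j = k then 1 else 0)
          * (if k = l then 1 else 0))) := by
  -- `e p` is the multiplicity of `p` among the four indices.
  set e : Fin m → ℕ := fun p => (if p = i then 1 else 0) + (if p = j then 1 else 0)
    + ((if p = k then 1 else 0) + (if p = l then 1 else 0)) with he
  have hrep : ∀ x : Fin m → ℝ, x i * x j * (x k * x l) = ∏ p, x p ^ e p := by
    intro x
    simp only [he, pow_add, Finset.prod_mul_distrib, prod_pow_ite_eq]
  simp_rw [hrep]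
  rw [integral_fintype_prod_eq_prod (f := fun (p : Fin m) (t : ℝ) => t ^ e p)]
  have hzero : ∀ p, e p = 1 → ∏ p, ∫ t, t ^ e p ∂Q = 0 := fun p hp =>
    Finset.prod_eq_zero (Finset.mem_univ p) (by simp [hp, hmean])
  have hone : (∀ p, e p = 0 ∨ e p = 2) → ∏ p, ∫ t, t ^ e p ∂Q = 1 := fun h =>
    Finset.prod_eq_one fun p _ => by
      rcases h p with h | h <;> simp [h, hsq]
  by_cases hij : i = j
  · by_cases hkl : k = l
    · subst hij hkl
      by_cases hik : i = k
      · subst hik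
        have : ∏ p, ∫ t, t ^ e p ∂Q = b := by
          rw [Finset.prod_eq_single i]
          · simpa [he] using hfourth
          · intro p _ hp
            simp [he, hp]
          · simp
        rw [this]; norm_num
      · rw [hone]
        · simp [hik]
        · intro p
          simp only [he]
          by_cases h1 : p = i <;> by_cases h2 : p = k <;> simp_all
    · by_cases hk : k = i
      · rw [hzero l]
        · subst hij hk; simp [hkl]
        · subst hij hk; simp [he, Ne.symm hkl]
      · rw [hzero k]
        · subst hij; simp [hkl, Ne.symm hk]
        · subst hij; simp [he, hkl, hk]
  · by_cases hik : i = k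
    · subst hik
      by_cases hjl : j = l
      · subst hjl
        rw [hone]
        · simp [hij]
        · intro p
          simp only [he]
          by_cases h1 : p = i <;> by_cases h2 : p = j <;> simp_all
      · rw [hzero j]
        · simp [hij, hjl, Ne.symm hij]
        · simp [he, hjl, Ne.symm hij]
    · by_cases hil : i = l
      · subst hil
        by_cases hjk : j = k
        · subst hjk
          rw [hone]
          · simp [hij]
          · intro p
            simp only [he]
            by_cases h1 : p = i <;> by_cases h2 : p = j <;> simp_all
        · rw [hzero j]
          · simp [hij, hjk, hik]
          · simp [he, hjk, Ne.symm hij]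
      · rw [hzero i]
        · simp [hij, hik, hil]
        · simp [he, hij, hik, hil]

end Moments

/-! ### Averaging quadratic forms over a row -/

section RowIntegral

variable {Q : Measure ℝ} [IsProbabilityMeasure Q]

theorem integrable_mul_four_rowLaw (hfinite : MemLp (fun x : ℝ => x) 4 Q) {m : ℕ}
    (i j k l : Fin m) :
    Integrable (fun x : Fin m → ℝ => x i * x j * (x k * x l)) (rowLaw Q m) := by
  refine (integrable_one_add_norm_pow hfinite m).mono' (by fun_prop) (ae_of_all _ fun x => ?_)
  have h : ∀ a, ‖x a‖ ≤ 1 + ‖x‖ := fun a => (norm_le_pi_norm x a).trans (by linarith)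
  rw [norm_mul, norm_mul, norm_mul]
  calc ‖x i‖ * ‖x j‖ * (‖x k‖ * ‖x l‖)
      ≤ (1 + ‖x‖) * (1 + ‖x‖) * ((1 + ‖x‖) * (1 + ‖x‖)) := by gcongr <;> exact h _
    _ = _ := by ring

theorem integrable_mul_rowLaw (hfinite : MemLp (fun x : ℝ => x) 4 Q) {m : ℕ} (i j : Fin m) :
    Integrable (fun x : Fin m → ℝ => x i * x j) (rowLaw Q m) := by
  refine (integrable_one_add_norm_pow hfinite m).mono' (by fun_prop) (ae_of_all _ fun x => ?_)
  have h : ∀ a, ‖x a‖ ≤ 1 + ‖x‖ := fun a => (norm_le_pi_norm x a).trans (by linarith)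
  have h1 : 1 ≤ 1 + ‖x‖ := by linarith [norm_nonneg x]
  rw [norm_mul]
  calc ‖x i‖ * ‖x j‖ ≤ (1 + ‖x‖) * (1 + ‖x‖) := by gcongr <;> exact h _
    _ = (1 + ‖x‖) ^ 2 := by ring
    _ ≤ (1 + ‖x‖) ^ 4 := pow_le_pow_right₀ h1 (by norm_num)

/-- The quadratic form of a complex matrix on a real vector. -/
def quadForm {m : ℕ} (a : Matrix (Fin m) (Fin m) ℂ) (x : Fin m → ℝ) : ℂ :=
  ∑ i, ∑ j, (x i : ℂ) * (x j : ℂ) * a i j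

theorem quadForm_mul_quadForm {m : ℕ} (a b : Matrix (Fin m) (Fin m) ℂ) (x : Fin m → ℝ) :
    quadForm a x * quadForm b x
      = ∑ i, ∑ j, ∑ k, ∑ l, ((x i * x j * (x k * x l) : ℝ) : ℂ) * (a i j * b k l) := by
  rw [quadForm, quadForm, Finset.sum_mul]
  refine Finset.sum_congr rfl fun i _ => ?_
  rw [Finset.sum_mul]
  refine Finset.sum_congr rfl fun j _ => ?_
  rw [Finset.mul_sum]
  refine Finset.sum_congr rfl fun k _ => ?_
  rw [Finset.mul_sum]
  refine Finset.sum_congr rfl fun l _ => ?_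
  push_cast
  ring

theorem integrable_quadForm (hfinite : MemLp (fun x : ℝ => x) 4 Q) {m : ℕ}
    (a : Matrix (Fin m) (Fin m) ℂ) : Integrable (quadForm a) (rowLaw Q m) := by
  refine integrable_finsetSum _ fun i _ => integrable_finsetSum _ fun j _ => ?_
  have := ((integrable_mul_rowLaw hfinite i j).ofReal (𝕜 := ℂ)).mul_const (a i j)
  simpa using this

theorem integrable_quadForm_mul_quadForm (hfinite : MemLp (fun x : ℝ => x) 4 Q) {m : ℕ}
    (a b : Matrix (Fin m) (Fin m) ℂ) :
    Integrable (fun x => quadForm a x * quadForm b x) (rowLaw Q m) := by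
  simp only [quadForm_mul_quadForm]
  exact integrable_finsetSum _ fun i _ => integrable_finsetSum _ fun j _ =>
    integrable_finsetSum _ fun k _ => integrable_finsetSum _ fun l _ =>
      ((integrable_mul_four_rowLaw hfinite i j k l).ofReal (𝕜 := ℂ)).mul_const _

theorem integral_quadForm (hmean : ∫ x, x ∂Q = 0) (hsq : ∫ x, x ^ 2 ∂Q = 1)
    (hfinite : MemLp (fun x : ℝ => x) 4 Q) {m : ℕ} (a : Matrix (Fin m) (Fin m) ℂ) :
    ∫ x, quadForm a x ∂(rowLaw Q m) = a.trace := by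
  have h : ∀ i j : Fin m, Integrable (fun x : Fin m → ℝ => ((x i * x j : ℝ) : ℂ) * a i j)
      (rowLaw Q m) := fun i j =>
    ((integrable_mul_rowLaw hfinite i j).ofReal (𝕜 := ℂ)).mul_const (a i j)
  have e : quadForm a = fun x => ∑ i, ∑ j, ((x i * x j : ℝ) : ℂ) * a i j := by
    ext x
    simp [quadForm]
  rw [e, integral_finsetSum _ fun i _ => integrable_finsetSum _ fun j _ => h i j]
  refine Finset.sum_congr rfl fun i _ => ?_
  rw [integral_finsetSum _ fun j _ => h i j]
  simp only [integral_mul_const, integral_complex_ofReal, integral_mul_rowLaw hmean hsq]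
  rw [Finset.sum_eq_single i]
  · simp
  · intro j _ hj
    simp [Ne.symm hj]
  · simp

theorem sum_wick_pairings {m : ℕ} (a b : Fin m → Fin m → ℂ) (c : ℝ) :
    ∑ i, ∑ j, ∑ k, ∑ l, (((if i = j then 1 else 0) * (if k = l then 1 else 0)
        + (if i = k then 1 else 0) * (if j = l then 1 else 0)
        + (if i = l then 1 else 0) * (if j = k then 1 else 0)
        + c * ((if i = j then 1 else 0) * ((if j = k then 1 else 0)
          * (if k = l then 1 else 0))) : ℝ) : ℂ) * (a i j * b k l)
      = ∑ i, ∑ k, a i i * b k k + ∑ i, ∑ j, a i j * b i j + ∑ i, ∑ j, a i j * b j i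
        + (c : ℂ) * ∑ i, a i i * b i i := by
  have h : ∀ i j k l : Fin m, (((if i = j then 1 else 0) * (if k = l then 1 else 0)
        + (if i = k then 1 else 0) * (if j = l then 1 else 0)
        + (if i = l then 1 else 0) * (if j = k then 1 else 0)
        + c * ((if i = j then 1 else 0) * ((if j = k then 1 else 0)
          * (if k = l then 1 else 0))) : ℝ) : ℂ) * (a i j * b k l)
      = (if i = j then (if k = l then a i j * b k l else 0) else 0)
        + (if j = l then (if i = k then a i j * b k l else 0) else 0)
        + (if i = l then (if j = k then a i j * b k l else 0) else 0)
        + (if i = j then (if j = k then (if k = l then c * (a i j * b k l) else 0) else 0)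
          else 0) := by
    intro i j k l
    push_cast
    rw [add_mul, add_mul, add_mul]
    refine congrArg₂ _ (congrArg₂ _ (congrArg₂ _ ?_ ?_) ?_) ?_ <;> split_ifs <;> simp
  simp only [h, Finset.sum_add_distrib, Finset.mul_sum]
  congr 1
  · congr 1
    · congr 1
      · refine Finset.sum_congr rfl fun i _ => ?_
        simp
      · refine Finset.sum_congr rfl fun i _ => Finset.sum_congr rfl fun j _ => ?_
        simp
    · refine Finset.sum_congr rfl fun i _ => Finset.sum_congr rfl fun j _ => ?_
      simp
  · refine Finset.sum_congr rfl fun i _ => ?_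
    simp

theorem integral_quadForm_mul_quadForm {b₄ : ℝ} (hmean : ∫ x, x ∂Q = 0)
    (hsq : ∫ x, x ^ 2 ∂Q = 1) (hfinite : MemLp (fun x : ℝ => x) 4 Q)
    (hfourth : ∫ x, x ^ 4 ∂Q = b₄) {m : ℕ} (a b : Matrix (Fin m) (Fin m) ℂ) :
    ∫ x, quadForm a x * quadForm b x ∂(rowLaw Q m)
      = a.trace * b.trace + (a * b.transpose).trace + (a * b).trace
        + ((b₄ - 3 : ℝ) : ℂ) * ∑ i, a i i * b i i := by
  have h : ∀ i j k l : Fin m, Integrable (fun x : Fin m → ℝ =>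
      ((x i * x j * (x k * x l) : ℝ) : ℂ) * (a i j * b k l)) (rowLaw Q m) := fun i j k l =>
    ((integrable_mul_four_rowLaw hfinite i j k l).ofReal (𝕜 := ℂ)).mul_const _
  have key : ∫ x, quadForm a x * quadForm b x ∂(rowLaw Q m)
      = ∑ i, ∑ j, ∑ k, ∑ l, ((∫ x : Fin m → ℝ, x i * x j * (x k * x l) ∂(rowLaw Q m) : ℝ) : ℂ)
        * (a i j * b k l) := by
    simp only [quadForm_mul_quadForm]
    rw [integral_finsetSum _ fun i _ => integrable_finsetSum _ fun j _ =>
      integrable_finsetSum _ fun k _ => integrable_finsetSum _ fun l _ => h i j k l]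
    refine Finset.sum_congr rfl fun i _ => ?_
    rw [integral_finsetSum _ fun j _ =>
      integrable_finsetSum _ fun k _ => integrable_finsetSum _ fun l _ => h i j k l]
    refine Finset.sum_congr rfl fun j _ => ?_
    rw [integral_finsetSum _ fun k _ => integrable_finsetSum _ fun l _ => h i j k l]
    refine Finset.sum_congr rfl fun k _ => ?_
    rw [integral_finsetSum _ fun l _ => h i j k l]
    refine Finset.sum_congr rfl fun l _ => ?_
    rw [integral_mul_const, integral_complex_ofReal]
  rw [key]
  simp only [integral_mul_four_rowLaw hmean hsq hfourth]
  rw [sum_wick_pairings (fun i j => a i j) (fun i j => b i j) (b₄ - 3)]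
  simp only [Matrix.trace, Matrix.diag_apply, Matrix.mul_apply, Matrix.transpose_apply,
    Finset.sum_mul_sum]

end RowIntegral

/-! ### The recursion in the number of rows -/

section Recursion

variable {Q : Measure ℝ} [IsProbabilityMeasure Q]

/-- The second-order correlation function of the characteristic polynomial, on the canonical
probability space. -/
noncomputable def gramCorr (Q : Measure ℝ) (n m : ℕ) (z w : ℂ) : ℂ :=
  ∫ Y, (gramC Y).charpoly.eval z * (gramC Y).charpoly.eval w ∂(matrixLaw Q n m)

/-- The correlation of the derivative of the characteristic polynomial with itself. -/
noncomputable def gramCorrL (Q : Measure ℝ) (n m : ℕ) (z w : ℂ) : ℂ :=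
  ∫ Y, (gramC Y).charpoly.derivative.eval z * (gramC Y).charpoly.eval w ∂(matrixLaw Q n m)

/-- The derivative of `gramCorr` in the second variable. -/
noncomputable def gramCorrR (Q : Measure ℝ) (n m : ℕ) (z w : ℂ) : ℂ :=
  ∫ Y, (gramC Y).charpoly.eval z * (gramC Y).charpoly.derivative.eval w ∂(matrixLaw Q n m)

/-- The mixed second derivative of `gramCorr`. -/
noncomputable def gramCorrLR (Q : Measure ℝ) (n m : ℕ) (z w : ℂ) : ℂ :=
  ∫ Y, (gramC Y).charpoly.derivative.eval z * (gramC Y).charpoly.derivative.eval w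
    ∂(matrixLaw Q n m)

theorem integral_matrixLaw_succ {n m : ℕ} {h : (Fin (n + 1) → Fin m → ℝ) → ℂ}
    (hh : Integrable h (matrixLaw Q (n + 1) m)) :
    ∫ Y, h Y ∂(matrixLaw Q (n + 1) m)
      = ∫ Y, ∫ x, h (Fin.cons x Y) ∂(rowLaw Q m) ∂(matrixLaw Q n m) := by
  have hmp := (measurePreserving_piFinSuccAbove (fun _ : Fin (n + 1) => rowLaw Q m) 0).symm
  have hcons : ∀ p : (Fin m → ℝ) × (Fin n → Fin m → ℝ),
      (MeasurableEquiv.piFinSuccAbove (fun _ : Fin (n + 1) => Fin m → ℝ) 0).symm p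
        = Fin.cons p.1 p.2 := fun p => by
    simp [MeasurableEquiv.piFinSuccAbove_symm_apply]
    rfl
  have hi : Integrable (fun p : (Fin m → ℝ) × (Fin n → Fin m → ℝ) => h (Fin.cons p.1 p.2))
      ((rowLaw Q m).prod (matrixLaw Q n m)) := by
    have := (hmp.integrable_comp_emb (MeasurableEquiv.measurableEmbedding _) (g := h)).2 hh
    refine this.congr (ae_of_all _ fun p => ?_)
    rw [Function.comp_apply, hcons]
  rw [← hmp.integral_comp' h]
  simp_rw [hcons]
  exact integral_prod_symm _ hi

/-- Expand the product of the two rank-one updates and average. The adjugates are symmetric, so the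
two crossed pairings agree and give 2 tr(AB), which the trace identity turns into first derivatives
at the price of dividing by w - z. -/
theorem integral_cons_charpoly {b : ℝ} (hmean : ∫ x, x ∂Q = 0)
    (hsq : ∫ x, x ^ 2 ∂Q = 1) (hfinite : MemLp (fun x : ℝ => x) 4 Q)
    (hfourth : ∫ x, x ^ 4 ∂Q = b) {n m : ℕ} (Y : Fin n → Fin m → ℝ) {z w : ℂ} (hzw : z ≠ w) :
    ∫ x, (gramC (Fin.cons x Y : Fin (n + 1) → Fin m → ℝ)).charpoly.eval z
        * (gramC (Fin.cons x Y : Fin (n + 1) → Fin m → ℝ)).charpoly.eval w ∂(rowLaw Q m)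
      = (gramC Y).charpoly.eval z * (gramC Y).charpoly.eval w
        - (gramC Y).charpoly.derivative.eval z * (gramC Y).charpoly.eval w
        - (gramC Y).charpoly.eval z * (gramC Y).charpoly.derivative.eval w
        + (gramC Y).charpoly.derivative.eval z * (gramC Y).charpoly.derivative.eval w
        + 2 / (w - z) * ((gramC Y).charpoly.derivative.eval z * (gramC Y).charpoly.eval w
          - (gramC Y).charpoly.eval z * (gramC Y).charpoly.derivative.eval w)
        + ((b - 3 : ℝ) : ℂ) * ∑ i, (Matrix.scalar (Fin m) z - gramC Y).adjugate i i
          * (Matrix.scalar (Fin m) w - gramC Y).adjugate i i := by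
  have h1 : ∀ (x : Fin m → ℝ) (z : ℂ),
      (gramC (Fin.cons x Y : Fin (n + 1) → Fin m → ℝ)).charpoly.eval z
        = (gramC Y).charpoly.eval z
          - quadForm (Matrix.scalar (Fin m) z - gramC Y).adjugate x := fun x z =>
    eval_charpoly_gramC_cons x Y z
  have htr := trace_adjugate_mul_adjugate (gramC Y) z w
  have hsymm : (Matrix.scalar (Fin m) w - gramC Y).adjugate.transpose
      = (Matrix.scalar (Fin m) w - gramC Y).adjugate := by
    rw [Matrix.adjugate_transpose, Matrix.transpose_sub, gramC_transpose, Matrix.scalar_apply,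
      Matrix.diagonal_transpose]
  rw [eval_derivative_charpoly, eval_derivative_charpoly] at *
  simp only [h1]
  set p := (gramC Y).charpoly.eval z
  set r := (gramC Y).charpoly.eval w
  set A := (Matrix.scalar (Fin m) z - gramC Y).adjugate
  set B := (Matrix.scalar (Fin m) w - gramC Y).adjugate
  have e : ∀ x, (p - quadForm A x) * (r - quadForm B x)
      = (p * r - p * quadForm B x) - (quadForm A x * r - quadForm A x * quadForm B x) := by
    intro x; ring
  have iA := integrable_quadForm (Q := Q) hfinite A
  have iB := integrable_quadForm (Q := Q) hfinite B
  have iAB := integrable_quadForm_mul_quadForm (Q := Q) hfinite A B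
  simp only [e]
  rw [integral_sub, integral_sub, integral_sub, integral_const_mul p (quadForm B),
    integral_mul_const r (quadForm A),
    integral_quadForm hmean hsq hfinite, integral_quadForm hmean hsq hfinite,
    integral_quadForm_mul_quadForm hmean hsq hfinite hfourth, hsymm]
  · have hwz : w - z ≠ 0 := sub_ne_zero.2 (Ne.symm hzw)
    rw [div_mul_eq_mul_div, ← htr]
    simp only [integral_const, probReal_univ, one_smul]
    field_simp
    ring
  · exact iA.mul_const r
  · exact iAB
  · exact integrable_const _
  · exact iB.const_mul p
  · exact (integrable_const _).sub (iB.const_mul p)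
  · exact (iA.mul_const r).sub iAB

/-- The i-th diagonal cofactor is the characteristic polynomial of the Gram matrix with column i of
Y removed, and the remaining columns are again independent with the same law. -/
theorem integral_adjugate_diag {n m : ℕ} (z w : ℂ) (i : Fin (m + 1)) :
    ∫ Y, (Matrix.scalar (Fin (m + 1)) z - gramC Y).adjugate i i
        * (Matrix.scalar (Fin (m + 1)) w - gramC Y).adjugate i i ∂(matrixLaw Q n (m + 1))
      = gramCorr Q n m z w := by
  have hrow : MeasurePreserving (fun (x : Fin (m + 1) → ℝ) (a : Fin m) => x (i.succAbove a))
      (rowLaw Q (m + 1)) (rowLaw Q m) :=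
    measurePreserving_snd.comp (measurePreserving_piFinSuccAbove (fun _ : Fin (m + 1) => Q) i)
  have hmat : MeasurePreserving
      (fun (Y : Fin n → Fin (m + 1) → ℝ) (k : Fin n) (a : Fin m) => Y k (i.succAbove a))
      (matrixLaw Q n (m + 1)) (matrixLaw Q n m) :=
    measurePreserving_pi _ _ fun _ => hrow
  rw [gramCorr, ← hmat.map_eq, integral_map hmat.measurable.aemeasurable]
  · simp only [adjugate_scalar_sub_apply_self, gramC_submatrix]
  · exact ((quadraticGrowth_eval_charpoly z).continuous.mul
      (quadraticGrowth_eval_charpoly w).continuous).aestronglyMeasurable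

theorem gramCorr_succ {b : ℝ} (hmean : ∫ x, x ∂Q = 0)
    (hsq : ∫ x, x ^ 2 ∂Q = 1) (hfinite : MemLp (fun x : ℝ => x) 4 Q)
    (hfourth : ∫ x, x ^ 4 ∂Q = b) (n m : ℕ) {z w : ℂ} (hzw : z ≠ w) :
    gramCorr Q (n + 1) m z w
      = gramCorr Q n m z w - gramCorrL Q n m z w - gramCorrR Q n m z w + gramCorrLR Q n m z w
        - 2 / (z - w) * (gramCorrL Q n m z w - gramCorrR Q n m z w)
        + ((b - 3 : ℝ) : ℂ) * (m * gramCorr Q n (m - 1) z w) := by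
  have i0 := (quadraticGrowth_eval_charpoly (n := n) (m := Fin m) z).integrable_mul hfinite
    (quadraticGrowth_eval_charpoly (n := n) w)
  have i1 := (quadraticGrowth_derivative_charpoly (n := n) (m := Fin m) z).integrable_mul hfinite
    (quadraticGrowth_eval_charpoly (n := n) w)
  have i2 := (quadraticGrowth_eval_charpoly (n := n) (m := Fin m) z).integrable_mul hfinite
    (quadraticGrowth_derivative_charpoly (n := n) w)
  have i3 := (quadraticGrowth_derivative_charpoly (n := n) (m := Fin m) z).integrable_mul hfinite
    (quadraticGrowth_derivative_charpoly (n := n) w)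
  have i4 : ∀ i : Fin m, Integrable (fun Y => (Matrix.scalar (Fin m) z - gramC Y).adjugate i i
      * (Matrix.scalar (Fin m) w - gramC Y).adjugate i i) (matrixLaw Q n m) := fun i =>
    (quadraticGrowth_adjugate (n := n) z i i).integrable_mul hfinite (quadraticGrowth_adjugate w i i)
  have i5 := integrable_finsetSum Finset.univ fun i _ => i4 i
  have hdiag : ∑ i : Fin m, ∫ Y, (Matrix.scalar (Fin m) z - gramC Y).adjugate i i
      * (Matrix.scalar (Fin m) w - gramC Y).adjugate i i ∂(matrixLaw Q n m)
      = m * gramCorr Q n (m - 1) z w := by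
    -- At `m = 0` the truncated `m - 1` is harmless: the sum is empty and the factor `m` vanishes.
    cases m with
    | zero => simp
    | succ m =>
      rw [Finset.sum_congr rfl fun i _ => integral_adjugate_diag (Q := Q) (n := n) z w i]
      simp
  rw [gramCorr, integral_matrixLaw_succ
    ((quadraticGrowth_eval_charpoly z).integrable_mul hfinite (quadraticGrowth_eval_charpoly w))]
  simp only [integral_cons_charpoly hmean hsq hfinite hfourth _ hzw]
  rw [integral_add, integral_add, integral_add, integral_sub, integral_sub, integral_const_mul,
    integral_sub i1 i2, integral_const_mul, integral_finsetSum _ fun i _ => i4 i, hdiag]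
  · have e : w - z = -(z - w) := by ring
    rw [e, div_neg, neg_mul, ← sub_eq_add_neg]
    rfl
  · exact i0
  · exact i1
  · exact i0.sub i1
  · exact i2
  · exact (i0.sub i1).sub i2
  · exact i3
  · exact ((i0.sub i1).sub i2).add i3
  · exact (i1.sub i2).const_mul _
  · exact (((i0.sub i1).sub i2).add i3).add ((i1.sub i2).const_mul _)
  · exact i5.const_mul _

theorem gramCorr_zero (m : ℕ) (z w : ℂ) : gramCorr Q 0 m z w = z ^ m * w ^ m := by
  have h : ∀ Y : Fin 0 → Fin m → ℝ, gramC Y = 0 := fun Y => by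
    ext a b
    simp [gramC_apply]
  simp [gramCorr, h]

end Recursion

/-! ### Differentiating under the expectation -/

section Derivatives

variable {Q : Measure ℝ} [IsProbabilityMeasure Q]

/-- The correlation of two linear functionals of the characteristic polynomial is a finite
combination of values of `gramCorr`, by Lagrange interpolation. -/
theorem integral_functional_charpoly (hfinite : MemLp (fun x : ℝ => x) 4 Q) (n m : ℕ)
    (φ ψ : Polynomial ℂ →ₗ[ℂ] ℂ) :
    ∫ Y, φ (gramC Y).charpoly * ψ (gramC Y).charpoly ∂(matrixLaw Q n m)
      = ∑ i ∈ Finset.range (m + 1), ∑ j ∈ Finset.range (m + 1), gramCorr Q n m i j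
        * (φ (Lagrange.basis (Finset.range (m + 1)) (fun i : ℕ => (i : ℂ)) i)
          * ψ (Lagrange.basis (Finset.range (m + 1)) (fun i : ℕ => (i : ℂ)) j)) := by
  set ℓ := Lagrange.basis (Finset.range (m + 1)) (fun i : ℕ => (i : ℂ))
  have hint : ∀ (Y : Fin n → Fin m → ℝ) (φ : Polynomial ℂ →ₗ[ℂ] ℂ), φ (gramC Y).charpoly
      = ∑ i ∈ Finset.range (m + 1), (gramC Y).charpoly.eval (i : ℂ) * φ (ℓ i) := by
    intro Y φ
    have hdeg : (gramC Y).charpoly.degree < (Finset.range (m + 1)).card := by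
      rw [Matrix.charpoly_degree_eq_dim, Fintype.card_fin, Finset.card_range]
      exact_mod_cast Nat.lt_succ_self m
    conv_lhs => rw [Lagrange.eq_interpolate (v := fun i : ℕ => (i : ℂ))
      (Nat.cast_injective.injOn) hdeg, Lagrange.interpolate_apply]
    simp [← Polynomial.smul_eq_C_mul, ℓ]
  have hi : ∀ i j : ℕ, Integrable (fun Y => (gramC Y).charpoly.eval (i : ℂ)
      * (gramC Y).charpoly.eval (j : ℂ) * (φ (ℓ i) * ψ (ℓ j))) (matrixLaw Q n m) := fun i j =>
    ((quadraticGrowth_eval_charpoly (i : ℂ)).integrable_mul hfinite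
      (quadraticGrowth_eval_charpoly (j : ℂ))).mul_const _
  have e : ∀ Y : Fin n → Fin m → ℝ, φ (gramC Y).charpoly * ψ (gramC Y).charpoly
      = ∑ i ∈ Finset.range (m + 1), ∑ j ∈ Finset.range (m + 1), (gramC Y).charpoly.eval (i : ℂ)
        * (gramC Y).charpoly.eval (j : ℂ) * (φ (ℓ i) * ψ (ℓ j)) := by
    intro Y
    rw [hint Y φ, hint Y ψ, Finset.sum_mul_sum]
    refine Finset.sum_congr rfl fun i _ => Finset.sum_congr rfl fun j _ => ?_
    ring
  simp only [e]
  rw [integral_finsetSum _ fun i _ => integrable_finsetSum _ fun j _ => hi i j]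
  refine Finset.sum_congr rfl fun i _ => ?_
  rw [integral_finsetSum _ fun j _ => hi i j]
  refine Finset.sum_congr rfl fun j _ => ?_
  rw [integral_mul_const, gramCorr]

/-- Evaluation of the derivative of a polynomial, as a linear functional. -/
noncomputable def evalDerivative (z : ℂ) : Polynomial ℂ →ₗ[ℂ] ℂ :=
  (Polynomial.leval z).comp Polynomial.derivative

/-- After interpolation z occurs only in the Lagrange basis polynomials of a finite sum, so no
domination argument is needed. -/
theorem hasDerivAt_integral_leval (hfinite : MemLp (fun x : ℝ => x) 4 Q) (n m : ℕ)
    (ψ : Polynomial ℂ →ₗ[ℂ] ℂ) (z : ℂ) :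
    HasDerivAt (fun z => ∫ Y, Polynomial.leval z (gramC Y).charpoly * ψ (gramC Y).charpoly
        ∂(matrixLaw Q n m))
      (∫ Y, evalDerivative z (gramC Y).charpoly * ψ (gramC Y).charpoly ∂(matrixLaw Q n m)) z := by
  simp only [integral_functional_charpoly hfinite]
  refine HasDerivAt.fun_sum fun i _ => HasDerivAt.fun_sum fun j _ => ?_
  exact ((Polynomial.hasDerivAt _ z).mul_const _).const_mul _

theorem hasDerivAt_gramCorr_left (hfinite : MemLp (fun x : ℝ => x) 4 Q) (n m : ℕ) (z w : ℂ) :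
    HasDerivAt (fun z => gramCorr Q n m z w) (gramCorrL Q n m z w) z :=
  hasDerivAt_integral_leval hfinite n m (Polynomial.leval w) z

theorem hasDerivAt_gramCorr_right (hfinite : MemLp (fun x : ℝ => x) 4 Q) (n m : ℕ) (z w : ℂ) :
    HasDerivAt (fun w => gramCorr Q n m z w) (gramCorrR Q n m z w) w := by
  have := hasDerivAt_integral_leval hfinite n m (Polynomial.leval z) w
  simp only [mul_comm _ ((Polynomial.leval z) _)] at this
  exact this

theorem hasDerivAt_gramCorrL_right (hfinite : MemLp (fun x : ℝ => x) 4 Q) (n m : ℕ) (z w : ℂ) :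
    HasDerivAt (fun w => gramCorrL Q n m z w) (gramCorrLR Q n m z w) w := by
  have := hasDerivAt_integral_leval hfinite n m (evalDerivative z) w
  simp only [mul_comm _ ((evalDerivative z) _)] at this
  exact this

end Derivatives

/-! ### The operator D and its action on Wronskian kernels -/

section StepRelation

/-- `h = (1 - ∂₁) (1 - ∂₂) f - 2 / (z - w) (∂₁ - ∂₂) f` off the diagonal. -/
def StepRel (f h : ℂ → ℂ → ℂ) : Prop :=
  ∃ f₁ f₂ f₁₂ : ℂ → ℂ → ℂ, ∀ z w, z ≠ w →
    HasDerivAt (fun z => f z w) (f₁ z w) z ∧ HasDerivAt (fun w => f z w) (f₂ z w) w ∧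
    HasDerivAt (fun w => f₁ z w) (f₁₂ z w) w ∧
    h z w = f z w - f₁ z w - f₂ z w + f₁₂ z w - 2 / (z - w) * (f₁ z w - f₂ z w)

/-- Derivatives are local and z ≠ w is an open condition in each variable, so agreement off the
diagonal already determines the derivatives there. -/
theorem StepRel.unique {f h f' h' : ℂ → ℂ → ℂ} (hf : StepRel f h) (hf' : StepRel f' h')
    (heq : ∀ z w, z ≠ w → f z w = f' z w) {z w : ℂ} (hzw : z ≠ w) : h z w = h' z w := by
  obtain ⟨f₁, f₂, f₁₂, hf⟩ := hf
  obtain ⟨g₁, g₂, g₁₂, hg⟩ := hf'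
  have e1 : ∀ z w, z ≠ w → f₁ z w = g₁ z w := fun z w hzw =>
    (hf z w hzw).1.unique ((hg z w hzw).1.congr_of_eventuallyEq
      ((eventually_ne_nhds hzw).mono fun u (hu : u ≠ w) => heq u w hu))
  have e2 : f₂ z w = g₂ z w :=
    (hf z w hzw).2.1.unique ((hg z w hzw).2.1.congr_of_eventuallyEq
      ((eventually_ne_nhds hzw.symm).mono fun u (hu : u ≠ z) => heq z u hu.symm))
  have e3 : f₁₂ z w = g₁₂ z w :=
    (hf z w hzw).2.2.1.unique ((hg z w hzw).2.2.1.congr_of_eventuallyEq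
      ((eventually_ne_nhds hzw.symm).mono fun u (hu : u ≠ z) => e1 z u hu.symm))
  rw [(hf z w hzw).2.2.2, (hg z w hzw).2.2.2, heq z w hzw, e1 z w hzw, e2, e3]

theorem StepRel.sum {κ : Type*} (s : Finset κ) (a : κ → ℂ) {f h : κ → ℂ → ℂ → ℂ}
    (hf : ∀ k, StepRel (f k) (h k)) :
    StepRel (fun z w => ∑ k ∈ s, a k * f k z w) (fun z w => ∑ k ∈ s, a k * h k z w) := by
  choose f₁ f₂ f₁₂ hf using hf
  refine ⟨fun z w => ∑ k ∈ s, a k * f₁ k z w, fun z w => ∑ k ∈ s, a k * f₂ k z w,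
    fun z w => ∑ k ∈ s, a k * f₁₂ k z w, fun z w hzw => ⟨?_, ?_, ?_, ?_⟩⟩
  · exact HasDerivAt.fun_sum fun k _ => (hf k z w hzw).1.const_mul _
  · exact HasDerivAt.fun_sum fun k _ => (hf k z w hzw).2.1.const_mul _
  · exact HasDerivAt.fun_sum fun k _ => (hf k z w hzw).2.2.1.const_mul _
  · simp only [← Finset.sum_sub_distrib, ← Finset.sum_add_distrib, Finset.mul_sum]
    refine Finset.sum_congr rfl fun k _ => ?_
    rw [(hf k z w hzw).2.2.2]
    ring

/-- The kernel `(∂₁ - ∂₂) ((f' ⊗ f - f ⊗ f') / (z - w)) / (z - w)` of a function `f₀` with first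
and second derivatives `f₁` and `f₂`. -/
noncomputable def wronskiKernel (f₀ f₁ f₂ : ℂ → ℂ) (z w : ℂ) : ℂ :=
  (f₂ z * f₀ w - 2 * f₁ z * f₁ w + f₀ z * f₂ w) / (z - w) ^ 2
    - 2 * (f₁ z * f₀ w - f₀ z * f₁ w) / (z - w) ^ 3

/-- `wronskiKernel` of a polynomial. -/
noncomputable def polyKernel (p : Polynomial ℂ) : ℂ → ℂ → ℂ :=
  wronskiKernel (fun z => p.eval z) (fun z => p.derivative.eval z)
    (fun z => p.derivative.derivative.eval z)

/-- This turns the singular two-variable operator into the one-variable map p ↦ p - p'. The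
witnesses are ∂z, ∂w and ∂z∂w of the kernel as given by the quotient rule; the identity then
compares bilinear expressions in p, p', p'', p''' over powers of z - w. -/
theorem stepRel_polyKernel (p : Polynomial ℂ) :
    StepRel (polyKernel p) (polyKernel (p - p.derivative)) := by
  refine ⟨fun z w => (p.derivative.derivative.derivative.eval z * p.eval w
        - 2 * p.derivative.derivative.eval z * p.derivative.eval w
        + p.derivative.eval z * p.derivative.derivative.eval w) / (z - w) ^ 2
      - 2 * (2 * p.derivative.derivative.eval z * p.eval w
        - 3 * p.derivative.eval z * p.derivative.eval w
        + p.eval z * p.derivative.derivative.eval w) / (z - w) ^ 3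
      + 6 * (p.derivative.eval z * p.eval w - p.eval z * p.derivative.eval w) / (z - w) ^ 4,
    fun z w => (p.derivative.derivative.derivative.eval w * p.eval z
        - 2 * p.derivative.derivative.eval w * p.derivative.eval z
        + p.derivative.eval w * p.derivative.derivative.eval z) / (z - w) ^ 2
      + 2 * (2 * p.derivative.derivative.eval w * p.eval z
        - 3 * p.derivative.eval w * p.derivative.eval z
        + p.eval w * p.derivative.derivative.eval z) / (z - w) ^ 3
      + 6 * (p.derivative.eval w * p.eval z - p.eval w * p.derivative.eval z) / (z - w) ^ 4,
    fun z w => (p.derivative.derivative.derivative.eval z * p.derivative.eval w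
        - 2 * p.derivative.derivative.eval z * p.derivative.derivative.eval w
        + p.derivative.eval z * p.derivative.derivative.derivative.eval w) / (z - w) ^ 2
      + 2 * (p.derivative.derivative.derivative.eval z * p.eval w
        - 2 * p.derivative.derivative.eval z * p.derivative.eval w
        + p.derivative.eval z * p.derivative.derivative.eval w) / (z - w) ^ 3
      - 2 * (2 * p.derivative.derivative.eval z * p.derivative.eval w
        - 3 * p.derivative.eval z * p.derivative.derivative.eval w
        + p.eval z * p.derivative.derivative.derivative.eval w) / (z - w) ^ 3
      - 6 * (2 * p.derivative.derivative.eval z * p.eval w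
        - 3 * p.derivative.eval z * p.derivative.eval w
        + p.eval z * p.derivative.derivative.eval w) / (z - w) ^ 4
      + 6 * (p.derivative.eval z * p.derivative.eval w
        - p.eval z * p.derivative.derivative.eval w) / (z - w) ^ 4
      + 24 * (p.derivative.eval z * p.eval w - p.eval z * p.derivative.eval w) / (z - w) ^ 5,
    fun z w hzw => ?_⟩
  have hd : z - w ≠ 0 := sub_ne_zero.2 hzw
  have hz : ∀ q : Polynomial ℂ, HasDerivAt (fun z => q.eval z) (q.derivative.eval z) z :=
    fun q => q.hasDerivAt z
  have hw : ∀ q : Polynomial ℂ, HasDerivAt (fun z => q.eval z) (q.derivative.eval w) w :=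
    fun q => q.hasDerivAt w
  have dz : ∀ k : ℕ, HasDerivAt (fun z => (z - w) ^ k) (k * (z - w) ^ (k - 1) * 1) z :=
    fun k => ((hasDerivAt_id z).sub_const w).pow k
  have dw : ∀ k : ℕ, HasDerivAt (fun w => (z - w) ^ k) (k * (z - w) ^ (k - 1) * (-1)) w :=
    fun k => ((hasDerivAt_id w).const_sub z).pow k
  refine ⟨?_, ?_, ?_, ?_⟩
  · have h := (((((hz p.derivative.derivative).mul_const (p.eval w)).sub
      (((hz p.derivative).const_mul 2).mul_const (p.derivative.eval w))).add
      ((hz p).mul_const (p.derivative.derivative.eval w))).div (dz 2) (pow_ne_zero 2 hd)).sub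
      (((((hz p.derivative).mul_const (p.eval w)).sub
        ((hz p).mul_const (p.derivative.eval w))).const_mul 2).div (dz 3) (pow_ne_zero 3 hd))
    refine h.congr_deriv ?_
    simp only [Pi.add_apply, Pi.sub_apply]
    field_simp
    push_cast
    ring
  · have h := (((((hw p).const_mul (p.derivative.derivative.eval z)).sub
      ((hw p.derivative).const_mul (2 * p.derivative.eval z))).add
      ((hw p.derivative.derivative).const_mul (p.eval z))).div (dw 2) (pow_ne_zero 2 hd)).sub
      (((((hw p).const_mul (p.derivative.eval z)).sub
        ((hw p.derivative).const_mul (p.eval z))).const_mul 2).div (dw 3) (pow_ne_zero 3 hd))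
    refine h.congr_deriv ?_
    simp only [Pi.add_apply, Pi.sub_apply]
    field_simp
    push_cast
    ring
  · have h := ((((((hw p).const_mul (p.derivative.derivative.derivative.eval z)).sub
      ((hw p.derivative).const_mul (2 * p.derivative.derivative.eval z))).add
      ((hw p.derivative.derivative).const_mul (p.derivative.eval z))).div (dw 2)
        (pow_ne_zero 2 hd)).sub
      ((((((hw p).const_mul (2 * p.derivative.derivative.eval z)).sub
        ((hw p.derivative).const_mul (3 * p.derivative.eval z))).add
        ((hw p.derivative.derivative).const_mul (p.eval z))).const_mul 2).div (dw 3)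
          (pow_ne_zero 3 hd))).add
      (((((hw p).const_mul (p.derivative.eval z)).sub
        ((hw p.derivative).const_mul (p.eval z))).const_mul 6).div (dw 4) (pow_ne_zero 4 hd))
    refine h.congr_deriv ?_
    simp only [Pi.add_apply, Pi.sub_apply]
    field_simp
    push_cast
    ring
  · simp only [polyKernel, wronskiKernel, Polynomial.eval_sub, Polynomial.derivative_sub]
    field_simp
    ring

/-- The polynomial `(1 - d/dX)ⁿ X ^ K`, a multiple of a Laguerre polynomial. -/
noncomputable def laguerrePoly (n K : ℕ) : Polynomial ℂ :=
  (fun p => p - Polynomial.derivative p)^[n] (Polynomial.X ^ K)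

theorem laguerrePoly_zero (K : ℕ) : laguerrePoly 0 K = Polynomial.X ^ K := rfl

theorem laguerrePoly_succ (n K : ℕ) :
    laguerrePoly (n + 1) K = laguerrePoly n K - (laguerrePoly n K).derivative :=
  Function.iterate_succ_apply' _ _ _

/-- The numerator over (z - w)² becomes (m+1)(m+2) zᵐwᵐ (z - w)² once the cubic pole is absorbed.
Hence the initial value of the recursion is itself a kernel, with the degree shifted by two. -/
theorem polyKernel_X_pow (m : ℕ) {z w : ℂ} (hzw : z ≠ w) :
    polyKernel (Polynomial.X ^ (m + 2)) z w = ((m + 1) * (m + 2)) * (z ^ m * w ^ m) := by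
  have hd : z - w ≠ 0 := sub_ne_zero.2 hzw
  simp only [polyKernel, wronskiKernel, Polynomial.derivative_X_pow, Polynomial.derivative_mul,
    Polynomial.derivative_C, Polynomial.eval_mul, Polynomial.eval_pow,
    Polynomial.eval_X, Polynomial.eval_C, Nat.add_sub_cancel,
    Nat.add_succ_sub_one, zero_mul, zero_add]
  field_simp
  push_cast
  ring

end StepRelation

/-! ### Closed form of the correlation function -/

section Solution

variable {Q : Measure ℝ} [IsProbabilityMeasure Q]

/-- Of the n steps, k use the source term, which lowers m by one, and n - k use D, which applies 1 -
d/dX to the polynomial. For k > m the truncated subtraction does no harm, since the falling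
factorial is zero. -/
theorem gramCorr_eq_sum {b : ℝ} (hmean : ∫ x, x ∂Q = 0)
    (hsq : ∫ x, x ^ 2 ∂Q = 1) (hfinite : MemLp (fun x : ℝ => x) 4 Q)
    (hfourth : ∫ x, x ^ 4 ∂Q = b) (n m : ℕ) {z w : ℂ} (hzw : z ≠ w) :
    gramCorr Q n m z w = ∑ k ∈ Finset.range (n + 1), (n.choose k : ℂ)
      * (((b - 3 : ℝ) : ℂ) ^ k * (m.descFactorial k : ℂ)
        * (polyKernel (laguerrePoly (n - k) (m - k + 2)) z w
          / (((m - k : ℕ) + 1) * ((m - k : ℕ) + 2)))) := by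
  induction n generalizing m z w with
  | zero =>
    have h1 : (m : ℂ) + 1 ≠ 0 := by exact_mod_cast Nat.succ_ne_zero m
    have h2 : (m : ℂ) + 2 ≠ 0 := by exact_mod_cast Nat.succ_ne_zero (m + 1)
    simp only [gramCorr_zero, zero_add, Finset.sum_range_one, Nat.choose_self, pow_zero,
      Nat.descFactorial_zero, laguerrePoly_zero, polyKernel_X_pow _ hzw, Nat.sub_zero, Nat.cast_one,
      one_mul]
    field_simp
  | succ n ih =>
    set c : ℂ := ((b - 3 : ℝ) : ℂ) with hc
    have hrel : StepRel (gramCorr Q n m)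
        (fun z w => gramCorr Q (n + 1) m z w - c * (m * gramCorr Q n (m - 1) z w)) :=
      ⟨gramCorrL Q n m, gramCorrR Q n m, gramCorrLR Q n m, fun z w hzw =>
        ⟨hasDerivAt_gramCorr_left hfinite n m z w, hasDerivAt_gramCorr_right hfinite n m z w,
          hasDerivAt_gramCorrL_right hfinite n m z w, by
            dsimp only
            rw [gramCorr_succ hmean hsq hfinite hfourth n m hzw]; ring⟩⟩
    have hrel' := StepRel.sum (Finset.range (n + 1)) (fun k => (n.choose k : ℂ)
        * (c ^ k * (m.descFactorial k : ℂ) / (((m - k : ℕ) + 1) * ((m - k : ℕ) + 2))))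
      (fun k => stepRel_polyKernel (laguerrePoly (n - k) (m - k + 2)))
    have h := hrel.unique hrel' (fun z w hzw => ?_) hzw
    · rw [sub_eq_iff_eq_add] at h
      rw [h, ih (m - 1) hzw]
      -- Pascal's rule: D keeps k and raises the Laguerre index j, while the source term raises k
      -- and keeps j.
      have hp := Finset.sum_choose_succ_mul (R := ℂ) (fun k j => c ^ k * (m.descFactorial k : ℂ)
        * (polyKernel (laguerrePoly j (m - k + 2)) z w
          / (((m - k : ℕ) + 1) * ((m - k : ℕ) + 2)))) n
      rw [hp]
      congr 1
      · refine Finset.sum_congr rfl fun k hk => ?_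
        have hk' : n + 1 - k = (n - k) + 1 := by
          have := Finset.mem_range.1 hk; omega
        rw [← laguerrePoly_succ, hk']
        ring
      · rw [Finset.mul_sum, Finset.mul_sum]
        refine Finset.sum_congr rfl fun k _ => ?_
        have hm : (m : ℂ) * ((m - 1).descFactorial k : ℂ) = (m.descFactorial (k + 1) : ℂ) := by
          cases m with
          | zero => simp
          | succ m => rw [Nat.succ_descFactorial_succ]; push_cast; simp
        have hs : m - 1 - k = m - (k + 1) := by omega
        rw [← hm, hs]
        ring
    · rw [ih m hzw]
      refine Finset.sum_congr rfl fun k _ => ?_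
      ring

/-- The binomial coefficient and the falling factorial cancel against n! m!, leaving the
coefficients of an exponential series in b - 3. -/
theorem gramCorr_div_factorial {b : ℝ} (hmean : ∫ x, x ∂Q = 0)
    (hsq : ∫ x, x ^ 2 ∂Q = 1) (hfinite : MemLp (fun x : ℝ => x) 4 Q)
    (hfourth : ∫ x, x ^ 4 ∂Q = b) {n m : ℕ} (hmn : m ≤ n) {z w : ℂ} (hzw : z ≠ w) :
    gramCorr Q n m z w / ((n.factorial : ℂ) * (m.factorial : ℂ))
      = ∑ k ∈ Finset.range (m + 1), ((b - 3 : ℝ) : ℂ) ^ k / (k.factorial : ℂ)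
        * (polyKernel (laguerrePoly (n - k) (m - k + 2)) z w
          / (((n - k).factorial : ℂ) * ((m - k + 2).factorial : ℂ))) := by
  rw [gramCorr_eq_sum hmean hsq hfinite hfourth n m hzw, Finset.sum_div]
  symm
  refine Finset.sum_subset_zero_on_sdiff (by gcongr) (fun k hk => ?_) (fun k hk => ?_)
  · have hk' : m < k := by
      simp only [Finset.mem_sdiff, Finset.mem_range] at hk
      omega
    simp [Nat.descFactorial_eq_zero_iff_lt.2 hk']
  · have hkm : k ≤ m := Nat.lt_succ_iff.1 (Finset.mem_range.1 hk)
    have e1 : (n.factorial : ℂ) = n.choose k * k.factorial * (n - k).factorial := by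
      exact_mod_cast (Nat.choose_mul_factorial_mul_factorial (hkm.trans hmn)).symm
    have e2 : (m.factorial : ℂ) = (m - k).factorial * m.descFactorial k := by
      exact_mod_cast (Nat.factorial_mul_descFactorial hkm).symm
    have e3 : ((m - k + 2).factorial : ℂ)
        = ((m - k : ℕ) + 2) * (((m - k : ℕ) + 1) * (m - k).factorial) := by
      rw [Nat.factorial_succ, Nat.factorial_succ]; push_cast; ring
    have h1 : (n.choose k : ℂ) ≠ 0 := by
      exact_mod_cast (Nat.choose_pos (hkm.trans hmn)).ne'
    have h2 : (m.descFactorial k : ℂ) ≠ 0 := by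
      exact_mod_cast (Nat.descFactorial_pos.2 hkm).ne'
    have h3 : ∀ j : ℕ, (j.factorial : ℂ) ≠ 0 := fun j => by exact_mod_cast j.factorial_ne_zero
    have h4 : ((m - k : ℕ) : ℂ) + 1 ≠ 0 := by exact_mod_cast Nat.succ_ne_zero (m - k)
    have h5 : ((m - k : ℕ) : ℂ) + 2 ≠ 0 := by exact_mod_cast Nat.succ_ne_zero (m - k + 1)
    have h6 := h3 k
    have h7 := h3 (n - k)
    have h8 := h3 (m - k)
    rw [e1, e2, e3]
    field_simp

end Solution

/-! ### From the given random matrix to the product measure -/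

section Transfer

variable {Q : Measure ℝ} [IsProbabilityMeasure Q]

theorem map_curry_pi (n m : ℕ) :
    (Measure.pi fun _ : Fin n × Fin m => Q).map Function.curry = matrixLaw Q n m := by
  have h := Measure.infinitePi_map_curry (fun (_ : Fin n) (_ : Fin m) => Q)
  simp only [Measure.infinitePi_eq_pi] at h
  exact h

theorem HasIIDEntries.map_eq {Ω : Type*} [MeasurableSpace Ω] {n m : ℕ} {P : Measure Ω}
    [IsProbabilityMeasure P] {X : Ω → Matrix (Fin n) (Fin m) ℝ} (hX : HasIIDEntries P Q X) :
    AEMeasurable (fun ω i j => X ω i j) P ∧ P.map (fun ω i j => X ω i j) = matrixLaw Q n m := by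
  have hae : ∀ p : Fin n × Fin m, AEMeasurable (fun ω => X ω p.1 p.2) P := fun p =>
    (hX.hasLaw p.1 p.2).aemeasurable
  refine ⟨aemeasurable_pi_lambda _ fun i => aemeasurable_pi_lambda _ fun j => hae (i, j), ?_⟩
  have h := (iIndepFun_iff_map_fun_eq_pi_map hae).1 hX.indep
  simp only [fun p : Fin n × Fin m => (hX.hasLaw p.1 p.2).map_eq] at h
  rw [← map_curry_pi, ← h, AEMeasurable.map_map_of_aemeasurable]
  · rfl
  · exact (MeasurableEquiv.curry (Fin n) (Fin m) ℝ).measurable.aemeasurable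
  · exact aemeasurable_pi_lambda _ hae

theorem HasIIDEntries.integrable_detProduct (hfinite : MemLp (fun x : ℝ => x) 4 Q)
    {Ω : Type*} [MeasurableSpace Ω] {n m : ℕ} {P : Measure Ω}
    [IsProbabilityMeasure P] {X : Ω → Matrix (Fin n) (Fin m) ℝ} (hX : HasIIDEntries P Q X)
    (z w : ℂ) : Integrable (fun ω => detProduct (X ω) z w) P := by
  obtain ⟨h1, h2⟩ := hX.map_eq
  have hi := (quadraticGrowth_eval_charpoly (n := n) (m := Fin m) z).integrable_mul hfinite
    (quadraticGrowth_eval_charpoly w)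
  rw [← h2] at hi
  have := hi.comp_aemeasurable h1
  refine this.congr (ae_of_all _ fun ω => ?_)
  exact (detProduct_eq_charpoly (X ω) z w).symm

theorem HasIIDEntries.charPolyCorrelation_eq {Ω : Type*} [MeasurableSpace Ω] {n m : ℕ}
    {P : Measure Ω} [IsProbabilityMeasure P] {X : Ω → Matrix (Fin n) (Fin m) ℝ}
    (hX : HasIIDEntries P Q X) (z w : ℂ) :
    charPolyCorrelation P X z w = gramCorr Q n m z w := by
  obtain ⟨h1, h2⟩ := hX.map_eq
  rw [gramCorr, ← h2, integral_map h1, charPolyCorrelation]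
  · exact integral_congr_ae (ae_of_all _ fun ω => detProduct_eq_charpoly (X ω) z w)
  · exact ((quadraticGrowth_eval_charpoly z).continuous.mul
      (quadraticGrowth_eval_charpoly w).continuous).aestronglyMeasurable

end Transfer

/-! ### Contour integrals for the Laguerre-type polynomials -/

section ContourIntegral

open Complex

theorem circleIntegral_exp_div_pow {r : ℝ} (hr : 0 < r) (x : ℂ) (K : ℕ) :
    (∮ z in C(0, r), z ^ (-(K : ℤ) - 1) * exp (x * z))
      = 2 * Real.pi * I * (x ^ K / K.factorial) := by
  have hd : DifferentiableOn ℂ (fun z : ℂ => exp (x * z)) (Metric.closedBall 0 r) := by fun_prop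
  have h := hd.circleIntegral_one_div_sub_center_pow_smul hr K
  have e : iteratedDeriv K (fun z : ℂ => exp (x * z)) 0 = x ^ K := by
    simp
  rw [e] at h
  rw [show 2 * Real.pi * I * (x ^ K / K.factorial) = (2 * Real.pi * I / K.factorial) • x ^ K by
    rw [smul_eq_mul]; ring, ← h]
  refine circleIntegral.integral_congr hr.le fun z _ => ?_
  simp only [sub_zero, smul_eq_mul, one_div]
  rw [show (-(K : ℤ) - 1) = -((K + 1 : ℕ) : ℤ) by push_cast; ring, zpow_neg, zpow_natCast]

/-- The contour integral representing the `j`-th derivative of `laguerrePoly n K`. -/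
noncomputable def laguerreContour (r : ℝ) (n K j : ℕ) (x : ℂ) : ℂ :=
  ∮ z in C(0, r), (1 - z) ^ n * z ^ ((j : ℤ) - K - 1) * exp (x * z)

theorem circleIntegrable_laguerre {r : ℝ} (hr : 0 < r) (n : ℕ) (l : ℤ) (x : ℂ) :
    CircleIntegrable (fun z => (1 - z) ^ n * z ^ l * exp (x * z)) 0 r := by
  refine ContinuousOn.circleIntegrable hr.le fun z hz => ContinuousAt.continuousWithinAt ?_
  have hz0 : z ≠ 0 := by
    rintro rfl
    simp at hz
    exact hr.ne hz
  have : ContinuousAt (fun z : ℂ => z ^ l) z := continuousAt_zpow₀ z l (Or.inl hz0)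
  fun_prop

/-- Differentiation in x multiplies the integrand by z, so a further factor 1 - z is the operator 1
- d/dx. -/
theorem laguerreContour_succ {r : ℝ} (hr : 0 < r) (n K j : ℕ) (x : ℂ) :
    laguerreContour r (n + 1) K j x
      = laguerreContour r n K j x - laguerreContour r n K (j + 1) x := by
  rw [laguerreContour, laguerreContour, laguerreContour, ← circleIntegral.integral_sub
    (circleIntegrable_laguerre hr _ _ _) (circleIntegrable_laguerre hr _ _ _)]
  refine circleIntegral.integral_congr hr.le fun z hz => ?_
  have hz0 : z ≠ 0 := by
    rintro rfl
    simp at hz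
    exact hr.ne hz
  have e : z ^ (((j + 1 : ℕ) : ℤ) - K - 1) = z ^ ((j : ℤ) - K - 1) * z := by
    rw [← zpow_add_one₀ hz0]; congr 1; push_cast; ring
  simp only [e]
  ring

theorem iterate_derivative_laguerrePoly_eval {r : ℝ} (hr : 0 < r) (n K j : ℕ) (x : ℂ) :
    2 * Real.pi * I * (Polynomial.derivative^[j] (laguerrePoly n K)).eval x
      = K.factorial * laguerreContour r n K j x := by
  induction n generalizing j with
  | zero =>
    rw [laguerrePoly_zero, laguerreContour, Polynomial.iterate_derivative_X_pow_eq_natCast_mul]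
    simp only [pow_zero, one_mul]
    rcases le_or_gt j K with hjK | hjK
    · rw [show ((j : ℤ) - K - 1) = -((K - j : ℕ) : ℤ) - 1 by push_cast [hjK]; ring,
        circleIntegral_exp_div_pow hr, ← Nat.factorial_mul_descFactorial hjK]
      have : ((K - j).factorial : ℂ) ≠ 0 := by exact_mod_cast (K - j).factorial_ne_zero
      simp only [Polynomial.eval_mul, Polynomial.eval_natCast, Polynomial.eval_pow,
        Polynomial.eval_X]
      push_cast
      field_simp
    -- For j > K both sides vanish: the exponent of z is nonnegative and the integrand entire.
    · rw [Nat.descFactorial_eq_zero_iff_lt.2 hjK]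
      have hd : (∮ z in C(0, r), z ^ ((j : ℤ) - K - 1) * exp (x * z)) = 0 := by
        refine Complex.circleIntegral_eq_zero_of_differentiable_on_off_countable hr.le
          Set.countable_empty ?_ ?_
        all_goals
          rw [show ((j : ℤ) - K - 1) = ((j - K - 1 : ℕ) : ℤ) by omega]
          simp only [zpow_natCast]
        · exact Continuous.continuousOn (by fun_prop)
        · intro z _
          fun_prop
      rw [hd]
      simp
  | succ n ih =>
    rw [laguerrePoly_succ, laguerreContour_succ hr, Polynomial.iterate_derivative_sub,
      ← Function.iterate_succ_apply, Polynomial.eval_sub, mul_sub, ih, ih, mul_sub]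

end ContourIntegral

/-! ### Gaussian majorants -/

section GaussianDomination

/-- A Gaussian with linear-exponential and polynomial weights. -/
noncomputable def gaussWeight (a R : ℝ) (j : ℕ) (t : ℝ) : ℝ :=
  Real.exp (-a * t ^ 2) * Real.exp (R * (1 + |t|)) * (1 + |t|) ^ j

theorem gaussWeight_nonneg (a R : ℝ) (j : ℕ) (t : ℝ) : 0 ≤ gaussWeight a R j t := by
  unfold gaussWeight; positivity

theorem continuous_gaussWeight (a R : ℝ) (j : ℕ) : Continuous (gaussWeight a R j) := by
  unfold gaussWeight; fun_prop

/-- The polynomial weight is at most j! e^(1+|t|), so only a linear exponent remains. Half of the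
Gaussian absorbs it by completing the square. -/
theorem integrable_gaussWeight {a : ℝ} (ha : 0 < a) (R : ℝ) (j : ℕ) :
    Integrable (gaussWeight a R j) := by
  set S := |R| + 1 with hS
  have hi := (integrable_exp_neg_mul_sq (b := a / 2) (by positivity)).const_mul
    (j.factorial * Real.exp (S + S ^ 2 / (2 * a)))
  refine hi.mono' (continuous_gaussWeight a R j).aestronglyMeasurable (ae_of_all _ fun t => ?_)
  rw [Real.norm_of_nonneg (gaussWeight_nonneg a R j t), gaussWeight]
  have h1 : (1 + |t|) ^ j ≤ j.factorial * Real.exp (1 + |t|) := by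
    have := Real.pow_div_factorial_le_exp (1 + |t|) (by positivity) j
    rwa [div_le_iff₀' (by positivity)] at this
  have h2 : Real.exp (R * (1 + |t|)) ≤ Real.exp (|R| * (1 + |t|)) :=
    Real.exp_le_exp.2 (mul_le_mul_of_nonneg_right (le_abs_self R) (by positivity))
  calc Real.exp (-a * t ^ 2) * Real.exp (R * (1 + |t|)) * (1 + |t|) ^ j
      ≤ Real.exp (-a * t ^ 2) * Real.exp (|R| * (1 + |t|)) * (j.factorial * Real.exp (1 + |t|)) := by
        gcongr
    _ = j.factorial * Real.exp (-a * t ^ 2 + S * (1 + |t|)) := by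
        rw [show -a * t ^ 2 + S * (1 + |t|) = -a * t ^ 2 + |R| * (1 + |t|) + (1 + |t|) by
          rw [hS]; ring,
          Real.exp_add (-a * t ^ 2 + |R| * (1 + |t|)), Real.exp_add (-a * t ^ 2)]
        ring
    _ ≤ j.factorial * Real.exp (S + S ^ 2 / (2 * a) + -(a / 2) * t ^ 2) := by
        refine mul_le_mul_of_nonneg_left (Real.exp_le_exp.2 ?_) (by positivity)
        have h3 : 0 ≤ (a * |t| - S) ^ 2 / (2 * a) := by positivity
        have h4 : (a * |t| - S) ^ 2 / (2 * a) = a / 2 * t ^ 2 - S * |t| + S ^ 2 / (2 * a) := by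
          rw [← sq_abs t]; field_simp; ring
        rw [h4] at h3
        linarith
    _ = _ := by rw [Real.exp_add]; ring

end GaussianDomination

/-! ### The Airy function in the complex domain -/

section Airy

open Complex

/-- The integrand of the `j`-th derivative of the Airy function, on the line `Re ω = -1`. -/
noncomputable def airyContourIntegrand (j : ℕ) (s : ℂ) (t : ℝ) : ℂ :=
  exp (s * (-1 + t * I) - (-1 + t * I) ^ 3 / 3) * (-1 + t * I) ^ j

/-- The `j`-th derivative of the Airy function in the complex domain, as a contour integral. -/
noncomputable def airyContour (j : ℕ) (s : ℂ) : ℂ :=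
  1 / (2 * Real.pi) * ∫ t : ℝ, airyContourIntegrand j s t

theorem norm_neg_one_add_mul_I_le (t : ℝ) : ‖(-1 + t * I : ℂ)‖ ≤ 1 + |t| := by
  refine (norm_add_le _ _).trans ?_
  simp

theorem norm_exp_mul_le {s ω : ℂ} {R a : ℝ} (hs : ‖s‖ ≤ R) (hω : ‖ω‖ ≤ a) :
    ‖exp (s * ω)‖ ≤ Real.exp (R * a) := by
  rw [norm_exp]
  refine Real.exp_le_exp.2 ((re_le_norm _).trans ?_)
  rw [norm_mul]
  exact mul_le_mul hs hω (norm_nonneg _) ((norm_nonneg _).trans hs)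

theorem norm_airyContourIntegrand_le (j : ℕ) {s : ℂ} {R : ℝ} (hs : ‖s‖ ≤ R) (t : ℝ) :
    ‖airyContourIntegrand j s t‖ ≤ Real.exp (1 / 3) * gaussWeight 1 R j t := by
  have h1 : ‖exp (-((-1 + t * I) ^ 3 / 3))‖ = Real.exp (1 / 3) * Real.exp (-1 * t ^ 2) := by
    rw [norm_exp, ← Real.exp_add]
    congr 1
    have : (-((-1 + t * I) ^ 3 / 3) : ℂ) = ((1 / 3 - t ^ 2 : ℝ) : ℂ)
        + ((-t + t ^ 3 / 3 : ℝ) : ℂ) * I := by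
      push_cast
      ring_nf
      rw [show I ^ 3 = -I by rw [pow_succ, I_sq]; ring, I_sq]
      ring
    rw [this]
    simp only [add_re, ofReal_re, re_ofReal_mul, I_re, mul_zero]
    ring
  rw [airyContourIntegrand, sub_eq_add_neg, exp_add, norm_mul, norm_mul, norm_pow, h1, gaussWeight]
  have h2 := norm_neg_one_add_mul_I_le t
  calc ‖exp (s * (-1 + t * I))‖ * (Real.exp (1 / 3) * Real.exp (-1 * t ^ 2)) * ‖(-1 + t * I : ℂ)‖ ^ j
      ≤ Real.exp (R * (1 + |t|)) * (Real.exp (1 / 3) * Real.exp (-1 * t ^ 2)) * (1 + |t|) ^ j := by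
        gcongr
        exact norm_exp_mul_le hs h2
    _ = _ := by ring

theorem continuous_airyContourIntegrand (j : ℕ) (s : ℂ) :
    Continuous (airyContourIntegrand j s) := by
  unfold airyContourIntegrand; fun_prop

theorem integrable_airyContourIntegrand (j : ℕ) (s : ℂ) :
    Integrable (airyContourIntegrand j s) :=
  ((integrable_gaussWeight one_pos ‖s‖ j).const_mul _).mono'
    (continuous_airyContourIntegrand j s).aestronglyMeasurable
    (ae_of_all _ fun t => norm_airyContourIntegrand_le j le_rfl t)

theorem hasDerivAt_airyContour (j : ℕ) (s : ℂ) :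
    HasDerivAt (airyContour j) (airyContour (j + 1) s) s := by
  have key := hasDerivAt_integral_of_dominated_loc_of_deriv_le (𝕜 := ℂ) (μ := volume)
    (F := airyContourIntegrand j) (F' := airyContourIntegrand (j + 1))
    (bound := fun t => Real.exp (1 / 3) * gaussWeight 1 (‖s‖ + 1) (j + 1) t)
    (x₀ := s) (Metric.ball_mem_nhds s one_pos)
    (Eventually.of_forall fun y => (continuous_airyContourIntegrand j y).aestronglyMeasurable)
    (integrable_airyContourIntegrand j s)
    (continuous_airyContourIntegrand (j + 1) s).aestronglyMeasurable
    (ae_of_all _ fun t y hy => norm_airyContourIntegrand_le _ ?_ t)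
    ((integrable_gaussWeight one_pos _ _).const_mul _) (ae_of_all _ fun t y _ => ?_)
  · exact key.2.const_mul _
  · have h1 : ‖y - s‖ < 1 := by simpa [dist_eq_norm] using hy
    have h2 := norm_le_norm_add_norm_sub' y s
    linarith
  · have h1 : HasDerivAt (fun y : ℂ => y * (-1 + t * I) - (-1 + t * I) ^ 3 / 3)
        (1 * (-1 + t * I)) y := ((hasDerivAt_id y).mul_const _).sub_const _
    refine (h1.cexp.mul_const ((-1 + t * I : ℂ) ^ j)).congr_deriv ?_
    rw [airyContourIntegrand]
    ring

/-- The Airy differential equation. -/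
theorem airyContour_two (s : ℂ) : airyContour 2 s = s * airyContour 0 s := by
  have hd : ∀ t : ℝ, HasDerivAt (airyContourIntegrand 0 s)
      (I * (s * airyContourIntegrand 0 s t - airyContourIntegrand 2 s t)) t := by
    intro t
    have h0 : HasDerivAt (fun t : ℝ => (-1 + t * I : ℂ)) (1 * I) t :=
      (((hasDerivAt_id t).ofReal_comp).mul_const I).const_add (-1)
    have h1 := (((h0.const_mul s).sub ((h0.pow 3).div_const 3)).cexp).mul_const (1 : ℂ)
    refine HasDerivAt.congr_deriv (h1.congr_of_eventuallyEq (Eventually.of_forall fun u => ?_)) ?_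
    · simp [airyContourIntegrand]
    · simp only [airyContourIntegrand, Pi.sub_apply, Pi.pow_apply]
      push_cast
      ring
  -- With ω = -1 + it, the phase sω - ω³/3 has ω-derivative s - ω², so the integrand of the
  -- difference is a total derivative.
  have h := integral_eq_zero_of_hasDerivAt_of_integrable hd
    ((((integrable_airyContourIntegrand 0 s).const_mul s).sub
      (integrable_airyContourIntegrand 2 s)).const_mul I) (integrable_airyContourIntegrand 0 s)
  rw [integral_const_mul, integral_sub ((integrable_airyContourIntegrand 0 s).const_mul s)
    (integrable_airyContourIntegrand 2 s), integral_const_mul] at h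
  have h2 := (mul_eq_zero.1 h).resolve_left I_ne_zero
  rw [airyContour, airyContour, ← sub_eq_zero.1 h2]
  ring

/-- The substitution ω = -z, that is t ↦ -t, carries the line Re ω = -1 to Re z = 1. Conjugation
symmetry makes the integral real, so taking the real part loses nothing. -/
theorem airyContour_zero_ofReal (x : ℝ) : airyContour 0 x = (airyAi x : ℂ) := by
  have h1 : ∫ t : ℝ, airyContourIntegrand 0 x t = ∫ t : ℝ, airyIntegrand x t := by
    rw [← integral_neg_eq_self]
    refine integral_congr_ae (ae_of_all _ fun t => ?_)
    simp only [airyContourIntegrand, airyIntegrand, pow_zero, mul_one]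
    congr 1
    push_cast
    ring
  have h2 : (starRingEnd ℂ) (∫ t : ℝ, airyIntegrand x t) = ∫ t : ℝ, airyIntegrand x t := by
    rw [← integral_conj, ← integral_neg_eq_self]
    refine integral_congr_ae (ae_of_all _ fun t => ?_)
    simp only [airyIntegrand, ← exp_conj]
    congr 1
    simp [map_ofNat]
  have h3 : (starRingEnd ℂ) (airyContour 0 x) = airyContour 0 x := by
    rw [airyContour, h1, map_mul, h2]
    congr 1
    simp [map_ofNat]
  rw [← conj_eq_iff_re.1 h3, airyAi, airyContour, h1]

theorem airyContour_one_ofReal (x : ℝ) : airyContour 1 x = ((deriv airyAi x : ℝ) : ℂ) := by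
  have h1 := (hasDerivAt_airyContour 0 (x : ℂ)).comp_ofReal
  have h2 := (differentiable_airyAi x).hasDerivAt.ofReal_comp
  simp only [airyContour_zero_ofReal] at h1
  exact h1.unique h2

theorem continuous_airyContour (j : ℕ) : Continuous (airyContour j) :=
  continuous_iff_continuousAt.2 fun s => (hasDerivAt_airyContour j s).continuousAt

/-- The kernel of the complex Airy function. -/
noncomputable def airyWronskiKernel : ℂ → ℂ → ℂ :=
  wronskiKernel (airyContour 0) (airyContour 1) (airyContour 2)

/-- Ai'' = x Ai turns the two second-derivative terms into (x + y) Ai(x) Ai(y). -/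
theorem airyWronskiKernel_ofReal {x y : ℝ} :
    airyWronskiKernel x y = (diffAiryFormula x y : ℂ) := by
  rw [airyWronskiKernel, wronskiKernel, airyContour_two, airyContour_two]
  simp only [airyContour_zero_ofReal, airyContour_one_ofReal, diffAiryFormula]
  push_cast
  ring

end Airy

/-! ### The contour near the degenerate saddle point 1/2 -/

section EdgeContour

open Complex

/-- The logarithm of the left side is 2u + (2/3)u³ + …; the generous cubic constant 2 lets
elementary lower bounds for the exponential suffice. -/
theorem one_add_div_one_sub_le {u : ℝ} (hu : 0 ≤ u) (hu' : u ≤ 1 / 2) :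
    (1 + u) / (1 - u) ≤ Real.exp (2 * u + 2 * u ^ 3) := by
  rw [div_le_iff₀ (by linarith), Real.exp_add]
  have h1 := Real.quadratic_le_exp_of_nonneg (x := 2 * u) (by linarith)
  have h2 := Real.add_one_le_exp (2 * u ^ 3)
  have h3 : 0 ≤ u ^ 3 := by positivity
  have h4 : (1 + 2 * u + (2 * u) ^ 2 / 2) * (2 * u ^ 3 + 1)
      ≤ Real.exp (2 * u) * Real.exp (2 * u ^ 3) :=
    mul_le_mul h1 h2 (by positivity) (Real.exp_pos _).le
  refine le_trans ?_ (mul_le_mul_of_nonneg_right h4 (by linarith))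
  have h5 : 0 ≤ u ^ 3 * (u * (1 - 2 * u ^ 2)) :=
    mul_nonneg h3 (mul_nonneg hu (by nlinarith))
  nlinarith

/-- The circle of radius `1/2 - 1/l`, parametrized at speed close to `1/l`. -/
noncomputable def edgeContour (l t : ℝ) : ℂ :=
  ((1 / 2 - 1 / l : ℝ) : ℂ) * exp (I * ((2 * t / l : ℝ) : ℂ))

theorem continuous_edgeContour (l : ℝ) : Continuous (edgeContour l) := by
  unfold edgeContour; fun_prop

theorem edge_radius_bounds {l : ℝ} (hl : 4 ≤ l) : 1 / 4 ≤ 1 / 2 - 1 / l ∧ 1 / 2 - 1 / l < 1 / 2 := by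
  have h1 : 0 < 1 / l := by positivity
  have h2 : 1 / l ≤ 1 / 4 := one_div_le_one_div_of_le (by norm_num) hl
  constructor <;> linarith

theorem norm_edgeContour {l : ℝ} (hl : 4 ≤ l) (t : ℝ) : ‖edgeContour l t‖ = 1 / 2 - 1 / l := by
  have := edge_radius_bounds hl
  rw [edgeContour, norm_mul, norm_real, Real.norm_of_nonneg (by linarith), norm_exp_I_mul_ofReal,
    mul_one]

theorem edgeContour_ne_zero {l : ℝ} (hl : 4 ≤ l) (t : ℝ) : edgeContour l t ≠ 0 := by
  rw [← norm_pos_iff, norm_edgeContour hl]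
  linarith [edge_radius_bounds hl]

theorem edgeContour_re (l t : ℝ) :
    (edgeContour l t).re = (1 / 2 - 1 / l) * Real.cos (2 * t / l) := by
  rw [edgeContour, re_ofReal_mul, mul_comm I, exp_ofReal_mul_I_re]

theorem norm_one_sub_edgeContour_sq {l : ℝ} (hl : 4 ≤ l) (t : ℝ) :
    ‖1 - edgeContour l t‖ ^ 2 = (1 / 2 + 1 / l) ^ 2
      + 2 * (1 / 2 - 1 / l) * (1 - Real.cos (2 * t / l)) := by
  have h1 : ‖edgeContour l t‖ ^ 2 = (1 / 2 - 1 / l) ^ 2 := by rw [norm_edgeContour hl]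
  rw [← normSq_eq_norm_sq, normSq_apply] at *
  have h2 := edgeContour_re l t
  simp only [sub_re, one_re, sub_im, one_im, zero_sub]
  rw [h2] at h1 ⊢
  linear_combination h1

theorem one_le_norm_div_edgeContour {l : ℝ} (hl : 4 ≤ l) (t : ℝ) :
    1 ≤ ‖(1 - edgeContour l t) / edgeContour l t‖ := by
  have hr := edge_radius_bounds hl
  have h1 := norm_edgeContour hl t
  rw [norm_div, one_le_div (by rw [h1]; linarith)]
  have h2 := norm_sub_norm_le 1 (edgeContour l t)
  rw [norm_one] at h2
  linarith

/-- With δ = 1/l, r = 1/2 - δ and v = 1 - cos(2t/l), the terms linear in δ cancel between the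
quotient and the exponential. There remain 16δ³ and r v ((1/2 + δ)⁻² - 4), the latter negative of
order δt²/l². Since l³ will be 16N, the N-th power is at most e^(1 - t²/12) on the whole circle. -/
theorem norm_edge_base_le {l t : ℝ} (hl : 4 ≤ l) (ht : |t| ≤ Real.pi * l / 2) :
    ‖(1 - edgeContour l t) / edgeContour l t * exp (4 * (edgeContour l t - 1 / 2))‖
      ≤ Real.exp (16 / l ^ 3 * (1 - t ^ 2 / 12)) := by
  have hr := edge_radius_bounds hl
  have hl0 : 0 < l := by linarith
  set δ := 1 / l with hδ
  have hδ0 : 0 < δ := by positivity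
  have hδ4 : δ ≤ 1 / 4 := by linarith
  set r := 1 / 2 - δ with hr_def
  set v := 1 - Real.cos (2 * t / l) with hv
  have hv0 : 0 ≤ v := by linarith [Real.cos_le_one (2 * t / l)]
  have hv1 : 8 * t ^ 2 / (Real.pi ^ 2 * l ^ 2) ≤ v := by
    have h := Real.cos_le_one_sub_mul_cos_sq (x := 2 * t / l) (by
      rw [abs_div, abs_mul, abs_two, abs_of_pos hl0, div_le_iff₀ hl0]
      linarith)
    have e : 2 / Real.pi ^ 2 * (2 * t / l) ^ 2 = 8 * t ^ 2 / (Real.pi ^ 2 * l ^ 2) := by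
      field_simp; ring
    linarith
  have hq : 0 < 1 / 2 + δ := by linarith
  have h1 : ‖1 - edgeContour l t‖ ≤ (1 / 2 + δ) * Real.exp (r * v / (1 / 2 + δ) ^ 2) := by
    refine le_of_sq_le_sq ?_ (by positivity)
    rw [norm_one_sub_edgeContour_sq hl, mul_pow, ← Real.exp_nat_mul]
    have h := Real.add_one_le_exp ((2 : ℕ) * (r * v / (1 / 2 + δ) ^ 2))
    calc (1 / 2 + δ) ^ 2 + 2 * r * v
        = (1 / 2 + δ) ^ 2 * ((2 : ℕ) * (r * v / (1 / 2 + δ) ^ 2) + 1) := by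
          push_cast; field_simp; ring
      _ ≤ _ := by gcongr
  have h2 : ‖exp (4 * (edgeContour l t - 1 / 2))‖ = Real.exp (-(4 * δ) - 4 * r * v) := by
    rw [norm_exp]
    congr 1
    have : (4 * (edgeContour l t - 1 / 2) : ℂ).re = 4 * ((edgeContour l t).re - 1 / 2) := by
      rw [show (4 : ℂ) = ((4 : ℝ) : ℂ) by push_cast; rfl, re_ofReal_mul]
      simp
    rw [this, edgeContour_re]
    simp only [hv, hr_def]
    ring
  have h3 : (1 / 2 + δ) / r ≤ Real.exp (4 * δ + 16 * δ ^ 3) := by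
    have h := one_add_div_one_sub_le (u := 2 * δ) (by linarith) (by linarith)
    have e : (1 + 2 * δ) / (1 - 2 * δ) = (1 / 2 + δ) / r := by
      rw [hr_def, div_eq_div_iff (by linarith) (by linarith)]; ring
    rw [e] at h
    refine h.trans (Real.exp_le_exp.2 (le_of_eq ?_))
    ring
  have hr0 : 0 < r := by linarith
  have h4 : r * v / (1 / 2 + δ) ^ 2 - 4 * r * v ≤ -(4 / 3 * t ^ 2 / l ^ 3) := by
    -- Uses δ ≤ 1/4. Together with r ≥ 1/4 this leaves -(7/4)δv, and the bound on v with π² < 10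
    -- turns 14/π² into at least 4/3.
    have e1 : 1 / (1 / 2 + δ) ^ 2 - 4 ≤ -(7 * δ) := by
      rw [sub_le_iff_le_add, div_le_iff₀ (by positivity)]
      nlinarith [mul_nonneg hδ0.le hδ0.le, mul_nonneg hδ0.le (sub_nonneg.2 hδ4),
        mul_nonneg (mul_nonneg hδ0.le hδ0.le) (sub_nonneg.2 hδ4)]
    have e2 : 4 / 3 * t ^ 2 / l ^ 3 ≤ 7 / 4 * δ * v := by
      have hpi : Real.pi ^ 2 < 10 := by nlinarith [Real.pi_lt_d2, Real.pi_pos]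
      have hpi0 := Real.pi_pos
      calc 4 / 3 * t ^ 2 / l ^ 3 ≤ 7 / 4 * δ * (8 * t ^ 2 / (Real.pi ^ 2 * l ^ 2)) := by
            rw [hδ, show 7 / 4 * (1 / l) * (8 * t ^ 2 / (Real.pi ^ 2 * l ^ 2))
              = 14 * t ^ 2 / l ^ 3 / Real.pi ^ 2 by field_simp; ring, le_div_iff₀ (by positivity)]
            have : 0 ≤ t ^ 2 / l ^ 3 := by positivity
            calc 4 / 3 * t ^ 2 / l ^ 3 * Real.pi ^ 2 = (t ^ 2 / l ^ 3) * (4 / 3 * Real.pi ^ 2) := by ring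
              _ ≤ (t ^ 2 / l ^ 3) * 14 := by gcongr; linarith
              _ = _ := by ring
        _ ≤ _ := by gcongr
    calc r * v / (1 / 2 + δ) ^ 2 - 4 * r * v = r * v * (1 / (1 / 2 + δ) ^ 2 - 4) := by ring
      _ ≤ r * v * (-(7 * δ)) := by gcongr
      _ ≤ -(7 / 4 * δ * v) := by nlinarith [mul_nonneg hδ0.le hv0]
      _ ≤ _ := by linarith
  rw [norm_mul, norm_div, norm_edgeContour hl, h2]
  calc ‖1 - edgeContour l t‖ / r * Real.exp (-(4 * δ) - 4 * r * v)
      ≤ (1 / 2 + δ) * Real.exp (r * v / (1 / 2 + δ) ^ 2) / r * Real.exp (-(4 * δ) - 4 * r * v) := by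
        gcongr
    _ = (1 / 2 + δ) / r * (Real.exp (r * v / (1 / 2 + δ) ^ 2)
          * Real.exp (-(4 * δ) - 4 * r * v)) := by ring
    _ ≤ Real.exp (4 * δ + 16 * δ ^ 3) * (Real.exp (r * v / (1 / 2 + δ) ^ 2)
          * Real.exp (-(4 * δ) - 4 * r * v)) := by gcongr
    _ ≤ _ := by
        rw [← Real.exp_add, ← Real.exp_add]
        refine Real.exp_le_exp.2 ?_
        have : 16 * δ ^ 3 = 16 / l ^ 3 := by rw [hδ]; field_simp
        have e : 16 / l ^ 3 * (1 - t ^ 2 / 12) = 16 / l ^ 3 - 4 / 3 * t ^ 2 / l ^ 3 := by ring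
        rw [e]
        linarith

theorem norm_edge_shift_le {l : ℝ} (hl : 4 ≤ l) (t : ℝ) :
    ‖(l : ℂ) * (edgeContour l t - 1 / 2)‖ ≤ 1 + |t| := by
  have hl0 : 0 < l := by linarith
  have hr := edge_radius_bounds hl
  have e : (l : ℂ) * (edgeContour l t - 1 / 2)
      = -1 + ((l * (1 / 2 - 1 / l) : ℝ) : ℂ) * (exp (I * ((2 * t / l : ℝ) : ℂ)) - 1) := by
    have : (l : ℂ) ≠ 0 := by exact_mod_cast hl0.ne'
    rw [edgeContour]
    push_cast
    field_simp
    ring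
  rw [e]
  refine (norm_add_le _ _).trans ?_
  rw [norm_neg, norm_one, norm_mul, norm_real, Real.norm_of_nonneg (by nlinarith)]
  gcongr
  calc l * (1 / 2 - 1 / l) * ‖exp (I * ((2 * t / l : ℝ) : ℂ)) - 1‖
      ≤ l * (1 / 2) * ‖2 * t / l‖ := by
        gcongr
        · exact hr.2.le
        · exact Real.norm_exp_I_mul_ofReal_sub_one_le
    _ = |t| := by
        rw [Real.norm_eq_abs, abs_div, abs_mul, abs_of_pos hl0, abs_two]
        field_simp

/-- With h = 1/l this is the difference quotient at h = 0 of (1/2 - h) e^(2ith). -/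
theorem tendsto_edge_shift (t : ℝ) :
    Tendsto (fun l : ℝ => (l : ℂ) * (edgeContour l t - 1 / 2)) atTop (𝓝 (-1 + t * I)) := by
  have h1 : Tendsto (fun l : ℝ => l⁻¹) atTop (𝓝[≠] 0) :=
    tendsto_inv_atTop_nhdsGT_zero.mono_right (nhdsWithin_mono _ fun x hx => ne_of_gt hx)
  have h2 : HasDerivAt (fun h : ℝ => ((1 / 2 - h : ℝ) : ℂ) * exp (I * ((2 * t * h : ℝ) : ℂ)))
      (-1 + t * I) 0 := by
    have a1 : HasDerivAt (fun h : ℝ => ((1 / 2 - h : ℝ) : ℂ)) (((-1 : ℝ)) : ℂ) 0 :=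
      ((hasDerivAt_id (0 : ℝ)).const_sub (1 / 2)).ofReal_comp
    have a2 : HasDerivAt (fun h : ℝ => ((2 * t * h : ℝ) : ℂ)) (((2 * t * 1 : ℝ)) : ℂ) 0 :=
      ((hasDerivAt_id (0 : ℝ)).const_mul (2 * t)).ofReal_comp
    refine (a1.mul ((a2.const_mul I).cexp)).congr_deriv ?_
    simp
    ring
  have h3 := (hasDerivAt_iff_tendsto_slope.1 h2).comp h1
  refine h3.congr' ?_
  filter_upwards [eventually_gt_atTop 0] with l hl
  simp [slope, edgeContour, div_eq_mul_inv]

end EdgeContour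

/-! ### Convergence of the rescaled integrals to Airy integrals -/

section EdgeTransform

open Complex

/-- The scale `2 ^ (4/3) N ^ (1/3)` of the soft edge. -/
noncomputable def edgeScale (N : ℕ) : ℝ := (2 : ℝ) ^ (4 / 3 : ℝ) * (N : ℝ) ^ (1 / 3 : ℝ)

theorem edgeScale_pow_three (N : ℕ) : edgeScale N ^ 3 = 16 * N := by
  rw [edgeScale, mul_pow, ← Real.rpow_natCast, ← Real.rpow_natCast, ← Real.rpow_mul (by norm_num),
    ← Real.rpow_mul (by positivity)]
  norm_num

theorem tendsto_edgeScale : Tendsto edgeScale atTop atTop := by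
  unfold edgeScale
  exact ((tendsto_rpow_atTop (by norm_num)).comp tendsto_natCast_atTop_atTop).const_mul_atTop
    (by positivity)

theorem tendsto_inv_edgeScale : Tendsto (fun N : ℕ => ((edgeScale N : ℂ))⁻¹) atTop (𝓝 0) := by
  have := (tendsto_inv_atTop_zero.comp tendsto_edgeScale).ofReal
  simpa using this

/-- The rescaled integrand of the contour integral for `laguerrePoly` near the soft edge. -/
noncomputable def edgeIntegrand (α k N j : ℕ) (s : ℂ) (t : ℝ) : ℂ :=
  ((1 - edgeContour (edgeScale N) t) / edgeContour (edgeScale N) t) ^ (N - k)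
    * (2 * edgeContour (edgeScale N) t) ^ ((α : ℤ) - 2)
    * exp ((4 * N + edgeScale N * s) * (edgeContour (edgeScale N) t - 1 / 2))
    * (edgeScale N * (edgeContour (edgeScale N) t - 1 / 2)) ^ j

/-- The rescaled contour integral for the derivatives of `laguerrePoly` near the soft edge. -/
noncomputable def edgeTransform (α k N j : ℕ) (s : ℂ) : ℂ :=
  1 / (2 * Real.pi) * ∫ t in (-(Real.pi * edgeScale N / 2))..(Real.pi * edgeScale N / 2),
    edgeIntegrand α k N j s t

/-- The majorant depends on neither N nor k. Uniformity in N gives the limit of each integral,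
uniformity in k the interchange of limit and sum. -/
theorem norm_edgeIntegrand_le (α k j : ℕ) {N : ℕ} (hl : 4 ≤ edgeScale N) {s : ℂ} {R : ℝ}
    (hs : ‖s‖ ≤ R) {t : ℝ} (ht : |t| ≤ Real.pi * edgeScale N / 2) :
    ‖edgeIntegrand α k N j s t‖ ≤ 4 * Real.exp 1 * gaussWeight (1 / 12) R j t := by
  have hl3 := edgeScale_pow_three N
  rw [edgeIntegrand]
  set l := edgeScale N
  have hr := edge_radius_bounds hl
  have hbase := norm_edge_base_le hl ht
  have hshift := norm_edge_shift_le hl t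
  have hone := one_le_norm_div_edgeContour hl t
  have hz := norm_edgeContour hl t
  set z := edgeContour l t
  have hl0 : 0 < l := by linarith
  have e1 : exp ((4 * N + l * s) * (z - 1 / 2))
      = exp (4 * (z - 1 / 2)) ^ N * exp (s * (l * (z - 1 / 2))) := by
    rw [← exp_nat_mul, ← exp_add]
    congr 1
    ring
  -- On this circle |(1 - z)/z| ≥ 1, so raising the exponent to N removes k from the bound.
  have h1 : ‖((1 - z) / z) ^ (N - k)‖ ≤ ‖(1 - z) / z‖ ^ N := by
    rw [norm_pow]
    exact pow_le_pow_right₀ hone (Nat.sub_le _ _)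
  -- 1/2 ≤ |2z| ≤ 1, so the worst factor is |2z|⁻².
  have h2 : ‖(2 * z) ^ ((α : ℤ) - 2)‖ ≤ 4 := by
    have hz2 : ‖2 * z‖ = 2 * (1 / 2 - 1 / l) := by rw [norm_mul, hz]; simp
    have hne : ‖2 * z‖ ≠ 0 := by rw [hz2]; linarith
    rw [norm_zpow, zpow_sub₀ hne, zpow_natCast, div_le_iff₀ (by positivity)]
    have h3 : ‖2 * z‖ ^ α ≤ 1 := pow_le_one₀ (norm_nonneg _) (by rw [hz2]; linarith)
    have h4 : (1 / 4 : ℝ) ≤ ‖2 * z‖ ^ (2 : ℤ) := by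
      rw [hz2, show (2 : ℤ) = ((2 : ℕ) : ℤ) by rfl, zpow_natCast]
      nlinarith
    linarith
  have h3 : ‖(1 - z) / z‖ ^ N * ‖exp (4 * (z - 1 / 2))‖ ^ N
      ≤ Real.exp 1 * Real.exp (-(1 / 12) * t ^ 2) := by
    rw [← mul_pow, ← norm_mul, ← Real.exp_add]
    refine (pow_le_pow_left₀ (norm_nonneg _) hbase N).trans ?_
    rw [← Real.exp_nat_mul]
    refine Real.exp_le_exp.2 (le_of_eq ?_)
    have hN : (N : ℝ) * (16 / l ^ 3) = 1 := by
      rw [mul_div_assoc', mul_comm, ← hl3]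
      field_simp
    rw [← mul_assoc, hN]
    ring
  have h4 := norm_exp_mul_le hs hshift
  rw [e1, norm_mul, norm_mul, norm_mul, norm_mul, norm_pow (exp _), norm_pow (_ * (_ - _)),
    gaussWeight]
  calc ‖((1 - z) / z) ^ (N - k)‖ * ‖(2 * z) ^ ((α : ℤ) - 2)‖
        * (‖exp (4 * (z - 1 / 2))‖ ^ N * ‖exp (s * (l * (z - 1 / 2)))‖)
        * ‖(l : ℂ) * (z - 1 / 2)‖ ^ j
      ≤ ‖(1 - z) / z‖ ^ N * 4 * (‖exp (4 * (z - 1 / 2))‖ ^ N * Real.exp (R * (1 + |t|)))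
        * (1 + |t|) ^ j := by gcongr
    _ = (‖(1 - z) / z‖ ^ N * ‖exp (4 * (z - 1 / 2))‖ ^ N) * (4 * Real.exp (R * (1 + |t|))
        * (1 + |t|) ^ j) := by ring
    _ ≤ (Real.exp 1 * Real.exp (-(1 / 12) * t ^ 2)) * (4 * Real.exp (R * (1 + |t|))
        * (1 + |t|) ^ j) := by gcongr
    _ = _ := by ring

theorem norm_log_sub_log_le {u : ℂ} (hu : ‖u‖ ≤ 1 / 2) :
    ‖log (1 - u) - log (1 + u) + 2 * u + 2 / 3 * u ^ 3‖ ≤ ‖u‖ ^ 4 := by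
  have hu1 : ‖u‖ < 1 := by linarith
  have h1 := norm_log_sub_logTaylor_le 3 hu1
  have h2 := norm_log_sub_logTaylor_le 3 (z := -u) (by rwa [norm_neg])
  rw [norm_neg] at h2
  have hT : ∀ z : ℂ, logTaylor (3 + 1) z = z - z ^ 2 / 2 + z ^ 3 / 3 := by
    intro z
    simp [logTaylor, Finset.sum_range_succ]
    ring
  rw [hT] at h1 h2
  have h3 : ‖u‖ ^ (3 + 1) * (1 - ‖u‖)⁻¹ / ((3 : ℕ) + 1) ≤ ‖u‖ ^ 4 * 2 / 4 := by
    have : (1 - ‖u‖)⁻¹ ≤ 2 := by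
      rw [inv_le_comm₀ (by linarith) (by norm_num)]; linarith
    push_cast
    norm_num
    gcongr
  have e : log (1 - u) - log (1 + u) + 2 * u + 2 / 3 * u ^ 3
      = (log (1 + -u) - (-u - (-u) ^ 2 / 2 + (-u) ^ 3 / 3))
        - (log (1 + u) - (u - u ^ 2 / 2 + u ^ 3 / 3)) := by
    rw [← sub_eq_add_neg]; ring
  rw [e]
  refine (norm_sub_le _ _).trans ?_
  linarith [h1.trans h3, h2.trans h3]

/-- With u = 2z - 1 one has (1 - z)/z = (1 - u)/(1 + u) and e^(4N(z - 1/2)) = e^(2Nu). The logarithm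
of the product is -(2/3)Nu³ + O(N|u|⁴). As u = 2ω/l and l³ = 16N, the cubic term is exactly -ω³/3
and the remainder is O(1/l). -/
theorem tendsto_edge_base_pow (t : ℝ) :
    Tendsto (fun N : ℕ => ((1 - edgeContour (edgeScale N) t) / edgeContour (edgeScale N) t) ^ N
      * exp (4 * N * (edgeContour (edgeScale N) t - 1 / 2))) atTop
      (𝓝 (exp (-((-1 + t * I) ^ 3 / 3)))) := by
  set ω : ℕ → ℂ := fun N => edgeScale N * (edgeContour (edgeScale N) t - 1 / 2) with hω
  have hlim : Tendsto ω atTop (𝓝 (-1 + t * I)) := (tendsto_edge_shift t).comp tendsto_edgeScale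
  have hlinv := tendsto_inv_edgeScale
  have hu : Tendsto (fun N => 2 * (ω N * ((edgeScale N : ℂ))⁻¹)) atTop (𝓝 0) := by
    simpa using (hlim.mul hlinv).const_mul 2
  have hev : ∀ᶠ N : ℕ in atTop, 4 ≤ edgeScale N := tendsto_edgeScale.eventually_ge_atTop 4
  have hu2 : ∀ᶠ N in atTop, ‖2 * (ω N * ((edgeScale N : ℂ))⁻¹)‖ ≤ 1 / 2 :=
    (hu.norm.eventually (ge_mem_nhds (by norm_num)))
  set u : ℕ → ℂ := fun N => 2 * (ω N * ((edgeScale N : ℂ))⁻¹) with hu_def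
  have hrem : Tendsto (fun N : ℕ => (N : ℂ) * (log (1 - u N) - log (1 + u N) + 2 * u N
      + 2 / 3 * u N ^ 3)) atTop (𝓝 0) := by
    have hb : Tendsto (fun N => ‖ω N‖ ^ 4 * ‖((edgeScale N : ℂ))⁻¹‖) atTop (𝓝 0) := by
      simpa using (hlim.norm.pow 4).mul hlinv.norm
    refine squeeze_zero_norm' ?_ hb
    filter_upwards [hev, hu2] with N hl hN
    have hl0 : 0 < edgeScale N := by linarith
    have hN3 : (N : ℝ) = edgeScale N ^ 3 / 16 := by rw [edgeScale_pow_three]; ring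
    rw [norm_mul, Complex.norm_natCast]
    refine (mul_le_mul_of_nonneg_left (norm_log_sub_log_le hN) (Nat.cast_nonneg N)).trans ?_
    rw [hN3]
    simp only [norm_mul, norm_inv, norm_real, Real.norm_of_nonneg hl0.le, Complex.norm_ofNat]
    refine le_of_eq ?_
    field_simp
    norm_num
  have hmain : Tendsto (fun N : ℕ => (N : ℂ) * (log (1 - u N) - log (1 + u N) + 2 * u N
      + 2 / 3 * u N ^ 3) - ω N ^ 3 / 3) atTop (𝓝 (0 - (-1 + t * I) ^ 3 / 3)) :=
    hrem.sub ((hlim.pow 3).div_const 3)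
  rw [zero_sub] at hmain
  refine hmain.cexp.congr' ?_
  filter_upwards [hev, hu2] with N hl hN
  have hl0 : 0 < edgeScale N := by linarith
  have hlC : (edgeScale N : ℂ) ≠ 0 := by exact_mod_cast hl0.ne'
  have hl3 : (edgeScale N : ℂ) ^ 3 = 16 * N := by exact_mod_cast edgeScale_pow_three N
  set z := edgeContour (edgeScale N) t with hz
  have huz : u N = 2 * (z - 1 / 2) := by
    simp only [hu_def, hω]
    field_simp
    rw [hz]
  have hω3 : ω N ^ 3 = 16 * N * (z - 1 / 2) ^ 3 := by
    simp only [hω]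
    rw [mul_pow, hl3]
  have hz0 : z ≠ 0 := edgeContour_ne_zero hl t
  have hz1 : 1 - z ≠ 0 := by
    intro h
    have := one_le_norm_div_edgeContour hl t
    rw [← hz, h] at this
    norm_num at this
  have ez : (1 - z) / z = exp (log (1 - u N) - log (1 + u N)) := by
    rw [exp_sub, exp_log, exp_log]
    · rw [huz, div_eq_div_iff hz0]
      · ring
      · rw [show 1 + 2 * (z - 1 / 2) = 2 * z by ring]
        exact mul_ne_zero two_ne_zero hz0
    · rw [huz, show 1 + 2 * (z - 1 / 2) = 2 * z by ring]
      exact mul_ne_zero two_ne_zero hz0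
    · rw [huz, show 1 - 2 * (z - 1 / 2) = 2 * (1 - z) by ring]
      exact mul_ne_zero two_ne_zero hz1
  rw [ez, ← exp_nat_mul, ← exp_add]
  congr 1
  rw [hω3, huz]
  ring

/-- Since z → 1/2, both ((1 - z)/z)^(-k) and (2z)^(α-2) tend to 1; this is why the limit forgets k
and α. -/
theorem tendsto_edgeIntegrand (α k j : ℕ) (s : ℂ) (t : ℝ) :
    Tendsto (fun N : ℕ => edgeIntegrand α k N j s t) atTop (𝓝 (airyContourIntegrand j s t)) := by
  have hω : Tendsto (fun N : ℕ => (edgeScale N : ℂ) * (edgeContour (edgeScale N) t - 1 / 2)) atTop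
    (𝓝 (-1 + t * I)) := (tendsto_edge_shift t).comp tendsto_edgeScale
  have hlinv := tendsto_inv_edgeScale
  have hev : ∀ᶠ N : ℕ in atTop, 4 ≤ edgeScale N := tendsto_edgeScale.eventually_ge_atTop 4
  have hz : Tendsto (fun N : ℕ => edgeContour (edgeScale N) t) atTop (𝓝 (1 / 2)) := by
    have := (hω.mul hlinv).add_const (1 / 2 : ℂ)
    rw [mul_zero, zero_add] at this
    refine this.congr' ?_
    filter_upwards [hev] with N hl
    have hlC : (edgeScale N : ℂ) ≠ 0 := by
      have : edgeScale N ≠ 0 := by linarith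
      exact_mod_cast this
    field_simp
    ring
  have h1 : Tendsto (fun N : ℕ => ((1 - edgeContour (edgeScale N) t)
      / edgeContour (edgeScale N) t)⁻¹ ^ k) atTop (𝓝 1) := by
    have := (((tendsto_const_nhds (x := (1 : ℂ))).sub hz).div hz (by norm_num)).inv₀ (by norm_num)
      |>.pow k
    rw [show ((1 - 1 / 2) / (1 / 2) : ℂ) = 1 by norm_num, inv_one, one_pow] at this
    exact this
  have h2 : Tendsto (fun N : ℕ => (2 * edgeContour (edgeScale N) t) ^ ((α : ℤ) - 2)) atTop
      (𝓝 1) := by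
    have := (hz.const_mul 2).zpow₀ ((α : ℤ) - 2) (Or.inl (by norm_num))
    convert this using 2
    norm_num
  have h3 := (((((tendsto_edge_base_pow t).mul h1).mul h2).mul
    (hω.const_mul s).cexp).mul (hω.pow j))
  have e : airyContourIntegrand j s t = exp (-((-1 + t * I) ^ 3 / 3)) * 1 * 1
      * exp (s * (-1 + t * I)) * (-1 + t * I) ^ j := by
    rw [airyContourIntegrand, sub_eq_add_neg, exp_add]
    ring
  rw [e]
  refine h3.congr' ?_
  filter_upwards [hev, eventually_ge_atTop k] with N hl hk
  have hne : (1 - edgeContour (edgeScale N) t) / edgeContour (edgeScale N) t ≠ 0 := by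
    rw [← norm_pos_iff]
    linarith [one_le_norm_div_edgeContour hl t]
  rw [edgeIntegrand, pow_sub₀ _ hne hk, inv_pow, add_mul, exp_add]
  ring_nf

theorem measurable_edgeIntegrand (α k N j : ℕ) (s : ℂ) : Measurable (edgeIntegrand α k N j s) := by
  have := (continuous_edgeContour (edgeScale N)).measurable
  unfold edgeIntegrand
  have h : Measurable fun t => (2 * edgeContour (edgeScale N) t) ^ ((α : ℤ) - 2) := by
    cases h : (α : ℤ) - 2 with
    | ofNat n => simp only [Int.ofNat_eq_natCast, zpow_natCast]; fun_prop
    | negSucc n => simp only [zpow_negSucc]; fun_prop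
  fun_prop

theorem tendsto_edgeTransform (α k j : ℕ) (s : ℂ) :
    Tendsto (fun N : ℕ => edgeTransform α k N j s) atTop (𝓝 (airyContour j s)) := by
  have hev : ∀ᶠ N : ℕ in atTop, 4 ≤ edgeScale N := tendsto_edgeScale.eventually_ge_atTop 4
  set S : ℕ → Set ℝ := fun N => Set.Ioc (-(Real.pi * edgeScale N / 2)) (Real.pi * edgeScale N / 2)
  have h := tendsto_integral_filter_of_dominated_convergence (μ := volume) (l := atTop)
    (F := fun N t => (S N).indicator (edgeIntegrand α k N j s) t)
    (f := airyContourIntegrand j s)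
    (fun t => 4 * Real.exp 1 * gaussWeight (1 / 12) ‖s‖ j t) ?_ ?_
    ((integrable_gaussWeight (by norm_num) _ _).const_mul _) ?_
  · refine (h.const_mul (1 / (2 * Real.pi) : ℂ)).congr' ?_
    filter_upwards [hev] with N hl
    have hle : -(Real.pi * edgeScale N / 2) ≤ Real.pi * edgeScale N / 2 := by
      have : 0 ≤ Real.pi * edgeScale N := by have := Real.pi_pos; positivity
      linarith
    rw [edgeTransform, intervalIntegral.integral_of_le hle, integral_indicator measurableSet_Ioc]
  · exact Eventually.of_forall fun N =>
      ((measurable_edgeIntegrand α k N j s).indicator measurableSet_Ioc).aestronglyMeasurable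
  · filter_upwards [hev] with N hl
    refine ae_of_all _ fun t => ?_
    by_cases ht : t ∈ S N
    · simp only [Set.indicator_of_mem ht]
      exact norm_edgeIntegrand_le α k j hl le_rfl (abs_le.2 ⟨ht.1.le, ht.2⟩)
    · simp only [Set.indicator_of_notMem ht, norm_zero]
      exact mul_nonneg (by positivity) (gaussWeight_nonneg _ _ _ _)
  · refine ae_of_all _ fun t => (tendsto_edgeIntegrand α k j s t).congr' ?_
    have : Tendsto (fun N : ℕ => Real.pi * edgeScale N / 2) atTop atTop :=
      (tendsto_edgeScale.const_mul_atTop Real.pi_pos).atTop_div_const two_pos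
    filter_upwards [this.eventually_gt_atTop |t|] with N hN
    rw [Set.indicator_of_mem]
    exact ⟨by linarith [neg_abs_le t], by linarith [le_abs_self t]⟩

theorem exists_norm_edgeTransform_le (α : ℕ) (R : ℝ) :
    ∃ C : ℝ, 0 ≤ C ∧ ∀ k N j : ℕ, j ≤ 2 → 4 ≤ edgeScale N → ∀ s : ℂ, ‖s‖ ≤ R →
      ‖edgeTransform α k N j s‖ ≤ C := by
  have hint : ∀ j, Integrable (fun t => 4 * Real.exp 1 * gaussWeight (1 / 12) R j t) := fun j =>
    (integrable_gaussWeight (by norm_num) _ _).const_mul _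
  have h0 : ∀ j, 0 ≤ ∫ t, 4 * Real.exp 1 * gaussWeight (1 / 12) R j t := fun j =>
    integral_nonneg fun t => mul_nonneg (by positivity) (gaussWeight_nonneg _ _ _ _)
  refine ⟨∑ j ∈ Finset.range 3, ∫ t, 4 * Real.exp 1 * gaussWeight (1 / 12) R j t,
    Finset.sum_nonneg fun j _ => h0 j, fun k N j hj hl s hs => ?_⟩
  refine le_trans ?_ (Finset.single_le_sum
    (f := fun j => ∫ t, 4 * Real.exp 1 * gaussWeight (1 / 12) R j t) (fun j _ => h0 j)
    (Finset.mem_range.2 (Nat.lt_succ_of_le hj)))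
  have hle : -(Real.pi * edgeScale N / 2) ≤ Real.pi * edgeScale N / 2 := by
    have : 0 ≤ Real.pi * edgeScale N := by have := Real.pi_pos; positivity
    linarith
  have h1 : ‖∫ t in (-(Real.pi * edgeScale N / 2))..(Real.pi * edgeScale N / 2),
      edgeIntegrand α k N j s t‖ ≤ ∫ t, 4 * Real.exp 1 * gaussWeight (1 / 12) R j t := by
    rw [intervalIntegral.integral_of_le hle, ← integral_indicator measurableSet_Ioc]
    refine norm_integral_le_of_norm_le (hint j) (ae_of_all _ fun t => ?_)
    by_cases ht : t ∈ Set.Ioc (-(Real.pi * edgeScale N / 2)) (Real.pi * edgeScale N / 2)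
    · simp only [Set.indicator_of_mem ht]
      exact norm_edgeIntegrand_le α k j hl hs (abs_le.2 ⟨ht.1.le, ht.2⟩)
    · simp only [Set.indicator_of_notMem ht, norm_zero]
      exact mul_nonneg (by positivity) (gaussWeight_nonneg _ _ _ _)
  have h2 : ‖(1 / (2 * Real.pi) : ℂ)‖ ≤ 1 := by
    rw [norm_div, norm_mul, norm_real, Real.norm_of_nonneg Real.pi_pos.le]
    simp only [norm_one, Complex.norm_ofNat]
    rw [div_le_one (by positivity)]
    linarith [Real.pi_gt_three]
  rw [edgeTransform, norm_mul]
  calc _ ≤ 1 * _ := mul_le_mul h2 h1 (norm_nonneg _) zero_le_one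
    _ = _ := one_mul _

end EdgeTransform

/-! ### Laguerre kernels in edge coordinates -/

section ContourToEdge

open Complex

theorem circleIntegral_eq_edgeContour {l : ℝ} (hl : 4 ≤ l) (f : ℂ → ℂ) :
    (∮ z in C(0, 1 / 2 - 1 / l), f z) = 2 * I / l *
      ∫ t in (-(Real.pi * l / 2))..(Real.pi * l / 2), edgeContour l t * f (edgeContour l t) := by
  have hl0 : l ≠ 0 := by linarith
  set r := 1 / 2 - 1 / l with hr
  set g : ℝ → ℂ := fun θ => circleMap 0 r θ * I * f (circleMap 0 r θ) with hg
  have hper : Function.Periodic g (2 * Real.pi) := fun θ => by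
    simp only [hg, periodic_circleMap 0 r θ]
  have h1 : (∮ z in C(0, r), f z) = ∫ θ in (-Real.pi)..Real.pi, g θ := by
    have := hper.intervalIntegral_add_eq 0 (-Real.pi)
    rw [zero_add, show -Real.pi + 2 * Real.pi = Real.pi by ring] at this
    rw [← this, circleIntegral]
    simp only [deriv_circleMap, smul_eq_mul, hg]
  have h2 := intervalIntegral.smul_integral_comp_mul_left (a := -(Real.pi * l / 2))
    (b := Real.pi * l / 2) g (2 / l)
  rw [show 2 / l * -(Real.pi * l / 2) = -Real.pi by field_simp,
    show 2 / l * (Real.pi * l / 2) = Real.pi by field_simp] at h2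
  rw [h1, ← h2, real_smul, ← intervalIntegral.integral_const_mul,
    ← intervalIntegral.integral_const_mul]
  refine intervalIntegral.integral_congr fun t _ => ?_
  have hz : circleMap 0 r (2 / l * t) = edgeContour l t := by
    rw [circleMap, edgeContour, zero_add, ← hr]
    congr 2
    push_cast
    ring
  simp only [hg, hz]
  push_cast
  ring

theorem intervalIntegrable_edgeIntegrand (α k j : ℕ) {N : ℕ} (hl : 4 ≤ edgeScale N) (s : ℂ)
    (a b : ℝ) : IntervalIntegrable (edgeIntegrand α k N j s) volume a b := by
  refine Continuous.intervalIntegrable ?_ a b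
  have h := continuous_edgeContour (edgeScale N)
  have h0 := edgeContour_ne_zero hl
  unfold edgeIntegrand
  have h1 : Continuous fun t => (2 * edgeContour (edgeScale N) t) ^ ((α : ℤ) - 2) :=
    (continuous_const.mul h).zpow₀ _ fun t => Or.inl (mul_ne_zero two_ne_zero (h0 t))
  have h2 : Continuous fun t => ((1 - edgeContour (edgeScale N) t) / edgeContour (edgeScale N) t) :=
    (continuous_const.sub h).div h h0
  fun_prop

/-- The expansion of `(1 / 2 + w) ^ i` in terms of `edgeTransform`. -/
theorem laguerreContour_eq_edge {α k N i : ℕ} (hl : 4 ≤ edgeScale N) (hk : k + α ≤ N) (s : ℂ) :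
    laguerreContour (1 / 2 - 1 / edgeScale N) (N - k) (N - k - α + 2) i
        (4 * N + edgeScale N * s)
      = 2 * I / edgeScale N * (2 ^ (2 - (α : ℤ)) * exp ((4 * N + edgeScale N * s) / 2)
        * ∫ t in (-(Real.pi * edgeScale N / 2))..(Real.pi * edgeScale N / 2),
          edgeIntegrand α k N 0 s t * edgeContour (edgeScale N) t ^ i) := by
  rw [laguerreContour, circleIntegral_eq_edgeContour hl]
  refine congrArg (2 * I / (edgeScale N : ℂ) * ·) ?_
  rw [← intervalIntegral.integral_const_mul]
  refine intervalIntegral.integral_congr fun t _ => ?_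
  have hz := edgeContour_ne_zero hl t
  simp only [edgeIntegrand, pow_zero, mul_one]
  set z := edgeContour (edgeScale N) t
  have e1 : exp ((4 * N + edgeScale N * s) * z) = exp ((4 * N + edgeScale N * s) / 2)
      * exp ((4 * N + edgeScale N * s) * (z - 1 / 2)) := by
    rw [← exp_add]; congr 1; ring
  have e2 : z * z ^ ((i : ℤ) - ((N - k - α + 2 : ℕ) : ℤ) - 1)
      = (z ^ (N - k))⁻¹ * z ^ ((α : ℤ) - 2) * z ^ i := by
    rw [← zpow_natCast z i, ← zpow_natCast z (N - k), ← zpow_neg, ← zpow_add₀ hz, ← zpow_add₀ hz]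
    nth_rewrite 1 [← zpow_one z]
    rw [← zpow_add₀ hz]
    congr 1
    omega
  have e3 : (2 : ℂ) ^ (2 - (α : ℤ)) * 2 ^ ((α : ℤ) - 2) = 1 := by
    rw [← zpow_add₀ two_ne_zero]; simp
  rw [e1, mul_zpow, div_pow]
  calc z * ((1 - z) ^ (N - k) * z ^ ((i : ℤ) - ((N - k - α + 2 : ℕ) : ℤ) - 1)
        * (exp ((4 * N + edgeScale N * s) / 2) * exp ((4 * N + edgeScale N * s) * (z - 1 / 2))))
      = (1 - z) ^ (N - k) * (z * z ^ ((i : ℤ) - ((N - k - α + 2 : ℕ) : ℤ) - 1))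
        * (exp ((4 * N + edgeScale N * s) / 2)
          * exp ((4 * N + edgeScale N * s) * (z - 1 / 2))) := by ring
    _ = (1 - z) ^ (N - k) * ((z ^ (N - k))⁻¹ * z ^ ((α : ℤ) - 2) * z ^ i)
        * (exp ((4 * N + edgeScale N * s) / 2)
          * exp ((4 * N + edgeScale N * s) * (z - 1 / 2)))
          * ((2 : ℂ) ^ (2 - (α : ℤ)) * 2 ^ ((α : ℤ) - 2)) := by rw [e2, e3, mul_one]
    _ = _ := by ring

/-- Each derivative puts a factor z = 1/2 + ω/l under the integral; expanding its powers produces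
the ω-moments. -/
theorem laguerrePoly_eval_edge {α k N : ℕ} (hl : 4 ≤ edgeScale N) (hk : k + α ≤ N) (s : ℂ) :
    let A : ℂ := (N - k - α + 2).factorial * (2 / edgeScale N * 2 ^ (2 - (α : ℤ)))
      * exp ((4 * N + edgeScale N * s) / 2)
    let p := laguerrePoly (N - k) (N - k - α + 2)
    p.eval (4 * N + edgeScale N * s) = A * edgeTransform α k N 0 s ∧
    p.derivative.eval (4 * N + edgeScale N * s)
      = A * (edgeTransform α k N 0 s / 2 + edgeTransform α k N 1 s / edgeScale N) ∧
    p.derivative.derivative.eval (4 * N + edgeScale N * s)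
      = A * (edgeTransform α k N 0 s / 4 + edgeTransform α k N 1 s / edgeScale N
        + edgeTransform α k N 2 s / edgeScale N ^ 2) := by
  have hr : 0 < 1 / 2 - 1 / edgeScale N := by linarith [edge_radius_bounds hl]
  have hlC : (edgeScale N : ℂ) ≠ 0 := by
    have : edgeScale N ≠ 0 := by linarith
    exact_mod_cast this
  have hpi : (Real.pi : ℂ) ≠ 0 := by exact_mod_cast Real.pi_ne_zero
  set a := -(Real.pi * edgeScale N / 2)
  set b := Real.pi * edgeScale N / 2
  have hint := fun j => intervalIntegrable_edgeIntegrand α k j hl s a b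
  have hj : ∀ j t, edgeIntegrand α k N j s t = edgeIntegrand α k N 0 s t
      * (edgeScale N * (edgeContour (edgeScale N) t - 1 / 2)) ^ j := fun j t => by
    simp [edgeIntegrand]
  have hT : ∀ j, ∫ t in a..b, edgeIntegrand α k N j s t
      = 2 * Real.pi * edgeTransform α k N j s := fun j => by
    rw [edgeTransform]; field_simp; rfl
  have h0 : ∫ t in a..b, edgeIntegrand α k N 0 s t * edgeContour (edgeScale N) t ^ 0
      = 2 * Real.pi * edgeTransform α k N 0 s := by
    rw [← hT]; simp
  have h1 : ∫ t in a..b, edgeIntegrand α k N 0 s t * edgeContour (edgeScale N) t ^ 1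
      = 2 * Real.pi * (edgeTransform α k N 0 s / 2 + edgeTransform α k N 1 s / edgeScale N) := by
    have : ∀ t, edgeIntegrand α k N 0 s t * edgeContour (edgeScale N) t ^ 1
        = 1 / 2 * edgeIntegrand α k N 0 s t + 1 / edgeScale N * edgeIntegrand α k N 1 s t := by
      intro t
      rw [hj 1]
      field_simp
      ring
    simp only [this]
    rw [intervalIntegral.integral_add ((hint 0).const_mul _) ((hint 1).const_mul _),
      intervalIntegral.integral_const_mul, intervalIntegral.integral_const_mul, hT, hT]
    ring
  have h2 : ∫ t in a..b, edgeIntegrand α k N 0 s t * edgeContour (edgeScale N) t ^ 2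
      = 2 * Real.pi * (edgeTransform α k N 0 s / 4 + edgeTransform α k N 1 s / edgeScale N
        + edgeTransform α k N 2 s / edgeScale N ^ 2) := by
    have : ∀ t, edgeIntegrand α k N 0 s t * edgeContour (edgeScale N) t ^ 2
        = 1 / 4 * edgeIntegrand α k N 0 s t + 1 / edgeScale N * edgeIntegrand α k N 1 s t
          + 1 / edgeScale N ^ 2 * edgeIntegrand α k N 2 s t := by
      intro t
      rw [hj 1, hj 2]
      field_simp
      ring
    simp only [this]
    rw [intervalIntegral.integral_add (((hint 0).const_mul _).add ((hint 1).const_mul _))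
      ((hint 2).const_mul _), intervalIntegral.integral_add ((hint 0).const_mul _)
      ((hint 1).const_mul _), intervalIntegral.integral_const_mul,
      intervalIntegral.integral_const_mul, intervalIntegral.integral_const_mul, hT, hT, hT]
    ring
  have hmain : ∀ i (V : ℂ), ∫ t in a..b, edgeIntegrand α k N 0 s t
      * edgeContour (edgeScale N) t ^ i = 2 * Real.pi * V →
      (Polynomial.derivative^[i] (laguerrePoly (N - k) (N - k - α + 2))).eval
        (4 * N + edgeScale N * s) = (N - k - α + 2).factorial
          * (2 / edgeScale N * 2 ^ (2 - (α : ℤ))) * exp ((4 * N + edgeScale N * s) / 2) * V := by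
    intro i V hV
    have h := iterate_derivative_laguerrePoly_eval hr (N - k) (N - k - α + 2) i
      (4 * N + edgeScale N * s)
    rw [laguerreContour_eq_edge hl hk, hV] at h
    have hne : 2 * Real.pi * I ≠ 0 := mul_ne_zero (mul_ne_zero two_ne_zero hpi) I_ne_zero
    refine mul_left_cancel₀ hne (h.trans ?_)
    ring
  exact ⟨hmain 0 _ h0, hmain 1 _ h1, hmain 2 _ h2⟩

/-- The kernel of `edgeTransform`. -/
noncomputable def edgeKernel (α k N : ℕ) : ℂ → ℂ → ℂ :=
  wronskiKernel (edgeTransform α k N 0) (edgeTransform α k N 1) (edgeTransform α k N 2)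

/-- The kernel is covariant under p ↦ e^(cx) p: all terms with the constant c cancel. So the parts
coming from the 1/2 in z = 1/2 + ω/l drop out, and the kernel scales as l⁻⁴. Two prefactors 2/l make
this l⁻⁶ = 1/(256 N²), which the powers of two and the leading 4 compensate. -/
theorem polyKernel_laguerrePoly_edge {α k N : ℕ} (hl : 4 ≤ edgeScale N) (hk : k + α ≤ N)
    {s u : ℂ} (hsu : s ≠ u) :
    4 * (4 * N) ^ α * exp (-((4 * N + edgeScale N * s) + (4 * N + edgeScale N * u)) / 2)
      * (polyKernel (laguerrePoly (N - k) (N - k - α + 2)) (4 * N + edgeScale N * s)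
          (4 * N + edgeScale N * u)
        / (((N - k).factorial : ℂ) * ((N - k - α + 2).factorial : ℂ)))
      = (N : ℂ) ^ α * (N - k - α + 2).factorial / (N ^ 2 * (N - k).factorial)
        * edgeKernel α k N s u := by
  obtain ⟨s0, s1, s2⟩ := laguerrePoly_eval_edge hl hk s
  obtain ⟨u0, u1, u2⟩ := laguerrePoly_eval_edge hl hk u
  have hl0 : edgeScale N ≠ 0 := by linarith
  have hlC : (edgeScale N : ℂ) ≠ 0 := by exact_mod_cast hl0
  have hl3 : (edgeScale N : ℂ) ^ 3 = 16 * N := by exact_mod_cast edgeScale_pow_three N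
  have hN : (N : ℂ) ≠ 0 := by
    intro h
    rw [h, mul_zero] at hl3
    exact hlC (pow_eq_zero_iff (by norm_num) |>.1 hl3)
  have hsu' : s - u ≠ 0 := sub_ne_zero.2 hsu
  rw [polyKernel, edgeKernel, wronskiKernel, wronskiKernel, s0, s1, s2, u0, u1, u2]
  have e1 : exp (-((4 * N + edgeScale N * s) + (4 * N + edgeScale N * u)) / 2)
      * (exp ((4 * N + edgeScale N * s) / 2) * exp ((4 * N + edgeScale N * u) / 2)) = 1 := by
    rw [← exp_add, ← exp_add]
    rw [← exp_zero]
    congr 1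
    ring
  have e2 : (4 : ℂ) ^ α * (2 ^ (2 - (α : ℤ)) * 2 ^ (2 - (α : ℤ))) = 16 := by
    rw [← zpow_add₀ two_ne_zero, show (4 : ℂ) = 2 ^ (2 : ℤ) by norm_num, ← zpow_natCast,
      ← zpow_mul, ← zpow_add₀ two_ne_zero]
    rw [show (2 : ℤ) * α + (2 - α + (2 - α)) = 4 by ring]
    norm_num
  have e3 : ∀ X : ℂ, X / (N : ℂ) ^ 2 = 256 * X / (edgeScale N : ℂ) ^ 6 := by
    intro X
    have : (edgeScale N : ℂ) ^ 6 = 256 * N ^ 2 := by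
      rw [show (6 : ℕ) = 3 * 2 by norm_num, pow_mul, hl3]; ring
    rw [this]
    field_simp
  have hd : (4 * (N : ℂ) + edgeScale N * s) - (4 * N + edgeScale N * u)
      = edgeScale N * (s - u) := by ring
  rw [hd]
  have hf1 : ((N - k).factorial : ℂ) ≠ 0 := by exact_mod_cast (N - k).factorial_ne_zero
  have hf2 : ((N - k - α + 2).factorial : ℂ) ≠ 0 := by
    exact_mod_cast (N - k - α + 2).factorial_ne_zero
  generalize edgeTransform α k N 0 s = a0
  generalize edgeTransform α k N 1 s = a1
  generalize edgeTransform α k N 2 s = a2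
  generalize edgeTransform α k N 0 u = b0
  generalize edgeTransform α k N 1 u = b1
  generalize edgeTransform α k N 2 u = b2
  generalize exp (-((4 * N + edgeScale N * s) + (4 * N + edgeScale N * u)) / 2) = E at e1 ⊢
  generalize exp ((4 * (N : ℂ) + edgeScale N * s) / 2) = E1 at e1 ⊢
  generalize exp ((4 * (N : ℂ) + edgeScale N * u) / 2) = E2 at e1 ⊢
  generalize (2 : ℂ) ^ (2 - (α : ℤ)) = Z at e2 ⊢
  generalize ((N - k - α + 2).factorial : ℂ) = K at hf2 ⊢
  generalize ((N - k).factorial : ℂ) = n at hf1 ⊢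
  generalize s - u = d at hsu' ⊢
  generalize (edgeScale N : ℂ) = l at *
  rw [mul_pow]
  calc _ = (E * (E1 * E2)) * (4 ^ α * (Z * Z)) * (16 * N ^ α * K / (n * l ^ 6)
        * ((a2 * b0 - 2 * a1 * b1 + a0 * b2) / d ^ 2 - 2 * (a1 * b0 - a0 * b1) / d ^ 3)) := by
        field_simp
        ring
    _ = (N : ℂ) ^ α * K / n * (256 * ((a2 * b0 - 2 * a1 * b1 + a0 * b2) / d ^ 2
          - 2 * (a1 * b0 - a0 * b1) / d ^ 3) / l ^ 6) := by
        rw [e1, e2]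
        field_simp
        ring
    _ = _ := by
        rw [← e3]
        field_simp

end ContourToEdge

/-! ### The factorial ratio and its growth in k -/

section FactorialRatio

/-- The ratio `N ^ α (N - k - α + 2)! / (N ² (N - k)!)`. -/
noncomputable def edgeRatio (α k N : ℕ) : ℝ :=
  (N : ℝ) ^ α * (N - k - α + 2).factorial / (N ^ 2 * (N - k).factorial)

theorem edgeRatio_eq {α k N : ℕ} (hk : k + α ≤ N) :
    edgeRatio α k N = (∏ i ∈ Finset.range α, (N : ℝ) / ((N - k + 2 - i : ℕ) : ℝ))
      * (((N - k : ℕ) + 2) / N * (((N - k : ℕ) + 1) / N)) := by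
  set n := N - k with hn
  have h1 : (n - α + 2).factorial * (n + 2).descFactorial α = (n + 2) * ((n + 1) * n.factorial) := by
    have := Nat.factorial_mul_descFactorial (n := n + 2) (k := α) (by omega)
    rw [show n + 2 - α = n - α + 2 by omega] at this
    rw [this, Nat.factorial_succ, Nat.factorial_succ]
  have h2 : ((n - α + 2).factorial : ℝ) * (n + 2).descFactorial α
      = (n + 2) * ((n + 1) * n.factorial) := by exact_mod_cast h1
  have h3 : ((n + 2).descFactorial α : ℝ) ≠ 0 := by
    exact_mod_cast (Nat.descFactorial_pos.2 (by omega)).ne'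
  have h4 : (n.factorial : ℝ) ≠ 0 := by exact_mod_cast n.factorial_ne_zero
  have h5 : ∏ i ∈ Finset.range α, (N : ℝ) / ((n + 2 - i : ℕ) : ℝ)
      = (N : ℝ) ^ α / (n + 2).descFactorial α := by
    rw [Finset.prod_div_distrib, Finset.prod_const, Finset.card_range,
      Nat.descFactorial_eq_prod_range]
    push_cast
    rfl
  have h6 : ((n - α + 2).factorial : ℝ)
      = (n + 2) * ((n + 1) * n.factorial) / (n + 2).descFactorial α := by
    rw [eq_div_iff h3, h2]
  rw [edgeRatio, h5, h6]
  by_cases hN : (N : ℝ) = 0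
  · simp [hN]
  · field_simp
    rw [hn]

theorem tendsto_natCast_sub_div (k : ℕ) (a : ℝ) :
    Tendsto (fun N : ℕ => ((N - k : ℕ) + a) / (N : ℝ)) atTop (𝓝 1) := by
  have h1 : Tendsto (fun N : ℕ => 1 + (a - k) * ((N : ℝ))⁻¹) atTop (𝓝 1) := by
    simpa using ((tendsto_inv_atTop_zero.comp
      (tendsto_natCast_atTop_atTop (R := ℝ))).const_mul (a - k)).const_add 1
  refine h1.congr' ?_
  filter_upwards [eventually_ge_atTop k, eventually_gt_atTop 0] with N hk hN
  have : (N : ℝ) ≠ 0 := by exact_mod_cast hN.ne'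
  rw [Nat.cast_sub hk]
  field_simp
  ring

theorem tendsto_edgeRatio (α k : ℕ) : Tendsto (fun N => edgeRatio α k N) atTop (𝓝 1) := by
  have h1 : ∀ i : ℕ, Tendsto (fun N : ℕ => (N : ℝ) / ((N - k + 2 - i : ℕ) : ℝ)) atTop (𝓝 1) := by
    intro i
    have := (tendsto_natCast_sub_div k (2 - i)).inv₀ one_ne_zero
    rw [inv_one] at this
    refine this.congr' ?_
    filter_upwards [eventually_ge_atTop (k + i)] with N hN
    rw [inv_div, Nat.cast_sub (show i ≤ N - k + 2 by omega), Nat.cast_add, Nat.cast_ofNat,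
      add_sub_assoc]
  have h2 : Tendsto (fun N : ℕ => (∏ i ∈ Finset.range α, (N : ℝ) / ((N - k + 2 - i : ℕ) : ℝ))
      * ((((N - k : ℕ) : ℝ) + 2) / N * ((((N - k : ℕ) : ℝ) + 1) / N))) atTop (𝓝 1) := by
    have := (tendsto_finsetProd (Finset.range α) fun i _ => h1 i).mul
      ((tendsto_natCast_sub_div k 2).mul (tendsto_natCast_sub_div k 1))
    simpa using this
  refine h2.congr' ?_
  filter_upwards [eventually_ge_atTop (k + α)] with N hN
  rw [edgeRatio_eq hN]

theorem edgeRatio_nonneg (α k N : ℕ) : 0 ≤ edgeRatio α k N := by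
  unfold edgeRatio; positivity

/-- For k close to N the ratio is not near 1. Since k + α ≤ N, each of its α factors is at most α +
k + 1, a polynomial growth in k that the weight 1/k! beats. -/
theorem edgeRatio_le {α k N : ℕ} (hN : 0 < N) (hk : k + α ≤ N) :
    edgeRatio α k N ≤ 6 * (α + k + 1) ^ α := by
  have hN' : (1 : ℝ) ≤ N := by exact_mod_cast hN
  rw [edgeRatio_eq hk]
  have h1 : ∏ i ∈ Finset.range α, (N : ℝ) / ((N - k + 2 - i : ℕ) : ℝ) ≤ ((α : ℝ) + k + 1) ^ α := by
    calc _ ≤ ∏ _i ∈ Finset.range α, ((α : ℝ) + k + 1) := by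
          refine Finset.prod_le_prod (fun i _ => by positivity) fun i hi => ?_
          have hi' := Finset.mem_range.1 hi
          obtain ⟨q, hq⟩ : ∃ q, N - k + 2 - i = q + 3 := ⟨N - k + 2 - i - 3, by omega⟩
          rw [hq, div_le_iff₀ (by positivity)]
          have h2 : N ≤ q + α + k := by omega
          have h3 : (N : ℝ) ≤ q + α + k := by exact_mod_cast h2
          push_cast
          have hq0 : (0 : ℝ) ≤ q := Nat.cast_nonneg q
          have ha0 : (0 : ℝ) ≤ α := Nat.cast_nonneg α
          have hk0 : (0 : ℝ) ≤ k := Nat.cast_nonneg k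
          nlinarith [mul_nonneg ha0 hq0, mul_nonneg hk0 hq0]
      _ = _ := by simp
  have h2 : (((N - k : ℕ) : ℝ) + 2) / N * ((((N - k : ℕ) : ℝ) + 1) / N) ≤ 3 * 2 := by
    have h3 : ((N - k : ℕ) : ℝ) ≤ N := by exact_mod_cast Nat.sub_le N k
    gcongr
    · rw [div_le_iff₀ (by linarith)]; linarith
    · rw [div_le_iff₀ (by linarith)]; linarith
  calc _ ≤ ((α : ℝ) + k + 1) ^ α * (3 * 2) := by gcongr
    _ = _ := by ring

theorem summable_edge_bound (c : ℝ) (α : ℕ) :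
    Summable fun k : ℕ => |c| ^ k / k.factorial * (6 * ((α : ℝ) + k + 1) ^ α) := by
  have h := (Real.summable_pow_div_factorial (|c| * Real.exp 1)).mul_left
    (6 * α.factorial * Real.exp (α + 1))
  refine h.of_nonneg_of_le (fun k => by positivity) fun k => ?_
  have h1 := Real.pow_div_factorial_le_exp ((α : ℝ) + k + 1) (by positivity) α
  rw [div_le_iff₀' (by positivity)] at h1
  have h2 : Real.exp ((α : ℝ) + k + 1) = Real.exp (α + 1) * Real.exp 1 ^ k := by
    rw [← Real.exp_nat_mul, ← Real.exp_add]
    congr 1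
    ring
  rw [h2] at h1
  calc |c| ^ k / k.factorial * (6 * ((α : ℝ) + k + 1) ^ α)
      ≤ |c| ^ k / k.factorial * (6 * (α.factorial * (Real.exp (α + 1) * Real.exp 1 ^ k))) := by
        gcongr
    _ = _ := by rw [mul_pow]; ring

end FactorialRatio

/-! ### The limit off the diagonal -/

section EdgeLimit

open Complex

theorem norm_wronskiKernel_le {f₀ f₁ f₂ : ℂ → ℂ} {s u : ℂ} {C d : ℝ} (hd : 0 < d)
    (hdist : d ≤ ‖s - u‖) (hs₀ : ‖f₀ s‖ ≤ C) (hs₁ : ‖f₁ s‖ ≤ C) (hs₂ : ‖f₂ s‖ ≤ C)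
    (hu₀ : ‖f₀ u‖ ≤ C) (hu₁ : ‖f₁ u‖ ≤ C) (hu₂ : ‖f₂ u‖ ≤ C) :
    ‖wronskiKernel f₀ f₁ f₂ s u‖ ≤ 4 * C ^ 2 / d ^ 2 + 4 * C ^ 2 / d ^ 3 := by
  have hC : 0 ≤ C := (norm_nonneg _).trans hs₀
  have hm : ∀ {a b : ℂ}, ‖a‖ ≤ C → ‖b‖ ≤ C → ‖a * b‖ ≤ C ^ 2 := fun ha hb => by
    rw [norm_mul, pow_two]
    exact mul_le_mul ha hb (norm_nonneg _) hC
  have h1 : ‖f₂ s * f₀ u - 2 * f₁ s * f₁ u + f₀ s * f₂ u‖ ≤ 4 * C ^ 2 := by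
    have e : ‖2 * f₁ s * f₁ u‖ ≤ 2 * C ^ 2 := by
      rw [mul_assoc, norm_mul, Complex.norm_ofNat]
      exact mul_le_mul_of_nonneg_left (hm hs₁ hu₁) (by norm_num)
    have := (norm_add_le (f₂ s * f₀ u - 2 * f₁ s * f₁ u) (f₀ s * f₂ u)).trans
      (add_le_add_left (norm_sub_le _ _) _)
    linarith [hm hs₂ hu₀, hm hs₀ hu₂]
  have h2 : ‖2 * (f₁ s * f₀ u - f₀ s * f₁ u)‖ ≤ 4 * C ^ 2 := by
    rw [norm_mul, Complex.norm_ofNat]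
    have := norm_sub_le (f₁ s * f₀ u) (f₀ s * f₁ u)
    linarith [hm hs₁ hu₀, hm hs₀ hu₁]
  rw [wronskiKernel]
  refine (norm_sub_le _ _).trans ?_
  rw [norm_div, norm_div, norm_pow, norm_pow]
  gcongr

theorem tendsto_edgeKernel (α k : ℕ) (s u : ℂ) :
    Tendsto (fun N => edgeKernel α k N s u) atTop (𝓝 (airyWronskiKernel s u)) := by
  have h := fun j s => tendsto_edgeTransform α k j s
  simp only [edgeKernel, airyWronskiKernel, wronskiKernel]
  exact (((((h 2 s).mul (h 0 u)).sub (((h 1 s).const_mul 2).mul (h 1 u))).add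
    ((h 0 s).mul (h 2 u))).div_const _).sub
    (((((h 1 s).mul (h 0 u)).sub ((h 0 s).mul (h 1 u))).const_mul 2).div_const _)

theorem exists_norm_edgeKernel_le (α : ℕ) (R : ℝ) {d : ℝ} (hd : 0 < d) :
    ∃ B : ℝ, 0 ≤ B ∧ ∀ k N : ℕ, 4 ≤ edgeScale N → ∀ s u : ℂ, ‖s‖ ≤ R → ‖u‖ ≤ R →
      d ≤ ‖s - u‖ → ‖edgeKernel α k N s u‖ ≤ B := by
  obtain ⟨C, hC0, hC⟩ := exists_norm_edgeTransform_le α R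
  refine ⟨4 * C ^ 2 / d ^ 2 + 4 * C ^ 2 / d ^ 3, by positivity, fun k N hl s u hs hu hsu => ?_⟩
  have h := fun j hj s hs => hC k N j hj hl s hs
  exact norm_wronskiKernel_le hd hsu (h 0 (by norm_num) s hs) (h 1 (by norm_num) s hs)
    (h 2 le_rfl s hs) (h 0 (by norm_num) u hu) (h 1 (by norm_num) u hu) (h 2 le_rfl u hu)

variable {Q : Measure ℝ} [IsProbabilityMeasure Q]

/-- The correlation function near the soft edge, normalized by `(4 N) ^ α` in place of
`(x y) ^ (α / 2)`. -/
noncomputable def edgeCorr (Q : Measure ℝ) (α N : ℕ) (s u : ℂ) : ℂ :=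
  4 * (4 * N) ^ α * exp (-((4 * N + edgeScale N * s) + (4 * N + edgeScale N * u)) / 2)
    * (gramCorr Q N (N - α) (4 * N + edgeScale N * s) (4 * N + edgeScale N * u)
      / ((N.factorial : ℂ) * ((N - α).factorial : ℂ)))

theorem edgeCorr_eq_sum {b : ℝ} (hmean : ∫ x, x ∂Q = 0)
    (hsq : ∫ x, x ^ 2 ∂Q = 1) (hfinite : MemLp (fun x : ℝ => x) 4 Q)
    (hfourth : ∫ x, x ^ 4 ∂Q = b) {α N : ℕ} (hl : 4 ≤ edgeScale N) (hN : α ≤ N)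
    {s u : ℂ} (hsu : s ≠ u) :
    edgeCorr Q α N s u = ∑ k ∈ Finset.range (N - α + 1), ((b - 3 : ℝ) : ℂ) ^ k / (k.factorial : ℂ)
      * (edgeRatio α k N * edgeKernel α k N s u) := by
  have hlC : (edgeScale N : ℂ) ≠ 0 := by
    have : edgeScale N ≠ 0 := by linarith
    exact_mod_cast this
  have hxy : 4 * (N : ℂ) + edgeScale N * s ≠ 4 * N + edgeScale N * u := fun h =>
    hsu (mul_left_cancel₀ hlC (add_left_cancel h))
  rw [edgeCorr, gramCorr_div_factorial hmean hsq hfinite hfourth (Nat.sub_le N α) hxy,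
    Finset.mul_sum]
  refine Finset.sum_congr rfl fun k hk => ?_
  have hk' : k + α ≤ N := by
    have := Finset.mem_range.1 hk
    omega
  have h := polyKernel_laguerrePoly_edge hl hk' hsu
  rw [Nat.sub_right_comm, mul_left_comm, h, edgeRatio]
  push_cast
  ring

theorem edgeCorr_term_norm_le {c : ℝ} {α k N : ℕ} (hN : 0 < N) (hk : k + α ≤ N)
    {W : ℂ} {B : ℝ} (hB : ‖W‖ ≤ B) :
    ‖(c : ℂ) ^ k / (k.factorial : ℂ) * (edgeRatio α k N * W)‖
      ≤ |c| ^ k / k.factorial * (6 * ((α : ℝ) + k + 1) ^ α) * B := by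
  rw [norm_mul, norm_mul, norm_div, norm_pow, norm_real, norm_real, Complex.norm_natCast,
    Real.norm_eq_abs, Real.norm_of_nonneg (edgeRatio_nonneg α k N), mul_assoc]
  have := edgeRatio_le hN hk
  gcongr

/-- Termwise, the factorial ratio tends to 1 and the kernel to the Airy kernel. The majorant is
summable in k, so the sum tends to the exponential series in b - 3 times that kernel. -/
theorem tendsto_edgeCorr_of_ne {b : ℝ} (hmean : ∫ x, x ∂Q = 0)
    (hsq : ∫ x, x ^ 2 ∂Q = 1) (hfinite : MemLp (fun x : ℝ => x) 4 Q)
    (hfourth : ∫ x, x ^ 4 ∂Q = b) (α : ℕ) {s u : ℂ} (hsu : s ≠ u) :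
    Tendsto (fun N => edgeCorr Q α N s u) atTop
      (𝓝 (exp ((b - 3 : ℝ) : ℂ) * airyWronskiKernel s u)) := by
  set c := b - 3
  obtain ⟨B, hB0, hB⟩ := exists_norm_edgeKernel_le α (max ‖s‖ ‖u‖)
    (norm_pos_iff.2 (sub_ne_zero.2 hsu))
  have hev : ∀ᶠ N : ℕ in atTop, 4 ≤ edgeScale N := tendsto_edgeScale.eventually_ge_atTop 4
  have h := tendsto_tsum_of_dominated_convergence (𝓕 := atTop)
    (f := fun N k => if k ∈ Finset.range (N - α + 1) then (c : ℂ) ^ k / (k.factorial : ℂ)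
      * (edgeRatio α k N * edgeKernel α k N s u) else 0)
    (g := fun k => (c : ℂ) ^ k / (k.factorial : ℂ) * ((1 : ℝ) * airyWronskiKernel s u))
    (bound := fun k => |c| ^ k / k.factorial * (6 * ((α : ℝ) + k + 1) ^ α) * B)
    ((summable_edge_bound c α).mul_right B) (fun k => ?_) ?_
  · have hg : ∑' k : ℕ, (c : ℂ) ^ k / (k.factorial : ℂ) * ((1 : ℝ) * airyWronskiKernel s u)
        = exp (c : ℂ) * airyWronskiKernel s u := by
      rw [tsum_mul_right, exp_eq_exp_ℂ, NormedSpace.exp_eq_tsum_div]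
      simp
    rw [hg] at h
    refine h.congr' ?_
    filter_upwards [hev, eventually_ge_atTop α] with N hl hN
    rw [edgeCorr_eq_sum hmean hsq hfinite hfourth hl hN hsu, tsum_eq_sum
      (s := Finset.range (N - α + 1)) fun k hk => if_neg hk]
    exact Finset.sum_congr rfl fun k hk => if_pos hk
  · refine ((((tendsto_edgeRatio α k).ofReal).mul (tendsto_edgeKernel α k s u)).const_mul
      ((c : ℂ) ^ k / (k.factorial : ℂ))).congr' ?_
    filter_upwards [eventually_ge_atTop (k + α)] with N hN
    rw [if_pos (Finset.mem_range.2 (by omega))]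
  · filter_upwards [hev, eventually_ge_atTop α, eventually_gt_atTop 0] with N hl hN hN0 k
    split_ifs with hk
    · have hk' : k + α ≤ N := by
        have := Finset.mem_range.1 hk
        omega
      exact edgeCorr_term_norm_le hN0 hk' (hB k N hl s u (le_max_left _ _) (le_max_right _ _) le_rfl)
    · rw [norm_zero]
      positivity

/-- Supplies the domination for the Cauchy integral; the gap d keeps the powers of s - u in the
denominators under control. -/
theorem exists_norm_edgeCorr_le {b : ℝ} (hmean : ∫ x, x ∂Q = 0)
    (hsq : ∫ x, x ^ 2 ∂Q = 1) (hfinite : MemLp (fun x : ℝ => x) 4 Q)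
    (hfourth : ∫ x, x ^ 4 ∂Q = b) (α : ℕ) (R : ℝ) {d : ℝ} (hd : 0 < d) :
    ∃ B : ℝ, ∀ᶠ N : ℕ in atTop, ∀ s u : ℂ, ‖s‖ ≤ R → ‖u‖ ≤ R →
      d ≤ ‖s - u‖ → ‖edgeCorr Q α N s u‖ ≤ B := by
  obtain ⟨B, hB0, hB⟩ := exists_norm_edgeKernel_le α R hd
  have hsum := (summable_edge_bound (b - 3) α).mul_right B
  refine ⟨∑' k : ℕ, |b - 3| ^ k / k.factorial * (6 * ((α : ℝ) + k + 1) ^ α) * B, ?_⟩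
  have hev : ∀ᶠ N : ℕ in atTop, 4 ≤ edgeScale N := tendsto_edgeScale.eventually_ge_atTop 4
  filter_upwards [hev, eventually_ge_atTop α, eventually_gt_atTop 0] with N hl hN hN0 s u hs hu hsu
  have hne : s ≠ u := by
    rintro rfl
    rw [sub_self, norm_zero] at hsu
    linarith
  rw [edgeCorr_eq_sum hmean hsq hfinite hfourth hl hN hne]
  refine (norm_sum_le _ _).trans ((Finset.sum_le_sum fun k hk => ?_).trans
    (hsum.sum_le_tsum (Finset.range (N - α + 1)) fun k _ => by positivity))
  have hk' : k + α ≤ N := by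
    have := Finset.mem_range.1 hk
    omega
  exact edgeCorr_term_norm_le hN0 hk' (hB k N hl s u hs hu hsu)

end EdgeLimit

/-! ### Crossing the diagonal by Cauchy's formula -/

section CauchyExtension

open Complex

variable {Q : Measure ℝ} [IsProbabilityMeasure Q]

theorem differentiable_edgeCorr_left (hfinite : MemLp (fun x : ℝ => x) 4 Q) (α N : ℕ) (u : ℂ) :
    Differentiable ℂ (fun s => edgeCorr Q α N s u) := by
  have h1 : Differentiable ℂ fun z => gramCorr Q N (N - α) z (4 * N + edgeScale N * u) :=
    fun z => (hasDerivAt_gramCorr_left hfinite N (N - α) z _).differentiableAt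
  have h2 : Differentiable ℂ fun s : ℂ =>
      gramCorr Q N (N - α) (4 * N + edgeScale N * s) (4 * N + edgeScale N * u) :=
    h1.comp (by fun_prop)
  unfold edgeCorr
  exact Differentiable.mul (by fun_prop) (h2.div_const _)

/-- The Cauchy integral of `airyWronskiKernel` in its first variable over the circle of radius `R`
around `0`; it extends the kernel across the diagonal. -/
noncomputable def airyCauchyKernel (R : ℝ) (s u : ℂ) : ℂ :=
  (2 * Real.pi * I : ℂ)⁻¹ • ∮ z in C(0, R), (z - s)⁻¹ • airyWronskiKernel z u

theorem norm_sub_pos_of_circle {R : ℝ} {u : ℂ} (hu : ‖u‖ < R) (θ : ℝ) :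
    R - ‖u‖ ≤ ‖circleMap 0 R θ - u‖ := by
  have h := norm_sub_norm_le (circleMap 0 R θ) u
  rwa [norm_circleMap_zero, abs_of_pos ((norm_nonneg u).trans_lt hu)] at h

theorem circleMap_sub_ne_zero_of_norm_lt {R : ℝ} {u : ℂ} (hu : ‖u‖ < R) (θ : ℝ) :
    circleMap 0 R θ - u ≠ 0 :=
  norm_pos_iff.1 ((sub_pos.2 hu).trans_le (norm_sub_pos_of_circle hu θ))

/-- For each N the function is entire in s, hence the Cauchy integral of its values on |z| = R.
There |z - u| ≥ R - |u| > 0, so the off-diagonal limit and the uniform bound apply under the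
integral, even when s = u. -/
theorem tendsto_edgeCorr_airyCauchyKernel {b : ℝ} (hmean : ∫ x, x ∂Q = 0)
    (hsq : ∫ x, x ^ 2 ∂Q = 1) (hfinite : MemLp (fun x : ℝ => x) 4 Q)
    (hfourth : ∫ x, x ^ 4 ∂Q = b) (α : ℕ) {R : ℝ} {s u : ℂ} (hs : ‖s‖ < R) (hu : ‖u‖ < R) :
    Tendsto (fun N => edgeCorr Q α N s u) atTop
      (𝓝 (exp ((b - 3 : ℝ) : ℂ) * airyCauchyKernel R s u)) := by
  have hR : 0 < R := (norm_nonneg s).trans_lt hs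
  have hcauchy : ∀ N, edgeCorr Q α N s u = (2 * Real.pi * I : ℂ)⁻¹ •
      ∮ z in C(0, R), (z - s)⁻¹ • edgeCorr Q α N z u := fun N =>
    ((differentiable_edgeCorr_left hfinite α N u).diffContOnCl
      (s := Metric.ball 0 R)).two_pi_i_inv_smul_circleIntegral_sub_inv_smul
      (mem_ball_zero_iff.2 hs) |>.symm
  simp_rw [hcauchy]
  have hlim : exp ((b - 3 : ℝ) : ℂ) * airyCauchyKernel R s u = (2 * Real.pi * I : ℂ)⁻¹ •
      ∮ z in C(0, R), (z - s)⁻¹ • (exp ((b - 3 : ℝ) : ℂ) * airyWronskiKernel z u) := by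
    rw [airyCauchyKernel, mul_smul_comm, ← smul_eq_mul (exp _), ← circleIntegral.integral_smul]
    simp only [smul_eq_mul, mul_left_comm]
  rw [hlim]
  refine Tendsto.const_smul ?_ _
  obtain ⟨B, hB⟩ := exists_norm_edgeCorr_le hmean hsq hfinite hfourth α R (sub_pos.2 hu)
  unfold circleIntegral
  refine intervalIntegral.tendsto_integral_filter_of_dominated_convergence
    (fun _ => R * ((R - ‖s‖)⁻¹ * B)) ?_ ?_ intervalIntegrable_const ?_
  · refine Eventually.of_forall fun N => Continuous.aestronglyMeasurable ?_
    have h1 := (differentiable_edgeCorr_left hfinite α N u).continuous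
    have h2 : Continuous fun θ : ℝ => (circleMap 0 R θ - s)⁻¹ :=
      ((continuous_circleMap 0 R).sub continuous_const).inv₀
        (circleMap_sub_ne_zero_of_norm_lt hs)
    simp only [deriv_circleMap, smul_eq_mul]
    exact ((continuous_circleMap 0 R).mul continuous_const).mul
      (h2.mul (h1.comp (continuous_circleMap 0 R)))
  · filter_upwards [hB] with N hN
    refine ae_of_all _ fun θ _ => ?_
    have h1 : ‖(circleMap 0 R θ - s)⁻¹‖ ≤ (R - ‖s‖)⁻¹ := by
      rw [norm_inv]
      exact inv_anti₀ (sub_pos.2 hs) (norm_sub_pos_of_circle hs θ)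
    have h2 := hN (circleMap 0 R θ) u (by simp [abs_of_pos hR]) hu.le
      (norm_sub_pos_of_circle hu θ)
    rw [norm_smul, norm_smul, deriv_circleMap, norm_mul, norm_circleMap_zero, norm_I, mul_one,
      abs_of_pos hR]
    have h3 := (sub_pos.2 hs).le
    gcongr
  · refine ae_of_all _ fun θ _ => ?_
    exact ((tendsto_edgeCorr_of_ne hmean hsq hfinite hfourth α
      (sub_ne_zero.1 (circleMap_sub_ne_zero_of_norm_lt hu θ))).const_smul _).const_smul _

theorem continuousOn_airyCauchyKernel (R : ℝ) :
    ContinuousOn (fun p : ℂ × ℂ => airyCauchyKernel R p.1 p.2) {p | ‖p.1‖ < R ∧ ‖p.2‖ < R} := by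
  rw [continuousOn_iff_continuous_domRestrict]
  refine Continuous.const_smul (M := ℂ) (intervalIntegral.continuous_parametric_intervalIntegral_of_continuous'
    (μ := volume) (f := fun (p : {p : ℂ × ℂ | ‖p.1‖ < R ∧ ‖p.2‖ < R}) θ => deriv (circleMap 0 R) θ •
      (fun z => (z - p.1.1)⁻¹ • airyWronskiKernel z p.1.2) (circleMap 0 R θ)) ?_ _ _) _
  have hz : Continuous fun q : {p : ℂ × ℂ | ‖p.1‖ < R ∧ ‖p.2‖ < R} × ℝ => circleMap 0 R q.2 :=
    (continuous_circleMap 0 R).comp continuous_snd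
  have h1 : Continuous fun q : {p : ℂ × ℂ | ‖p.1‖ < R ∧ ‖p.2‖ < R} × ℝ => q.1.1.1 := by fun_prop
  have h2 : Continuous fun q : {p : ℂ × ℂ | ‖p.1‖ < R ∧ ‖p.2‖ < R} × ℝ => q.1.1.2 := by fun_prop
  have hsub := hz.sub h2
  have hne : ∀ q : {p : ℂ × ℂ | ‖p.1‖ < R ∧ ‖p.2‖ < R} × ℝ, circleMap 0 R q.2 - q.1.1.2 ≠ 0 :=
    fun q => circleMap_sub_ne_zero_of_norm_lt q.1.2.2 q.2
  have hA : ∀ j, Continuous (airyContour j) := continuous_airyContour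
  have hinv : Continuous fun q : {p : ℂ × ℂ | ‖p.1‖ < R ∧ ‖p.2‖ < R} × ℝ =>
      (circleMap 0 R q.2 - q.1.1.1)⁻¹ :=
    (hz.sub h1).inv₀ fun q => circleMap_sub_ne_zero_of_norm_lt q.1.2.1 q.2
  simp only [deriv_circleMap, smul_eq_mul, Function.uncurry_def, airyWronskiKernel, wronskiKernel]
  refine (hz.mul continuous_const).mul (hinv.mul (Continuous.sub ?_ ?_))
  · exact Continuous.div₀ (by fun_prop) (hsub.pow 2) fun q => pow_ne_zero 2 (hne q)
  · exact Continuous.div₀ (by fun_prop) (hsub.pow 3) fun q => pow_ne_zero 3 (hne q)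

theorem isOpen_norm_lt_prod (E : Type*) [SeminormedAddGroup E] (R : ℝ) :
    IsOpen {p : E × E | ‖p.1‖ < R ∧ ‖p.2‖ < R} :=
  (isOpen_lt (continuous_fst.norm) continuous_const).inter
    (isOpen_lt (continuous_snd.norm) continuous_const)

/-- Both sides, times the nonzero e^(b-3), are limits of one sequence. Thus the removability of the
diagonal singularity is read off from the correlation functions (with α = 0) instead of a Taylor
expansion of the Airy function. -/
theorem airyCauchyKernel_of_ne {R : ℝ} {s u : ℂ} (hs : ‖s‖ < R) (hu : ‖u‖ < R) (hsu : s ≠ u)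
    {b : ℝ} (hmean : ∫ x, x ∂Q = 0)
    (hsq : ∫ x, x ^ 2 ∂Q = 1) (hfinite : MemLp (fun x : ℝ => x) 4 Q)
    (hfourth : ∫ x, x ^ 4 ∂Q = b) :
    airyCauchyKernel R s u = airyWronskiKernel s u :=
  mul_left_cancel₀ (exp_ne_zero _) (tendsto_nhds_unique
    (tendsto_edgeCorr_airyCauchyKernel hmean hsq hfinite hfourth 0 hs hu)
    (tendsto_edgeCorr_of_ne hmean hsq hfinite hfourth 0 hsu))

/-- Off the diagonal the two agree by the preceding lemma. The Cauchy integral is continuous, so its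
diagonal value is the limit that defines the kernel there; it is real as a limit of reals. -/
theorem ofReal_diffAiryKernel {b : ℝ} (hmean : ∫ x, x ∂Q = 0)
    (hsq : ∫ x, x ^ 2 ∂Q = 1) (hfinite : MemLp (fun x : ℝ => x) 4 Q)
    (hfourth : ∫ x, x ^ 4 ∂Q = b) {R x y : ℝ} (hx : |x| < R) (hy : |y| < R) :
    (diffAiryKernel x y : ℂ) = airyCauchyKernel R x y := by
  have hne : ∀ {x y : ℝ}, |x| < R → |y| < R → x ≠ y →
      airyCauchyKernel R x y = (diffAiryFormula x y : ℂ) := fun {x y} hx hy hxy => by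
    rw [airyCauchyKernel_of_ne (by simpa using hx) (by simpa using hy)
      (ofReal_injective.ne hxy) hmean hsq hfinite hfourth, airyWronskiKernel_ofReal]
  by_cases hxy : x = y
  · subst hxy
    have hnhds : {p : ℂ × ℂ | ‖p.1‖ < R ∧ ‖p.2‖ < R} ∈ 𝓝 ((x : ℂ), (x : ℂ)) :=
      (isOpen_norm_lt_prod ℂ R).mem_nhds ⟨by simpa using hx, by simpa using hx⟩
    have hc : Tendsto (fun t : ℝ => airyCauchyKernel R x t) (𝓝[≠] x)
        (𝓝 (airyCauchyKernel R x x)) := by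
      have := ((continuousOn_airyCauchyKernel R).continuousAt hnhds).tendsto.comp
        (tendsto_const_nhds.prodMk_nhds (continuous_ofReal.tendsto x))
      exact this.mono_left nhdsWithin_le_nhds
    have hev : (fun t : ℝ => airyCauchyKernel R x t) =ᶠ[𝓝[≠] x]
        fun t => (diffAiryFormula x t : ℂ) := by
      have h1 : ∀ᶠ t in 𝓝[≠] x, |t| < R :=
        nhdsWithin_le_nhds ((isOpen_lt continuous_abs continuous_const).mem_nhds hx)
      filter_upwards [h1, self_mem_nhdsWithin] with t ht hne'
      exact hne hx ht (Ne.symm hne')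
    have hlim := hc.congr' hev
    have hre : Tendsto (fun t => diffAiryFormula x t) (𝓝[≠] x)
        (𝓝 (airyCauchyKernel R x x).re) := by
      simpa [Function.comp_def] using (continuous_re.tendsto _).comp hlim
    have him : (airyCauchyKernel R x x).im = 0 := by
      have : Tendsto (fun _ : ℝ => (0 : ℝ)) (𝓝[≠] x) (𝓝 (airyCauchyKernel R x x).im) := by
        simpa [Function.comp_def] using (continuous_im.tendsto _).comp hlim
      exact tendsto_nhds_unique this tendsto_const_nhds
    rw [diffAiryKernel, if_pos rfl, hre.limUnder_eq]
    apply Complex.ext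
    · simp
    · simp [him]
  · rw [diffAiryKernel, if_neg hxy, hne hx hy hxy]

theorem continuous_diffAiryKernel {b : ℝ} (hmean : ∫ x, x ∂Q = 0)
    (hsq : ∫ x, x ^ 2 ∂Q = 1) (hfinite : MemLp (fun x : ℝ => x) 4 Q)
    (hfourth : ∫ x, x ^ 4 ∂Q = b) :
    Continuous (fun p : ℝ × ℝ => diffAiryKernel p.1 p.2) := by
  rw [continuous_iff_continuousAt]
  rintro ⟨x, y⟩
  obtain ⟨R, hx, hy⟩ : ∃ R, |x| < R ∧ |y| < R :=
    ⟨max |x| |y| + 1, by linarith [le_max_left |x| |y|], by linarith [le_max_right |x| |y|]⟩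
  have hreal : ∀ᶠ p : ℝ × ℝ in 𝓝 (x, y), |p.1| < R ∧ |p.2| < R :=
    (isOpen_norm_lt_prod ℝ R).mem_nhds ⟨hx, hy⟩
  have hnhds : {p : ℂ × ℂ | ‖p.1‖ < R ∧ ‖p.2‖ < R} ∈ 𝓝 ((x : ℂ), (y : ℂ)) :=
    (isOpen_norm_lt_prod ℂ R).mem_nhds ⟨by simpa using hx, by simpa using hy⟩
  have hcont : Tendsto (fun p : ℝ × ℝ => (airyCauchyKernel R p.1 p.2).re) (𝓝 (x, y))
      (𝓝 (airyCauchyKernel R x y).re) := by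
    have h1 : Tendsto (fun p : ℝ × ℝ => ((p.1 : ℂ), (p.2 : ℂ))) (𝓝 (x, y))
        (𝓝 ((x : ℂ), (y : ℂ))) :=
      ((continuous_ofReal.comp continuous_fst).prodMk
        (continuous_ofReal.comp continuous_snd)).tendsto (x, y)
    have h2 : Tendsto (fun p : ℂ × ℂ => airyCauchyKernel R p.1 p.2) (𝓝 ((x : ℂ), (y : ℂ)))
        (𝓝 (airyCauchyKernel R x y)) :=
      ((continuousOn_airyCauchyKernel R).continuousAt hnhds).tendsto
    have h3 := (continuous_re.tendsto _).comp (h2.comp h1)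
    simpa only [Function.comp_def] using h3
  rw [← ofReal_diffAiryKernel hmean hsq hfinite hfourth hx hy, ofReal_re] at hcont
  refine hcont.congr' ?_
  filter_upwards [hreal] with p hp
  rw [← ofReal_diffAiryKernel hmean hsq hfinite hfourth hp.1 hp.2, ofReal_re]

end CauchyExtension

/-! ### The normalization and the final limit -/

theorem softEdgePoint_eq (N : ℕ) (μ : ℝ) : softEdgePoint N μ = 4 * N + edgeScale N * μ := by
  rw [softEdgePoint, edgeScale]; ring

/-- The base of the power is the product of the two edge points. Pulling (4N)² out of it leaves a
factor that tends to 1; the sign conditions are what the real power needs in order to be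
multiplicative. -/
theorem softEdgeNormalization_eq (α : ℕ) {N : ℕ} (hN : 0 < N) (μ ν : ℝ)
    (hx : 0 ≤ 1 + edgeScale N * μ / (4 * N)) (hy : 0 ≤ 1 + edgeScale N * ν / (4 * N)) :
    softEdgeNormalization α N ((2 : ℝ) ^ (4 / 3 : ℝ) * μ) ((2 : ℝ) ^ (4 / 3 : ℝ) * ν)
      = ((1 + edgeScale N * μ / (4 * N)) * (1 + edgeScale N * ν / (4 * N))) ^ ((α : ℝ) / 2)
        * ((4 * N) ^ α
          * Real.exp (-((4 * N + edgeScale N * μ) + (4 * N + edgeScale N * ν)) / 2)) := by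
  have hN' : (0 : ℝ) < N := by exact_mod_cast hN
  have hpow : ((4 * N : ℝ) ^ 2) ^ ((α : ℝ) / 2) = (4 * N) ^ α := by
    rw [← Real.rpow_natCast, ← Real.rpow_mul (by positivity), ← Real.rpow_natCast]
    congr 1
    push_cast
    ring
  have h43 : (N : ℝ) ^ (4 / 3 : ℝ) = N * (N : ℝ) ^ (1 / 3 : ℝ) := by
    rw [show (4 / 3 : ℝ) = 1 + 1 / 3 by norm_num, Real.rpow_add hN', Real.rpow_one]
  have h23 : (N : ℝ) ^ (2 / 3 : ℝ) = (N : ℝ) ^ (1 / 3 : ℝ) * (N : ℝ) ^ (1 / 3 : ℝ) := by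
    rw [← Real.rpow_add hN']; norm_num
  rw [softEdgeNormalization, ← hpow, ← mul_assoc (_ ^ ((α : ℝ) / 2)),
    ← Real.mul_rpow (mul_nonneg hx hy) (by positivity), h43, h23, edgeScale]
  congr 1
  · congr 1
    field_simp
    ring
  · congr 1
    ring

theorem tendsto_edgeScale_mul_div (μ : ℝ) :
    Tendsto (fun N : ℕ => 1 + edgeScale N * μ / (4 * N)) atTop (𝓝 1) := by
  have h1 := ((tendsto_inv_atTop_zero.comp tendsto_edgeScale).pow 2).const_mul (4 * μ)
  have h2 : Tendsto (fun N : ℕ => 1 + 4 * μ * ((edgeScale N)⁻¹) ^ 2) atTop (𝓝 1) := by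
    simpa using h1.const_add 1
  refine h2.congr' ?_
  filter_upwards [tendsto_edgeScale.eventually_gt_atTop 0] with N hl
  have h3 : (4 * N : ℝ) = edgeScale N ^ 3 / 4 := by rw [edgeScale_pow_three]; ring
  rw [h3]
  field_simp

theorem theorem5p2 (Q : Measure ℝ) [IsProbabilityMeasure Q] (b : ℝ)
    (hmean : ∫ x, x ∂Q = 0) (hvar : variance (fun x : ℝ => x) Q = 1)
    (hfinite : MemLp (fun x : ℝ => x) 4 Q) (hfourth : ∫ x, x ^ 4 ∂Q = b)
    (α : ℕ) (Ω : ℕ → Type*) [∀ N, MeasurableSpace (Ω N)]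
    (P : ∀ N, Measure (Ω N)) [∀ N, IsProbabilityMeasure (P N)]
    (X : ∀ N, Ω N → Matrix (Fin N) (Fin (N - α)) ℝ)
    (hX : ∀ N, HasIIDEntries (P N) Q (X N)) :
    (∀ (N : ℕ) (z w : ℂ), Integrable (fun ω => detProduct (X N ω) z w) (P N)) ∧
    Continuous (fun p : ℝ × ℝ => diffAiryKernel p.1 p.2) ∧
    ∀ μ ν : ℝ,
      Tendsto (fun N : ℕ =>
          4 * (softEdgeNormalization α N ((2 : ℝ) ^ (4 / 3 : ℝ) * μ)
              ((2 : ℝ) ^ (4 / 3 : ℝ) * ν) : ℂ)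
            * (charPolyCorrelation (P N) (X N) (softEdgePoint N μ) (softEdgePoint N ν)
              / ((N.factorial : ℂ) * ((N - α).factorial : ℂ))))
        atTop
        (𝓝 ((Real.exp (b - 3) * diffAiryKernel μ ν : ℝ) : ℂ)) := by
  have hsq : ∫ x, x ^ 2 ∂Q = 1 := by
    rw [← hvar, variance_of_integral_eq_zero aemeasurable_id' hmean]
  refine ⟨fun N z w => (hX N).integrable_detProduct hfinite z w,
    continuous_diffAiryKernel hmean hsq hfinite hfourth, fun μ ν => ?_⟩
  set R := |μ| + |ν| + 1
  have hμ : |μ| < R := by have := abs_nonneg ν; linarith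
  have hν : |ν| < R := by have := abs_nonneg μ; linarith
  have hμ' := tendsto_edgeScale_mul_div μ
  have hν' := tendsto_edgeScale_mul_div ν
  -- The discrepancy between the stated normalization and the power (4N)^α in `edgeCorr` disappears
  -- in the limit.
  have hfactor : Tendsto (fun N : ℕ => (((((1 + edgeScale N * μ / (4 * N))
      * (1 + edgeScale N * ν / (4 * N))) ^ ((α : ℝ) / 2) : ℝ)) : ℂ)) atTop (𝓝 1) := by
    have h1 := (hμ'.mul hν').rpow_const (p := (α : ℝ) / 2) (Or.inl (by norm_num))
    rw [mul_one, Real.one_rpow] at h1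
    simpa using h1.ofReal
  have hmain := hfactor.mul (tendsto_edgeCorr_airyCauchyKernel hmean hsq hfinite hfourth α
    (s := μ) (u := ν) (by simpa using hμ) (by simpa using hν))
  rw [← ofReal_diffAiryKernel hmean hsq hfinite hfourth hμ hν, one_mul, ← Complex.ofReal_exp,
    ← Complex.ofReal_mul] at hmain
  refine hmain.congr' ?_
  filter_upwards [eventually_gt_atTop 0, hμ'.eventually_const_le zero_lt_one,
    hν'.eventually_const_le zero_lt_one] with N hN hx hy
  rw [(hX N).charPolyCorrelation_eq, softEdgeNormalization_eq α hN μ ν hx hy, softEdgePoint_eq,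
    softEdgePoint_eq, edgeCorr]
  push_cast
  ring
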